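/- For $\delta\in(0,\infty]$ set $$A_{-\delta}[\phi](x)=\mathrm{p.v.}\!\int_{|x-y|<\delta}\frac{\phi(x)-\phi(y)}{(x-y)^2}\,dy,\qquad A_{\delta}[u](x)=\int_{|x-y|\ge\delta}\frac{u(x)-u(y)}{(x-y)^2}\,dy ,$$ and let $A_0$ be the half-Laplacian $A_0[u](x)=\mathrm{p.v.}\int_{\mathbb R}\frac{u(x)-u(y)}{(x-y)^2}dy$. An upper (resp. lower) semicontinuous function $u:[0,\infty)\times\mathbb R\to\mathbb R$ is a viscosity sub-solution (resp. super-solution) of $\partial_t u+\partial_x u\,A_0[u]=0$ in $(0,\infty)\times\mathbb R$ if for all $T>0$, all $\delta\in(0,\infty]$, all $\phi$ of class $C^{1,1}_b$ (bounded, with bounded Lipschitz gradient) and every point $(t_0,x_0)\in(0,T]\times\mathbb R$ at which $u-\phi$ attains its maximum (resp. minimum) over $[0,T]\times\mathbb R$, $$\partial_t\phi(t_0,x_0)+\partial_x\phi(t_0,x_0)\big(A_{-\delta}[\phi(t_0,\cdot)](x_0)+A_\delta[u(t_0,\cdot)](x_0)\big)\le 0\quad(\text{resp. }\ge 0).$$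 A locally bounded function $u$ is a viscosity solution if its upper semicontinuous envelope $u^*$ is a sub-solution and its lower semicontinuous envelope $u_*$ is a super-solution. A family $(m(t))_{t\ge0}$ of Borel probability measures on $\mathbb R$ is a solution of the Dyson equation $$\partial_t m+\partial_x(m\,H[m])=0\ \text{ in }(0,\infty)\times\mathbb R,\qquad H[m]=\mathrm{p.v.}(1/x)*m,$$ with initial condition $m_0$ if $u(t,x)=m(t)((-\infty,x])$ is a viscosity solution of $\partial_t u+\partial_x u\,A_0[u]=0$, $m(0)=m_0$, and $m(t)\to m_0$ weakly as $t\to0^+$. For a probability measure $\mu$ on $\mathbb R$ and $1\le p\le\infty$ let $\|\mu\|_p\in[0,\infty]$ be the $L^p$ norm of its Lebesgue density if $\mu$ is absolutely continuous, and $\|\mu\|_p=\infty$ otherwise. **Proposition (decay of $L^p$ norms).** For every Borel probability measure $m_0$ on $\mathbb R$ with $\int x^2\,dm_0<\infty$, the Dyson equation has a unique solution $(m(t))_{t\ge 0}$ with initial condition $m_0$, and for all $1\le p\le\infty$ and $0\le t\le s$, $$\|m(s)\|_p\le\|m(t)\|_p .$$ -/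

import Mathlib

open MeasureTheory Filter Topology
open scoped NNReal ENNReal

noncomputable section

namespace Dyson

/-- The class `C^{1,1}_b` of test functions of `(t, x)`: bounded and continuously differentiable,
with bounded and Lipschitz gradient. -/
structure IsC11b (φ : ℝ × ℝ → ℝ) : Prop where
  differentiable : Differentiable ℝ φ
  bounded : ∃ C : ℝ, ∀ z, |φ z| ≤ C
  fderiv_bounded : ∃ C : ℝ, ∀ z, ‖fderiv ℝ φ z‖ ≤ C
  fderiv_lipschitz : ∃ K : ℝ≥0, LipschitzWith K (fderiv ℝ φ)

/-- The far part `A_δ[u](x) = ∫_{|x-y| ≥ δ} (u(x) - u(y)) / (x-y)² dy` of the half-Laplacian.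
It converges absolutely for bounded measurable `u` and `δ > 0`, and it is `0` for `δ = ∞`. -/
def halfLaplacianFar (δ : ℝ≥0∞) (u : ℝ → ℝ) (x : ℝ) : ℝ :=
  ∫ y in {y : ℝ | δ ≤ edist x y}, (u x - u y) / (x - y) ^ 2

/-- The near part `A_{-δ}[φ](x) = p.v. ∫_{|x-y| < δ} (φ(x) - φ(y)) / (x-y)² dy`
of the half-Laplacian.  The integral is a principal value at `y = x`; adding the contributions of
`y = x + z` and `y = x - z` it is the integral below, which converges absolutely
for bounded `φ` of class `C^{1,1}`, also for `δ = ∞`. -/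
def halfLaplacianNear (δ : ℝ≥0∞) (φ : ℝ → ℝ) (x : ℝ) : ℝ :=
  ∫ z in {z : ℝ | 0 < z ∧ ENNReal.ofReal z < δ}, (2 * φ x - φ (x + z) - φ (x - z)) / z ^ 2

/-- The left-hand side `∂ₜφ + ∂ₓφ (A_{-δ}[φ(t)] + A_δ[u(t)])` at `(t, x)` of the viscosity
formulation of the primitive Dyson equation `∂ₜu + ∂ₓu A₀[u] = 0`. -/
def viscosityOperator (δ : ℝ≥0∞) (φ : ℝ × ℝ → ℝ) (u : ℝ≥0 × ℝ → ℝ) (t : ℝ≥0) (x : ℝ) : ℝ :=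
  deriv (fun s : ℝ => φ (s, x)) (t : ℝ)
    + deriv (fun y : ℝ => φ ((t : ℝ), y)) x
      * (halfLaplacianNear δ (fun y => φ ((t : ℝ), y)) x
        + halfLaplacianFar δ (fun y => u (t, y)) x)

/-- Viscosity sub-solutions of `∂ₜu + ∂ₓu A₀[u] = 0` on `(0, ∞) × ℝ`. -/
def IsViscositySubsolution (u : ℝ≥0 × ℝ → ℝ) : Prop :=
  UpperSemicontinuous u ∧
    ∀ (T : ℝ≥0) (φ : ℝ × ℝ → ℝ) (δ : ℝ≥0∞) (t₀ : ℝ≥0) (x₀ : ℝ),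
      IsC11b φ → 0 < δ → 0 < t₀ → t₀ ≤ T →
      IsMaxOn (fun z : ℝ≥0 × ℝ => u z - φ ((z.1 : ℝ), z.2)) {z | z.1 ≤ T} (t₀, x₀) →
      viscosityOperator δ φ u t₀ x₀ ≤ 0

/-- Viscosity super-solutions of `∂ₜu + ∂ₓu A₀[u] = 0` on `(0, ∞) × ℝ`. -/
def IsViscositySupersolution (u : ℝ≥0 × ℝ → ℝ) : Prop :=
  LowerSemicontinuous u ∧
    ∀ (T : ℝ≥0) (φ : ℝ × ℝ → ℝ) (δ : ℝ≥0∞) (t₀ : ℝ≥0) (x₀ : ℝ),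
      IsC11b φ → 0 < δ → 0 < t₀ → t₀ ≤ T →
      IsMinOn (fun z : ℝ≥0 × ℝ => u z - φ ((z.1 : ℝ), z.2)) {z | z.1 ≤ T} (t₀, x₀) →
      0 ≤ viscosityOperator δ φ u t₀ x₀

/-- The upper semicontinuous envelope `u^*` on `[0, ∞) × ℝ`. -/
def upperEnvelope (u : ℝ≥0 × ℝ → ℝ) (z : ℝ≥0 × ℝ) : ℝ := limsup u (𝓝 z)

/-- The lower semicontinuous envelope `u_*` on `[0, ∞) × ℝ`. -/
def lowerEnvelope (u : ℝ≥0 × ℝ → ℝ) (z : ℝ≥0 × ℝ) : ℝ := liminf u (𝓝 z)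

/-- Viscosity solutions of `∂ₜu + ∂ₓu A₀[u] = 0` on `(0, ∞) × ℝ`. -/
structure IsViscositySolution (u : ℝ≥0 × ℝ → ℝ) : Prop where
  locally_bounded : ∀ z, ∃ C : ℝ, ∀ᶠ w in 𝓝 z, |u w| ≤ C
  sub : IsViscositySubsolution (upperEnvelope u)
  super : IsViscositySupersolution (lowerEnvelope u)

/-- The primitive `u(t, x) = m_t((-∞, x])` of a curve of probability measures. -/
def primitive (m : ℝ≥0 → ProbabilityMeasure ℝ) (z : ℝ≥0 × ℝ) : ℝ :=
  (m z.1 : Measure ℝ).real (Set.Iic z.2)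

/-- `m` solves the Dyson equation `∂ₜm + ∂ₓ(m H[m]) = 0` with initial condition `m₀`: its primitive
is a viscosity solution of `∂ₜu + ∂ₓu A₀[u] = 0`, and the initial condition is attained,
`m_t → m₀` weakly as `t → 0`. -/
structure IsSolution (m₀ : ProbabilityMeasure ℝ) (m : ℝ≥0 → ProbabilityMeasure ℝ) : Prop where
  viscosity : IsViscositySolution (primitive m)
  initial : m 0 = m₀
  continuousAt_zero : ContinuousAt m 0

open Classical in
/-- The `L^p` norm of a measure on `ℝ`, in `[0, ∞]`: the `L^p` norm of its Lebesgue density, and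
`∞` if it has no density. -/
def lpNorm (p : ℝ≥0∞) (μ : Measure ℝ) : ℝ≥0∞ :=
  if μ ≪ volume then eLpNorm (μ.rnDeriv volume) p volume else ∞

end Dyson

end

/-!
The Dyson equation is solved by the free convolution `m_t` of `m₀` with the semicircle law of
variance `t`. With `G_t(z) = ∫ (z - x)⁻¹ dm_t(x)` the equation becomes the complex Burgers equation
`∂ₜG + G ∂_z G = 0` in the upper half-plane, whose characteristics are straight:
`G_s(z) = G_t(z - (s - t) G_s(z))` for `t ≤ s`. The point `w = z - t G_t(z)`, a solution of
`w + t G₀(w) = z`, is found by iterating the contraction `w ↦ z - t G₀(w)`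
(`exists_subordination`). The function `z ↦ w` is Hölder continuous up to the real line
(`norm_subordination_sub_cube_le`), so `m_t` has a density for `t > 0`, bounded by `1 / (π √t)`.

*Decay of the norms.* Taking imaginary parts, the characteristics exhibit the Poisson regularization
at height `ε` of `m_s` as an average of `m_t` against the kernel
`k(y, x) = poisson (Im w) (Re w - x)`, `w = y + iε - (s - t) G_s(y + iε)`. As a function of `x` this
is a Poisson kernel. As a function of `y` it is the boundary density of the function
`z ↦ (z - (s - t) G_s(z) - x)⁻¹`, which maps the upper half-plane to the lower one and behaves like
`1 / z` at `i∞`. Both integrals are therefore `1` (`lintegral_poisson_characteristic`), and a doubly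
stochastic kernel contracts every `L^p` norm; Fatou's lemma removes `ε` (`lpNorm_freeConv_le`).

*Uniqueness.* For `η > 0` the Burgers equation at height `η` says that the distribution function of
`m_t` convolved with the Cauchy law of scale `η` is a classical solution of
`∂ₜu + ∂ₓu A₀[u] = 0` (`smoothSolution_equation`): its spatial derivative is `-π⁻¹ Im G_t(x + iη)`,
and its half-Laplacian is `Re G_t(x + iη)`. Comparing a viscosity solution with these functions,
shifted in space so as to be ordered at time `0`, needs no doubling of variables because they are
admissible test functions up to a penalization (`HasSubTest.le_add`). Letting `η` and the shift tend
to `0` identifies the solution with `m_t` (`IsSolution.eq_freeConv`).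

*Existence.* The density bound makes the regularized distribution functions converge uniformly on
`t ≥ c > 0` to that of `m_t`, and they are monotone in `x`. A uniform limit of monotone classical
solutions is a viscosity solution (`viscosity_inequality_of_uniform_limit`). The initial condition
holds because the regularized distribution functions are Lipschitz in time up to `t = 0`
(`continuousAt_freeFlow_zero`).
-/

namespace Dyson

/-! ### Stieltjes transforms in the upper half-plane -/

/-- The Stieltjes transform `G(z) = ∫ (z - x)⁻¹ dμ(x)`. -/
noncomputable def stieltjes (μ : Measure ℝ) (z : ℂ) : ℂ := ∫ x : ℝ, (z - x)⁻¹ ∂μ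

/-- The integral `∫ |z - x|⁻² dμ(x)`, which is `-Im G(z) / Im z`. -/
noncomputable def resolventSq (μ : Measure ℝ) (z : ℂ) : ℝ := ∫ x : ℝ, (‖z - x‖ ^ 2)⁻¹ ∂μ

lemma im_le_norm_sub_ofReal (z : ℂ) (x : ℝ) : z.im ≤ ‖z - x‖ := by
  have h := Complex.abs_im_le_norm (z - x)
  simp only [Complex.sub_im, Complex.ofReal_im, sub_zero] at h
  exact (le_abs_self _).trans h

lemma sub_ofReal_ne_zero {z : ℂ} (hz : 0 < z.im) (x : ℝ) : z - x ≠ 0 :=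
  norm_pos_iff.1 (hz.trans_le (im_le_norm_sub_ofReal z x))

lemma norm_inv_sub_ofReal_le {z : ℂ} (hz : 0 < z.im) (x : ℝ) : ‖(z - x)⁻¹‖ ≤ (z.im)⁻¹ := by
  rw [norm_inv]
  exact inv_anti₀ hz (im_le_norm_sub_ofReal z x)

lemma continuous_inv_sub_ofReal {z : ℂ} (hz : 0 < z.im) :
    Continuous fun x : ℝ => (z - x)⁻¹ :=
  (continuous_const.sub Complex.continuous_ofReal).inv₀ (sub_ofReal_ne_zero hz)

lemma norm_sq_sub_ofReal (z : ℂ) (x : ℝ) : ‖z - x‖ ^ 2 = (z.re - x) ^ 2 + z.im ^ 2 := by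
  rw [← Complex.normSq_eq_norm_sq, Complex.normSq_apply]
  simp
  ring

lemma im_inv_sub_ofReal (z : ℂ) (x : ℝ) :
    ((z - x)⁻¹).im = -z.im * (‖z - x‖ ^ 2)⁻¹ := by
  rw [Complex.inv_im, Complex.normSq_eq_norm_sq, div_eq_mul_inv]
  simp

section

variable {μ : Measure ℝ}

lemma integrable_inv_sub [IsFiniteMeasure μ] {z : ℂ} (hz : 0 < z.im) :
    Integrable (fun x : ℝ => (z - x)⁻¹) μ :=
  Integrable.of_bound (continuous_inv_sub_ofReal hz).aestronglyMeasurable _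
    (Eventually.of_forall (norm_inv_sub_ofReal_le hz))

lemma integrable_inv_sub_mul [IsFiniteMeasure μ] {z w : ℂ} (hz : 0 < z.im) (hw : 0 < w.im) :
    Integrable (fun x : ℝ => (z - x)⁻¹ * (w - x)⁻¹) μ := by
  refine Integrable.of_bound
    ((continuous_inv_sub_ofReal hz).mul (continuous_inv_sub_ofReal hw)).aestronglyMeasurable
    ((z.im)⁻¹ * (w.im)⁻¹) (Eventually.of_forall fun x => ?_)
  rw [norm_mul]
  exact mul_le_mul (norm_inv_sub_ofReal_le hz x) (norm_inv_sub_ofReal_le hw x)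
    (norm_nonneg _) (by positivity)

lemma inv_norm_sq_le {z : ℂ} (hz : 0 < z.im) (x : ℝ) :
    (‖z - x‖ ^ 2)⁻¹ ≤ (z.im ^ 2)⁻¹ :=
  inv_anti₀ (by positivity) (pow_le_pow_left₀ hz.le (im_le_norm_sub_ofReal z x) 2)

lemma integrable_inv_norm_sq [IsFiniteMeasure μ] {z : ℂ} (hz : 0 < z.im) :
    Integrable (fun x : ℝ => (‖z - x‖ ^ 2)⁻¹) μ := by
  refine Integrable.of_bound (Continuous.aestronglyMeasurable ?_) ((z.im ^ 2)⁻¹)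
    (Eventually.of_forall fun x => ?_)
  · refine Continuous.inv₀ (by fun_prop) fun x => ?_
    have := sub_ofReal_ne_zero hz x
    positivity
  · rw [Real.norm_of_nonneg (by positivity)]
    exact inv_norm_sq_le hz x

lemma resolventSq_nonneg (z : ℂ) : 0 ≤ resolventSq μ z :=
  integral_nonneg fun _ => by positivity

lemma stieltjes_im [IsFiniteMeasure μ] {z : ℂ} (hz : 0 < z.im) :
    (stieltjes μ z).im = -z.im * resolventSq μ z := by
  have h := integral_im (μ := μ) (integrable_inv_sub (μ := μ) hz)
  simp only [RCLike.im_to_complex] at h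
  rw [stieltjes, ← h, resolventSq, ← integral_const_mul]
  simp only [im_inv_sub_ofReal]

lemma stieltjes_im_nonpos [IsFiniteMeasure μ] {z : ℂ} (hz : 0 < z.im) :
    (stieltjes μ z).im ≤ 0 := by
  rw [stieltjes_im hz]
  have := resolventSq_nonneg (μ := μ) z
  nlinarith

lemma resolventSq_le [IsProbabilityMeasure μ] {z : ℂ} (hz : 0 < z.im) :
    resolventSq μ z ≤ (z.im ^ 2)⁻¹ := by
  calc resolventSq μ z ≤ ∫ _ : ℝ, (z.im ^ 2)⁻¹ ∂μ :=
        integral_mono (integrable_inv_norm_sq hz) (integrable_const _) (inv_norm_sq_le hz)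
    _ = _ := by simp

lemma norm_stieltjes_le [IsProbabilityMeasure μ] {z : ℂ} (hz : 0 < z.im) :
    ‖stieltjes μ z‖ ≤ (z.im)⁻¹ := by
  calc ‖stieltjes μ z‖ ≤ ∫ x : ℝ, ‖(z - x)⁻¹‖ ∂μ := norm_integral_le_integral_norm _
    _ ≤ ∫ _ : ℝ, (z.im)⁻¹ ∂μ :=
        integral_mono (integrable_inv_sub hz).norm (integrable_const _) (norm_inv_sub_ofReal_le hz)
    _ = _ := by simp

lemma norm_stieltjes_sq_le [IsProbabilityMeasure μ] {z : ℂ} (hz : 0 < z.im) :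
    ‖stieltjes μ z‖ ^ 2 ≤ resolventSq μ z := by
  set n := ‖stieltjes μ z‖
  have h1 : n ≤ ∫ x : ℝ, ‖(z - x)⁻¹‖ ∂μ := norm_integral_le_integral_norm _
  have h2 : 2 * n * (∫ x : ℝ, ‖(z - x)⁻¹‖ ∂μ) ≤ n ^ 2 + resolventSq μ z := by
    have hn : n ^ 2 = ∫ _ : ℝ, n ^ 2 ∂μ := by simp
    rw [hn, resolventSq, ← integral_add (integrable_const _) (integrable_inv_norm_sq hz),
      ← integral_const_mul]
    refine integral_mono ((integrable_inv_sub hz).norm.const_mul _)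
      ((integrable_const _).add (integrable_inv_norm_sq hz)) fun x => ?_
    simp only [norm_inv, ← inv_pow]
    nlinarith [sq_nonneg (n - ‖z - (x : ℂ)‖⁻¹)]
  have h3 : 0 ≤ n := norm_nonneg _
  nlinarith

/-- The resolvent identity for Stieltjes transforms. -/
lemma stieltjes_sub [IsFiniteMeasure μ] {z w : ℂ} (hz : 0 < z.im) (hw : 0 < w.im) :
    stieltjes μ w - stieltjes μ z
      = (z - w) * ∫ x : ℝ, (w - x)⁻¹ * (z - x)⁻¹ ∂μ := by
  rw [stieltjes, stieltjes, ← integral_sub (integrable_inv_sub hw) (integrable_inv_sub hz),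
    ← integral_const_mul]
  congr 1
  ext x
  have h1 := sub_ofReal_ne_zero hz x
  have h2 := sub_ofReal_ne_zero hw x
  field_simp
  ring

lemma norm_integral_inv_mul_le (z w : ℂ) :
    ‖∫ x : ℝ, (w - x)⁻¹ * (z - x)⁻¹ ∂μ‖ ≤ ∫ x : ℝ, ‖(w - x)⁻¹‖ * ‖(z - x)⁻¹‖ ∂μ := by
  refine (norm_integral_le_integral_norm _).trans_eq ?_
  simp only [norm_mul]

lemma integrable_norm_inv_mul [IsFiniteMeasure μ] {z w : ℂ} (hz : 0 < z.im) (hw : 0 < w.im) :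
    Integrable (fun x : ℝ => ‖(w - x)⁻¹‖ * ‖(z - x)⁻¹‖) μ := by
  simpa only [norm_mul] using (integrable_inv_sub_mul (μ := μ) hw hz).norm

/-- Weighted arithmetic-geometric mean bound for the kernel in the resolvent identity. -/
lemma integral_norm_inv_mul_le [IsFiniteMeasure μ] {z w : ℂ} (hz : 0 < z.im) (hw : 0 < w.im)
    {c : ℝ} (hc : 0 < c) :
    ∫ x : ℝ, ‖(w - x)⁻¹‖ * ‖(z - x)⁻¹‖ ∂μ
      ≤ (c * resolventSq μ w + c⁻¹ * resolventSq μ z) / 2 := by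
  rw [resolventSq, resolventSq, ← integral_const_mul, ← integral_const_mul,
    ← integral_add ((integrable_inv_norm_sq hw).const_mul _)
      ((integrable_inv_norm_sq hz).const_mul _), ← integral_div]
  refine integral_mono (integrable_norm_inv_mul hz hw)
    ((((integrable_inv_norm_sq hw).const_mul _).add
      ((integrable_inv_norm_sq hz).const_mul _)).div_const _) fun x => ?_
  simp only [norm_inv, ← inv_pow]
  set a := ‖w - (x : ℂ)‖⁻¹
  set b := ‖z - (x : ℂ)‖⁻¹
  have key : c * a ^ 2 + c⁻¹ * b ^ 2 - 2 * (a * b) = c⁻¹ * (c * a - b) ^ 2 := by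
    field_simp
    ring
  have : 0 ≤ c⁻¹ * (c * a - b) ^ 2 := by positivity
  linarith

lemma resolventSq_pos [IsProbabilityMeasure μ] {z : ℂ} (hz : 0 < z.im) :
    0 < resolventSq μ z := by
  rw [resolventSq, integral_pos_iff_support_of_nonneg (fun _ => by positivity)
    (integrable_inv_norm_sq hz)]
  have : Function.support (fun x : ℝ => (‖z - x‖ ^ 2)⁻¹) = Set.univ := by
    ext x
    have := sub_ofReal_ne_zero hz x
    simp [this]
  rw [this]
  simp

/-- Cauchy–Schwarz for the kernel in the resolvent identity. -/
lemma integral_norm_inv_mul_sq_le [IsProbabilityMeasure μ] {z w : ℂ} (hz : 0 < z.im)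
    (hw : 0 < w.im) :
    (∫ x : ℝ, ‖(w - x)⁻¹‖ * ‖(z - x)⁻¹‖ ∂μ) ^ 2 ≤ resolventSq μ w * resolventSq μ z := by
  set J := ∫ x : ℝ, ‖(w - x)⁻¹‖ * ‖(z - x)⁻¹‖ ∂μ
  have hJ : 0 ≤ J := integral_nonneg fun _ => by positivity
  have hIw := resolventSq_pos (μ := μ) hw
  have hIz := resolventSq_pos (μ := μ) hz
  set A := resolventSq μ w
  set B := resolventSq μ z
  have hsA := Real.sqrt_pos.2 hIw
  have hsB := Real.sqrt_pos.2 hIz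
  have h := integral_norm_inv_mul_le (μ := μ) hz hw (div_pos hsB hsA)
  have eA : √A ^ 2 = A := Real.sq_sqrt hIw.le
  have eB : √B ^ 2 = B := Real.sq_sqrt hIz.le
  have e : (√B / √A * A + (√B / √A)⁻¹ * B) / 2 = √A * √B := by
    rw [← eA, ← eB, Real.sqrt_sq hsA.le, Real.sqrt_sq hsB.le]
    field_simp
    ring
  change J ≤ (√B / √A * A + (√B / √A)⁻¹ * B) / 2 at h
  rw [e] at h
  calc J ^ 2 ≤ (√A * √B) ^ 2 := pow_le_pow_left₀ hJ h 2
    _ = A * B := by rw [mul_pow, eA, eB]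

lemma hasDerivAt_stieltjes [IsFiniteMeasure μ] {z : ℂ} (hz : 0 < z.im) :
    HasDerivAt (stieltjes μ) (∫ x : ℝ, -((z - x)⁻¹ * (z - x)⁻¹) ∂μ) z := by
  have hz2 : 0 < z.im / 2 := by linarith
  have him : ∀ w ∈ Metric.ball z (z.im / 2), z.im / 2 < w.im := by
    intro w hw
    have h1 := Complex.abs_im_le_norm (w - z)
    rw [Metric.mem_ball, dist_eq_norm] at hw
    rw [Complex.sub_im] at h1
    have h2 := (abs_lt.1 (h1.trans_lt hw)).1
    linarith
  refine (hasDerivAt_integral_of_dominated_loc_of_deriv_le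
    (F' := fun (w : ℂ) (x : ℝ) => -((w - x)⁻¹ * (w - x)⁻¹))
    (bound := fun _ => (z.im / 2)⁻¹ * (z.im / 2)⁻¹)
    (Metric.ball_mem_nhds z hz2) ?_ (integrable_inv_sub hz) ?_ ?_ (integrable_const _) ?_).2
  · filter_upwards [Metric.ball_mem_nhds z hz2] with w hw
    exact (continuous_inv_sub_ofReal (hz2.trans (him w hw))).aestronglyMeasurable
  · exact ((continuous_inv_sub_ofReal hz).mul
      (continuous_inv_sub_ofReal hz)).neg.aestronglyMeasurable
  · refine Eventually.of_forall fun x w hw => ?_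
    have h0 := hz2.trans (him w hw)
    have h1 : ‖(w - x)⁻¹‖ ≤ (z.im / 2)⁻¹ :=
      (norm_inv_sub_ofReal_le h0 x).trans (inv_anti₀ hz2 (him w hw).le)
    rw [norm_neg, norm_mul]
    exact mul_le_mul h1 h1 (norm_nonneg _) (by positivity)
  · refine Eventually.of_forall fun x w hw => ?_
    have h0 := sub_ofReal_ne_zero (hz2.trans (him w hw)) x
    have := ((hasDerivAt_id w).sub_const (x : ℂ)).inv h0
    refine this.congr_deriv ?_
    simp only [id]
    field_simp

lemma norm_deriv_stieltjes_le [IsProbabilityMeasure μ] {z : ℂ} (hz : 0 < z.im) :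
    ‖deriv (stieltjes μ) z‖ ≤ (z.im)⁻¹ * (z.im)⁻¹ := by
  rw [(hasDerivAt_stieltjes hz).deriv]
  calc _ ≤ ∫ x : ℝ, ‖-((z - x)⁻¹ * (z - x)⁻¹)‖ ∂μ := norm_integral_le_integral_norm _
    _ ≤ ∫ _ : ℝ, (z.im)⁻¹ * (z.im)⁻¹ ∂μ := by
        refine integral_mono (integrable_inv_sub_mul hz hz).neg.norm (integrable_const _)
          fun x => ?_
        simp only [norm_neg, norm_mul]
        exact mul_le_mul (norm_inv_sub_ofReal_le hz x) (norm_inv_sub_ofReal_le hz x)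
          (norm_nonneg _) (by positivity)
    _ = _ := by simp

/-- Normalization of the Stieltjes transform along the imaginary axis. -/
lemma tendsto_mul_stieltjes [IsProbabilityMeasure μ] :
    Tendsto (fun y : ℝ => (y * Complex.I) * stieltjes μ (y * Complex.I)) atTop (𝓝 1) := by
  have h : Tendsto (fun y : ℝ => ∫ x : ℝ, (y * Complex.I) * (y * Complex.I - x)⁻¹ ∂μ) atTop
      (𝓝 (∫ _ : ℝ, (1 : ℂ) ∂μ)) := by
    refine tendsto_integral_filter_of_dominated_convergence (fun _ => 1) ?_ ?_
      (integrable_const _) ?_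
    · filter_upwards [eventually_gt_atTop 0] with y hy
      exact (continuous_const.mul (continuous_inv_sub_ofReal (by simpa))).aestronglyMeasurable
    · filter_upwards [eventually_gt_atTop 0] with y hy
      refine Eventually.of_forall fun x => ?_
      have := norm_inv_sub_ofReal_le (z := y * Complex.I) (by simpa) x
      rw [norm_mul]
      calc _ ≤ ‖(y * Complex.I : ℂ)‖ * ((y * Complex.I : ℂ).im)⁻¹ := by gcongr
        _ = 1 := by
          simp only [norm_mul, Complex.norm_real, Complex.norm_I, mul_one, Complex.mul_im,
            Complex.ofReal_re, Complex.I_im, Complex.ofReal_im, Complex.I_re, mul_zero, add_zero]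
          rw [Real.norm_of_nonneg hy.le, mul_inv_cancel₀ hy.ne']
    · refine Eventually.of_forall fun x => ?_
      have h0 : Tendsto (fun y : ℝ => (x : ℂ) * (y * Complex.I - x)⁻¹) atTop (𝓝 0) := by
        rw [tendsto_zero_iff_norm_tendsto_zero]
        have h1 : Tendsto (fun y : ℝ => ‖(x : ℂ)‖ * y⁻¹) atTop (𝓝 0) := by
          simpa using tendsto_inv_atTop_zero.const_mul ‖(x : ℂ)‖
        refine squeeze_zero' (Eventually.of_forall fun _ => norm_nonneg _) ?_ h1
        filter_upwards [eventually_gt_atTop 0] with y hy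
        have := norm_inv_sub_ofReal_le (z := y * Complex.I) (by simpa) x
        rw [norm_mul]
        gcongr
        simpa using this
      have h2 := h0.const_add 1
      rw [add_zero] at h2
      refine h2.congr' ?_
      filter_upwards [eventually_gt_atTop 0] with y hy
      have := sub_ofReal_ne_zero (z := y * Complex.I) (by simpa) x
      field_simp
      ring
  simp only [integral_const, probReal_univ, one_smul] at h
  refine h.congr fun y => ?_
  rw [integral_const_mul, stieltjes]

end

/-! ### The subordination function -/

section

variable {μ : Measure ℝ} [IsProbabilityMeasure μ]

lemma im_sub_mul_stieltjes (t : ℝ) (z : ℂ) {w : ℂ} (hw : 0 < w.im) :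
    (z - t * stieltjes μ w).im = z.im + t * (w.im * resolventSq μ w) := by
  simp [stieltjes_im hw]

lemma im_mul_resolventSq_le {η : ℝ} (hη : 0 < η) {w : ℂ} (hw : η ≤ w.im) :
    w.im * resolventSq μ w ≤ η⁻¹ := by
  have h0 : 0 < w.im := hη.trans_le hw
  calc w.im * resolventSq μ w ≤ w.im * (w.im ^ 2)⁻¹ := by gcongr; exact resolventSq_le h0
    _ = w.im⁻¹ := by field_simp
    _ ≤ η⁻¹ := inv_anti₀ hη hw

/-- The map `w ↦ z - t G(w)` contracts the quantity `|w₁ - w₂|² / (Im w₁ Im w₂)`, an increasing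
function of the hyperbolic distance. -/
lemma norm_sub_mul_stieltjes_contract {t : ℝ} (ht : 0 ≤ t) {z : ℂ} (hz : 0 < z.im) {w₁ w₂ : ℂ}
    (h₁ : z.im ≤ w₁.im) (h₂ : z.im ≤ w₂.im) :
    ‖(z - t * stieltjes μ w₁) - (z - t * stieltjes μ w₂)‖ ^ 2 * (w₁.im * w₂.im)
      ≤ (t / z.im / (z.im + t / z.im)) ^ 2 * ‖w₁ - w₂‖ ^ 2 *
        ((z - t * stieltjes μ w₁).im * (z - t * stieltjes μ w₂).im) := by
  have p₁ := hz.trans_le h₁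
  have p₂ := hz.trans_le h₂
  rw [im_sub_mul_stieltjes t z p₁, im_sub_mul_stieltjes t z p₂]
  have b₁ := im_mul_resolventSq_le (μ := μ) hz h₁
  have b₂ := im_mul_resolventSq_le (μ := μ) hz h₂
  have key : ∀ s : ℝ, s ≤ z.im⁻¹ →
      t * s ≤ t / z.im / (z.im + t / z.im) * (z.im + t * s) := by
    intro s hs
    rw [div_mul_eq_mul_div, le_div_iff₀ (by positivity), div_eq_mul_inv]
    nlinarith [mul_le_mul_of_nonneg_left hs (mul_nonneg ht hz.le)]
  have e : (z - t * stieltjes μ w₁) - (z - t * stieltjes μ w₂)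
      = t * ((w₁ - w₂) * ∫ x : ℝ, (w₂ - x)⁻¹ * (w₁ - x)⁻¹ ∂μ) := by
    rw [← stieltjes_sub p₁ p₂]; ring
  have hJ := (pow_le_pow_left₀ (norm_nonneg _)
    (norm_integral_inv_mul_le (μ := μ) w₁ w₂) 2).trans (integral_norm_inv_mul_sq_le p₁ p₂)
  rw [e, norm_mul, norm_mul, mul_pow, mul_pow, Complex.norm_real, Real.norm_of_nonneg ht]
  have k₁ := key _ b₁
  have k₂ := key _ b₂
  have n₁ : 0 ≤ t * (w₁.im * resolventSq μ w₁) :=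
    mul_nonneg ht (mul_nonneg p₁.le (resolventSq_nonneg _))
  have n₂ : 0 ≤ t * (w₂.im * resolventSq μ w₂) :=
    mul_nonneg ht (mul_nonneg p₂.le (resolventSq_nonneg _))
  calc t ^ 2 * (‖w₁ - w₂‖ ^ 2 * ‖∫ x : ℝ, (w₂ - x)⁻¹ * (w₁ - x)⁻¹ ∂μ‖ ^ 2) * (w₁.im * w₂.im)
      ≤ t ^ 2 * (‖w₁ - w₂‖ ^ 2 * (resolventSq μ w₂ * resolventSq μ w₁)) * (w₁.im * w₂.im) := by
        gcongr
    _ = ‖w₁ - w₂‖ ^ 2 *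
        ((t * (w₁.im * resolventSq μ w₁)) * (t * (w₂.im * resolventSq μ w₂))) := by ring
    _ ≤ ‖w₁ - w₂‖ ^ 2 * ((t / z.im / (z.im + t / z.im) * (z.im + t * (w₁.im * resolventSq μ w₁)))
        * (t / z.im / (z.im + t / z.im) * (z.im + t * (w₂.im * resolventSq μ w₂)))) := by
        refine mul_le_mul_of_nonneg_left (mul_le_mul k₁ k₂ n₂ (n₁.trans k₁)) (by positivity)
    _ = _ := by ring

/-- Existence of the subordination point, as the limit of the iterates of the contraction
`w ↦ z - t G(w)`. -/
lemma exists_subordination {t : ℝ} (ht : 0 ≤ t) {z : ℂ} (hz : 0 < z.im) :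
    ∃ w : ℂ, 0 < w.im ∧ w + t * stieltjes μ w = z := by
  set η := z.im with hη
  -- `T` maps the half-plane `Im w ≥ η` into the strip `η ≤ Im w ≤ V`, where it contracts by `q`.
  set T : ℂ → ℂ := fun w => z - t * stieltjes μ w with hT
  set q : ℝ := t / η / (η + t / η) with hq
  have hq0 : 0 ≤ q := by positivity
  have hq1 : q < 1 := by
    rw [hq, div_lt_one (by positivity)]
    linarith
  set V : ℝ := η + t / η with hV
  have hT1 : ∀ w : ℂ, η ≤ w.im → η ≤ (T w).im := by
    intro w hw
    have h0 := hz.trans_le hw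
    simp only [hT]
    rw [im_sub_mul_stieltjes t z h0]
    have := mul_nonneg ht (mul_nonneg h0.le (resolventSq_nonneg (μ := μ) w))
    linarith
  have hT2 : ∀ w : ℂ, η ≤ w.im → (T w).im ≤ V := by
    intro w hw
    have h0 := hz.trans_le hw
    simp only [hT]
    rw [im_sub_mul_stieltjes t z h0, hV, div_eq_mul_inv]
    have := mul_le_mul_of_nonneg_left (im_mul_resolventSq_le (μ := μ) hz hw) ht
    linarith
  set u : ℕ → ℂ := fun n => T^[n] z with hu
  have hus : ∀ n, u (n + 1) = T (u n) := fun n => Function.iterate_succ_apply' T n z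
  have hu1 : ∀ n, η ≤ (u n).im := by
    intro n
    induction n with
    | zero => simp [hu, hη]
    | succ n ih => rw [hus]; exact hT1 _ ih
  have hu2 : ∀ n, (u n).im ≤ V := by
    intro n
    cases n with
    | zero =>
      simp only [hu, Function.iterate_zero, id, hV]
      rw [← hη]
      have : 0 ≤ t / η := by positivity
      linarith
    | succ n => rw [hus]; exact hT2 _ (hu1 n)
  have hupos : ∀ n, 0 < (u n).im := fun n => hz.trans_le (hu1 n)
  set e : ℕ → ℝ := fun n => ‖u (n + 1) - u n‖ ^ 2 / ((u (n + 1)).im * (u n).im) with he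
  have he1 : ∀ n, e (n + 1) ≤ q ^ 2 * e n := by
    intro n
    have h := norm_sub_mul_stieltjes_contract (μ := μ) ht hz (hu1 (n + 1)) (hu1 n)
    have a1 := hupos n
    have a2 := hupos (n + 1)
    have a3 := hupos (n + 2)
    change ‖T (u (n + 1)) - T (u n)‖ ^ 2 * _ ≤ q ^ 2 * _ * ((T (u (n + 1))).im * (T (u n)).im) at h
    rw [← hus, ← hus] at h
    simp only [he]
    rw [← mul_div_assoc, div_le_div_iff₀ (by positivity) (by positivity)]
    exact h
  have he2 : ∀ n, e n ≤ (q ^ 2) ^ n * e 0 := by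
    intro n
    induction n with
    | zero => simp
    | succ n ih =>
      calc e (n + 1) ≤ q ^ 2 * e n := he1 n
        _ ≤ q ^ 2 * ((q ^ 2) ^ n * e 0) := by gcongr
        _ = _ := by ring
  have he0 : 0 ≤ e 0 := by
    have a1 := hupos 0
    have a2 := hupos 1
    simp only [he]
    positivity
  have hVpos : 0 < V := by positivity
  have hd : ∀ n, dist (u n) (u (n + 1)) ≤ (V * √(e 0)) * q ^ n := by
    intro n
    rw [dist_comm, dist_eq_norm]
    refine abs_le_of_sq_le_sq' ?_ (by positivity) |>.2
    have a1 := hupos n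
    have a2 := hupos (n + 1)
    have : ‖u (n + 1) - u n‖ ^ 2 = e n * ((u (n + 1)).im * (u n).im) := by
      simp only [he]
      field_simp
    rw [this]
    have en : 0 ≤ e n := by simp only [he]; positivity
    calc e n * ((u (n + 1)).im * (u n).im) ≤ ((q ^ 2) ^ n * e 0) * (V * V) := by
          refine mul_le_mul (he2 n) (mul_le_mul (hu2 _) (hu2 _) a1.le hVpos.le) (by positivity)
            (by positivity)
      _ = (V * √(e 0) * q ^ n) ^ 2 := by
          rw [mul_pow, mul_pow, Real.sq_sqrt he0]
          ring
  have hc : CauchySeq u := cauchySeq_of_le_geometric q _ hq1 hd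
  obtain ⟨w, hw⟩ := cauchySeq_tendsto_of_complete hc
  have hwim : η ≤ w.im :=
    ge_of_tendsto' ((Complex.continuous_im.tendsto w).comp hw) hu1
  have hw0 : 0 < w.im := hz.trans_le hwim
  have hTc : ContinuousAt T w :=
    continuousAt_const.sub (continuousAt_const.mul (hasDerivAt_stieltjes hw0).continuousAt)
  have h1 : Tendsto (fun n => u (n + 1)) atTop (𝓝 (T w)) := by
    simp only [hus]
    exact hTc.tendsto.comp hw
  have h2 : T w = w := tendsto_nhds_unique h1 ((tendsto_add_atTop_iff_nat 1).2 hw)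
  refine ⟨w, hw0, ?_⟩
  simp only [hT] at h2
  linear_combination -h2

/-- The imaginary part of the equation `w + t G(w) = z`. -/
lemma mul_resolventSq_eq {t : ℝ} {z w : ℂ} (hw : 0 < w.im)
    (h : w + t * stieltjes μ w = z) : t * resolventSq μ w = 1 - z.im / w.im := by
  have h1 := im_sub_mul_stieltjes (μ := μ) t z hw
  rw [← h, add_sub_cancel_right] at h1
  rw [← h]
  field_simp
  linarith

lemma im_le_of_subordination {t : ℝ} (ht : 0 ≤ t) {z w : ℂ} (hw : 0 < w.im)
    (h : w + t * stieltjes μ w = z) : z.im ≤ w.im := by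
  have h1 := mul_resolventSq_eq hw h
  have h2 : 0 ≤ t * resolventSq μ w := mul_nonneg ht (resolventSq_nonneg _)
  have h3 : z.im / w.im ≤ 1 := by linarith
  rwa [div_le_one hw] at h3

lemma mul_resolventSq_le {t : ℝ} (ht : 0 ≤ t) {η : ℝ} (hη : 0 < η) {z w : ℂ} (hz : η ≤ z.im)
    (hw : 0 < w.im) (h : w + t * stieltjes μ w = z) :
    t * resolventSq μ w ≤ 1 - η ^ 2 / (η ^ 2 + t) := by
  rw [mul_resolventSq_eq hw h]
  have hz0 := hη.trans_le hz
  have h1 := im_le_of_subordination ht hw h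
  have h2 := im_sub_mul_stieltjes (μ := μ) t z hw
  rw [show z - t * stieltjes μ w = w by rw [← h]; ring] at h2
  have h3 := mul_le_mul_of_nonneg_left (im_mul_resolventSq_le (μ := μ) hz0 h1) ht
  have h4 : w.im * z.im ≤ z.im ^ 2 + t := by
    have : w.im ≤ z.im + t * z.im⁻¹ := by linarith
    calc w.im * z.im ≤ (z.im + t * z.im⁻¹) * z.im := by gcongr
      _ = _ := by field_simp
  have h5 : η ^ 2 / (η ^ 2 + t) ≤ z.im / w.im := by
    rw [div_le_div_iff₀ (by positivity) hw]
    have h6 : η ^ 2 ≤ z.im ^ 2 := pow_le_pow_left₀ hη.le hz 2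
    have h7 : η ^ 2 * (w.im * z.im) ≤ η ^ 2 * (z.im ^ 2 + t) := by gcongr
    have h8 : η ^ 2 * t ≤ z.im ^ 2 * t := by gcongr
    have h9 : (η ^ 2 * w.im) * z.im ≤ (z.im * (η ^ 2 + t)) * z.im := by nlinarith
    exact le_of_mul_le_mul_right h9 hz0
  linarith

lemma subordination_sub {t₁ t₂ : ℝ} {z₁ z₂ w₁ w₂ : ℂ} (hw₁ : 0 < w₁.im) (hw₂ : 0 < w₂.im)
    (h₁ : w₁ + t₁ * stieltjes μ w₁ = z₁) (h₂ : w₂ + t₂ * stieltjes μ w₂ = z₂) :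
    (w₁ - w₂) * (1 - t₁ * ∫ x : ℝ, (w₁ - x)⁻¹ * (w₂ - x)⁻¹ ∂μ)
      = z₁ - z₂ + (t₂ - t₁) * stieltjes μ w₂ := by
  have h := stieltjes_sub (μ := μ) hw₂ hw₁
  rw [← h₁, ← h₂]
  linear_combination (-t₁ : ℂ) * h

/-- Joint Lipschitz bound for the subordination point as a function of `t` and `z`. -/
lemma norm_subordination_sub_le {t₁ t₂ η : ℝ} (ht₁ : 0 ≤ t₁) (ht : t₁ ≤ t₂) (hη : 0 < η)
    {z₁ z₂ w₁ w₂ : ℂ} (hz₁ : η ≤ z₁.im) (hz₂ : η ≤ z₂.im) (hw₁ : 0 < w₁.im) (hw₂ : 0 < w₂.im)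
    (h₁ : w₁ + t₁ * stieltjes μ w₁ = z₁) (h₂ : w₂ + t₂ * stieltjes μ w₂ = z₂) :
    ‖w₁ - w₂‖ * (η ^ 2 / (η ^ 2 + t₂)) ≤ ‖z₁ - z₂‖ + (t₂ - t₁) * η⁻¹ := by
  have ht₂ := ht₁.trans ht
  have e := subordination_sub hw₁ hw₂ h₁ h₂
  set J := ∫ x : ℝ, (w₁ - x)⁻¹ * (w₂ - x)⁻¹ ∂μ with hJ
  have hJ1 : ‖J‖ ≤ (1 * resolventSq μ w₁ + 1⁻¹ * resolventSq μ w₂) / 2 :=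
    (norm_integral_inv_mul_le w₂ w₁).trans (integral_norm_inv_mul_le hw₂ hw₁ one_pos)
  have m₁ := mul_resolventSq_le ht₁ hη hz₁ hw₁ h₁
  have m₂ := mul_resolventSq_le ht₂ hη hz₂ hw₂ h₂
  have m₃ : t₁ * resolventSq μ w₂ ≤ t₂ * resolventSq μ w₂ := by
    gcongr
    exact resolventSq_nonneg _
  have m₄ : η ^ 2 / (η ^ 2 + t₂) ≤ η ^ 2 / (η ^ 2 + t₁) := by gcongr
  have hJ2 : ‖(t₁ : ℂ) * J‖ ≤ 1 - η ^ 2 / (η ^ 2 + t₂) := by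
    rw [norm_mul, Complex.norm_real, Real.norm_of_nonneg ht₁]
    have := mul_le_mul_of_nonneg_left hJ1 ht₁
    linarith
  have hJ3 : η ^ 2 / (η ^ 2 + t₂) ≤ ‖1 - t₁ * J‖ := by
    have := norm_sub_norm_le (1 : ℂ) (t₁ * J)
    rw [norm_one] at this
    linarith
  calc ‖w₁ - w₂‖ * (η ^ 2 / (η ^ 2 + t₂)) ≤ ‖w₁ - w₂‖ * ‖1 - t₁ * J‖ := by gcongr
    _ = ‖z₁ - z₂ + (t₂ - t₁) * stieltjes μ w₂‖ := by rw [← norm_mul, e]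
    _ ≤ ‖z₁ - z₂‖ + ‖((t₂ - t₁ : ℝ) : ℂ)‖ * ‖stieltjes μ w₂‖ := by
        rw [← norm_mul]
        push_cast
        exact norm_add_le _ _
    _ ≤ ‖z₁ - z₂‖ + (t₂ - t₁) * η⁻¹ := by
        rw [Complex.norm_real, Real.norm_of_nonneg (sub_nonneg.2 ht)]
        gcongr
        exact (norm_stieltjes_le hw₂).trans
          (inv_anti₀ hη (hz₂.trans (im_le_of_subordination ht₂ hw₂ h₂)))

lemma subordination_unique {t : ℝ} (ht : 0 ≤ t) {z w₁ w₂ : ℂ} (hz : 0 < z.im)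
    (hw₁ : 0 < w₁.im) (hw₂ : 0 < w₂.im)
    (h₁ : w₁ + t * stieltjes μ w₁ = z) (h₂ : w₂ + t * stieltjes μ w₂ = z) : w₁ = w₂ := by
  have h := norm_subordination_sub_le ht le_rfl hz le_rfl le_rfl hw₁ hw₂ h₁ h₂
  simp only [sub_self, norm_zero, zero_mul, add_zero] at h
  have hp : 0 < z.im ^ 2 / (z.im ^ 2 + t) := by positivity
  have : ‖w₁ - w₂‖ ≤ 0 := by
    by_contra! hc
    exact absurd h (not_le.2 (mul_pos hc hp))
  exact sub_eq_zero.1 (norm_le_zero_iff.1 this)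

/-- The subordination function extends to the closed half-plane because it is Hölder continuous:
a difference of subordination points is controlled by the cube root of the difference of the
arguments. -/
lemma norm_subordination_sub_cube_le {t : ℝ} (ht : 0 ≤ t) {B : ℝ} {z₁ z₂ w₁ w₂ : ℂ}
    (hz₁ : 0 < z₁.im) (hz₂ : 0 < z₂.im) (hw₁ : 0 < w₁.im) (hw₂ : 0 < w₂.im)
    (h₁ : w₁ + t * stieltjes μ w₁ = z₁) (h₂ : w₂ + t * stieltjes μ w₂ = z₂)
    (hB₁ : ‖w₁‖ ≤ B) (hB₂ : ‖w₂‖ ≤ B) :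
    t / 2 * (∫ x : ℝ, ((1 + B + |x|) ^ 4)⁻¹ ∂μ) * ‖w₁ - w₂‖ ^ 3 ≤ ‖z₁ - z₂‖ := by
  have hB : 0 ≤ B := (norm_nonneg _).trans hB₁
  have e := subordination_sub hw₁ hw₂ h₁ h₂
  rw [sub_self, zero_mul, add_zero] at e
  have int1 := integrable_inv_sub_mul (μ := μ) hw₁ hw₂
  set J := ∫ x : ℝ, (w₁ - x)⁻¹ * (w₂ - x)⁻¹ ∂μ with hJ
  have hre : J.re = ∫ x : ℝ, ((w₁ - x)⁻¹ * (w₂ - x)⁻¹).re ∂μ := by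
    have := integral_re int1
    simp only [RCLike.re_to_complex] at this
    rw [hJ, ← this]
  have hconj : ‖w₁ - w₂‖ ≤ ‖w₁ - (starRingEnd ℂ) w₂‖ := by
    rw [← sq_le_sq₀ (norm_nonneg _) (norm_nonneg _), ← Complex.normSq_eq_norm_sq,
      ← Complex.normSq_eq_norm_sq, Complex.normSq_apply, Complex.normSq_apply]
    simp only [Complex.sub_re, Complex.sub_im, Complex.conj_re, Complex.conj_im]
    nlinarith [mul_pos hw₁ hw₂]
  -- This is `2 Re(ab) = |a|² + |b|² - |a - b̄|²` with `a = 1/(w₁ - x)` and `b = 1/(w₂ - x)`.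
  have hpt : ∀ x : ℝ, ‖w₁ - w₂‖ ^ 2 * ((1 + B + |x|) ^ 4)⁻¹
      ≤ (‖w₁ - x‖ ^ 2)⁻¹ + (‖w₂ - x‖ ^ 2)⁻¹ - 2 * ((w₁ - x)⁻¹ * (w₂ - x)⁻¹).re := by
    intro x
    have n₁ := sub_ofReal_ne_zero hw₁ x
    have n₂ := sub_ofReal_ne_zero hw₂ x
    have p₁ : 0 < ‖w₁ - x‖ := norm_pos_iff.2 n₁
    have p₂ : 0 < ‖w₂ - x‖ := norm_pos_iff.2 n₂
    have id1 : (‖w₁ - x‖ ^ 2)⁻¹ + (‖w₂ - x‖ ^ 2)⁻¹ - 2 * ((w₁ - x)⁻¹ * (w₂ - x)⁻¹).re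
        = ‖w₁ - (starRingEnd ℂ) w₂‖ ^ 2 * ((‖w₁ - x‖ ^ 2)⁻¹ * (‖w₂ - x‖ ^ 2)⁻¹) := by
      rw [← mul_inv (w₁ - (x : ℂ)), Complex.inv_re, Complex.normSq_mul,
        Complex.normSq_eq_norm_sq, Complex.normSq_eq_norm_sq]
      field_simp
      rw [norm_sq_sub_ofReal, norm_sq_sub_ofReal, ← Complex.normSq_eq_norm_sq,
        Complex.normSq_apply]
      simp only [Complex.sub_re, Complex.sub_im, Complex.conj_re, Complex.conj_im, Complex.mul_re,
        Complex.ofReal_re, Complex.ofReal_im]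
      ring
    rw [id1]
    have q₁ : ‖w₁ - x‖ ≤ 1 + B + |x| := by
      have := norm_sub_le w₁ (x : ℂ)
      rw [Complex.norm_real, Real.norm_eq_abs] at this
      linarith
    have q₂ : ‖w₂ - x‖ ≤ 1 + B + |x| := by
      have := norm_sub_le w₂ (x : ℂ)
      rw [Complex.norm_real, Real.norm_eq_abs] at this
      linarith
    rw [← mul_inv]
    gcongr
    calc ‖w₁ - (x : ℂ)‖ ^ 2 * ‖w₂ - (x : ℂ)‖ ^ 2 ≤ (1 + B + |x|) ^ 2 * (1 + B + |x|) ^ 2 := by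
          gcongr
      _ = _ := by ring
  have int2 : Integrable (fun x : ℝ => ((1 + B + |x|) ^ 4)⁻¹) μ := by
    refine Integrable.of_bound (Continuous.aestronglyMeasurable ?_) 1
      (Eventually.of_forall fun x => ?_)
    · refine Continuous.inv₀ (by fun_prop) fun x => ?_
      positivity
    · rw [Real.norm_of_nonneg (by positivity)]
      refine inv_le_one_of_one_le₀ (one_le_pow₀ ?_)
      have := abs_nonneg x
      linarith
  have hint : ‖w₁ - w₂‖ ^ 2 * (∫ x : ℝ, ((1 + B + |x|) ^ 4)⁻¹ ∂μ)
      ≤ resolventSq μ w₁ + resolventSq μ w₂ - 2 * J.re := by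
    have int3 : Integrable (fun x : ℝ => ((w₁ - x)⁻¹ * (w₂ - x)⁻¹).re) μ := int1.re
    have int4 : Integrable (fun x : ℝ => (‖w₁ - x‖ ^ 2)⁻¹ + (‖w₂ - x‖ ^ 2)⁻¹) μ :=
      (integrable_inv_norm_sq hw₁).add (integrable_inv_norm_sq hw₂)
    rw [hre, resolventSq, resolventSq, ← integral_const_mul, ← integral_const_mul,
      ← integral_add (integrable_inv_norm_sq hw₁) (integrable_inv_norm_sq hw₂),
      ← integral_sub int4 (int3.const_mul 2)]
    exact integral_mono (int2.const_mul _) (int4.sub (int3.const_mul 2)) hpt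
  have m₁ : t * resolventSq μ w₁ ≤ 1 := by
    rw [mul_resolventSq_eq hw₁ h₁]
    have : 0 ≤ z₁.im / w₁.im := by positivity
    linarith
  have m₂ : t * resolventSq μ w₂ ≤ 1 := by
    rw [mul_resolventSq_eq hw₂ h₂]
    have : 0 ≤ z₂.im / w₂.im := by positivity
    linarith
  set c := ∫ x : ℝ, ((1 + B + |x|) ^ 4)⁻¹ ∂μ
  have hlow : t / 2 * (‖w₁ - w₂‖ ^ 2 * c) ≤ ‖1 - t * J‖ := by
    have h3 := Complex.re_le_norm (1 - t * J)
    simp only [Complex.sub_re, Complex.one_re, Complex.re_ofReal_mul] at h3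
    have h4 := mul_le_mul_of_nonneg_left hint ht
    linarith
  calc t / 2 * c * ‖w₁ - w₂‖ ^ 3 = ‖w₁ - w₂‖ * (t / 2 * (‖w₁ - w₂‖ ^ 2 * c)) := by ring
    _ ≤ ‖w₁ - w₂‖ * ‖1 - t * J‖ := by gcongr
    _ = ‖z₁ - z₂‖ := by rw [← norm_mul, e]

end

/-! ### The Poisson formula in the upper half-plane -/

/-- The Poisson kernel of the upper half-plane at height `η`, that is, the Cauchy density. -/
noncomputable def poisson (η x : ℝ) : ℝ := η / (Real.pi * (x ^ 2 + η ^ 2))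

lemma poisson_pos {η : ℝ} (hη : 0 < η) (x : ℝ) : 0 < poisson η x := by
  have := Real.pi_pos
  unfold poisson
  positivity

lemma continuous_poisson {η : ℝ} (hη : 0 < η) : Continuous (poisson η) := by
  unfold poisson
  refine Continuous.div (by fun_prop) (by fun_prop) fun x => ?_
  have := Real.pi_pos
  positivity

lemma poisson_le {η : ℝ} (hη : 0 < η) (x : ℝ) : poisson η x ≤ (Real.pi * η)⁻¹ := by
  have := Real.pi_pos
  rw [poisson, div_le_iff₀ (by positivity)]
  have : (Real.pi * η)⁻¹ * (Real.pi * (x ^ 2 + η ^ 2)) = x ^ 2 / η + η := by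
    field_simp
  rw [this]
  have : 0 ≤ x ^ 2 / η := by positivity
  linarith

lemma poisson_eq {η : ℝ} (hη : 0 < η) (x : ℝ) :
    poisson η x = (Real.pi⁻¹ * η⁻¹) * (1 + (x / η) ^ 2)⁻¹ := by
  have := Real.pi_pos
  unfold poisson
  field_simp
  ring

lemma integrable_poisson {η : ℝ} (hη : 0 < η) : Integrable (poisson η) := by
  have h := (integrable_inv_one_add_sq.comp_div hη.ne').const_mul (Real.pi⁻¹ * η⁻¹)
  refine h.congr (Eventually.of_forall fun x => ?_)
  simp only [poisson_eq hη]

lemma integral_poisson {η : ℝ} (hη : 0 < η) : ∫ x, poisson η x = 1 := by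
  simp only [poisson_eq hη]
  rw [integral_const_mul, Measure.integral_comp_div (fun x => (1 + x ^ 2)⁻¹),
    integral_univ_inv_one_add_sq, smul_eq_mul, abs_of_pos hη]
  have := Real.pi_pos
  field_simp

lemma integrable_poisson_sub {η : ℝ} (hη : 0 < η) (x : ℝ) :
    Integrable fun y => poisson η (x - y) := by
  simpa using (integrable_poisson hη).comp_sub_left x

lemma integral_poisson_sub {η : ℝ} (hη : 0 < η) (x : ℝ) : ∫ y, poisson η (x - y) = 1 := by
  rw [integral_sub_left_eq_self (poisson η) volume x, integral_poisson hη]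

/-- A holomorphic function on the closed upper half-plane decaying like `|z|⁻²` has vanishing
integral over the real line. -/
lemma integral_ofReal_eq_zero {g : ℂ → ℂ} {C : ℝ} (hg : DifferentiableOn ℂ g {z | 0 ≤ z.im})
    (hC : ∀ z : ℂ, 0 ≤ z.im → ‖g z‖ ≤ C * (1 + ‖z‖ ^ 2)⁻¹) :
    Integrable (fun x : ℝ => g x) ∧ ∫ x : ℝ, g x = 0 := by
  have hcont : Continuous fun x : ℝ => g x :=
    hg.continuousOn.comp_continuous Complex.continuous_ofReal (fun x => by simp)
  have hint : Integrable (fun x : ℝ => g x) := by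
    refine (integrable_inv_one_add_sq.const_mul C).mono' hcont.aestronglyMeasurable
      (Eventually.of_forall fun x => ?_)
    have := hC x (by simp)
    rwa [Complex.norm_real, Real.norm_eq_abs, sq_abs] at this
  refine ⟨hint, ?_⟩
  have hC0 : 0 ≤ C := by
    have h := (norm_nonneg _).trans (hC 0 (by simp))
    simpa using h
  have hlim := intervalIntegral_tendsto_integral hint tendsto_neg_atTop_atBot tendsto_id
  refine tendsto_nhds_unique hlim ?_
  have hb : Tendsto (fun R : ℝ => 4 * C * R⁻¹) atTop (𝓝 0) := by
    simpa using tendsto_inv_atTop_zero.const_mul (4 * C)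
  refine squeeze_zero_norm' ?_ hb
  filter_upwards [eventually_gt_atTop 0] with R hR
  have hrect := Complex.integral_boundary_rect_eq_zero_of_differentiableOn g (-R : ℂ)
    (R + R * Complex.I) (hg.mono fun z hz => by
      have h2 := (Complex.mem_reProdIm.1 hz).2
      have e1 : (-(R : ℂ)).im = 0 := by simp
      have e2 : ((R : ℂ) + R * Complex.I).im = R := by simp
      rw [e1, e2, Set.uIcc_of_le hR.le] at h2
      exact h2.1)
  have e1 : (-(R : ℂ)).re = -R := by simp
  have e2 : (-(R : ℂ)).im = 0 := by simp
  have e3 : ((R : ℂ) + R * Complex.I).re = R := by simp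
  have e4 : ((R : ℂ) + R * Complex.I).im = R := by simp
  rw [e1, e2, e3, e4] at hrect
  simp only [Complex.ofReal_zero, zero_mul, add_zero] at hrect
  have hbound : ∀ z : ℂ, 0 ≤ z.im → R ≤ ‖z‖ → ‖g z‖ ≤ C * (R ^ 2)⁻¹ := by
    intro z hz hRz
    refine (hC z hz).trans ?_
    gcongr
    nlinarith
  have b1 : ‖∫ x : ℝ in -R..R, g (x + R * Complex.I)‖ ≤ C * (R ^ 2)⁻¹ * |R - -R| := by
    refine intervalIntegral.norm_integral_le_of_norm_le_const fun x _ => hbound _ (by simp [hR.le]) ?_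
    have := Complex.abs_im_le_norm (x + R * Complex.I)
    simpa [abs_of_pos hR] using this
  have b2 : ‖∫ y : ℝ in (0 : ℝ)..R, g (R + y * Complex.I)‖ ≤ C * (R ^ 2)⁻¹ * |R - 0| := by
    refine intervalIntegral.norm_integral_le_of_norm_le_const fun y hy => hbound _ ?_ ?_
    · rw [Set.uIoc_of_le hR.le] at hy
      simpa using hy.1.le
    · have := Complex.abs_re_le_norm (R + y * Complex.I)
      simpa [abs_of_pos hR] using this
  have b3 : ‖∫ y : ℝ in (0 : ℝ)..R, g (((-R : ℝ) : ℂ) + y * Complex.I)‖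
      ≤ C * (R ^ 2)⁻¹ * |R - 0| := by
    refine intervalIntegral.norm_integral_le_of_norm_le_const fun y hy => hbound _ ?_ ?_
    · rw [Set.uIoc_of_le hR.le] at hy
      simpa using hy.1.le
    · have := Complex.abs_re_le_norm (((-R : ℝ) : ℂ) + y * Complex.I)
      simpa [abs_of_pos hR] using this
  have e5 : ∫ x : ℝ in -R..id R, g x = (∫ x : ℝ in -R..R, g (x + R * Complex.I))
      - Complex.I • (∫ y : ℝ in (0 : ℝ)..R, g (R + y * Complex.I))
      + Complex.I • (∫ y : ℝ in (0 : ℝ)..R, g (((-R : ℝ) : ℂ) + y * Complex.I)) := by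
    simp only [id]
    linear_combination hrect
  rw [e5]
  refine (norm_add_le _ _).trans ((add_le_add_left (norm_sub_le _ _) _).trans ?_)
  simp only [smul_eq_mul, norm_mul, Complex.norm_I, one_mul]
  rw [abs_of_pos (by linarith)] at b1 b2 b3
  calc _ ≤ C * (R ^ 2)⁻¹ * (R - -R) + C * (R ^ 2)⁻¹ * (R - 0) + C * (R ^ 2)⁻¹ * (R - 0) := by
        gcongr
    _ = 4 * C * R⁻¹ := by
        field_simp
        ring

/-- The Poisson formula for a bounded holomorphic function on the closed upper half-plane. -/
lemma poisson_formula {f : ℂ → ℂ} {C : ℝ} (hf : DifferentiableOn ℂ f {z | 0 ≤ z.im})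
    (hC : ∀ z : ℂ, 0 ≤ z.im → ‖f z‖ ≤ C) {z : ℂ} (hz : 0 < z.im) :
    ∫ x : ℝ, (poisson z.im (z.re - x) : ℂ) * f x = f z := by
  have hnhds : {z : ℂ | 0 ≤ z.im} ∈ 𝓝 z := by
    filter_upwards [Complex.continuous_im.continuousAt.eventually (lt_mem_nhds hz)] with w hw
    exact le_of_lt hw
  have hds := (Complex.differentiableOn_dslope hnhds).2 hf
  have hzc : ∀ ζ : ℂ, 0 ≤ ζ.im → ‖ζ - z‖ ≤ ‖ζ - (starRingEnd ℂ) z‖ ∧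
      z.im ≤ ‖ζ - (starRingEnd ℂ) z‖ := by
    intro ζ hζ
    constructor
    · rw [← sq_le_sq₀ (norm_nonneg _) (norm_nonneg _), ← Complex.normSq_eq_norm_sq,
        ← Complex.normSq_eq_norm_sq, Complex.normSq_apply, Complex.normSq_apply]
      simp only [Complex.sub_re, Complex.sub_im, Complex.conj_re, Complex.conj_im]
      nlinarith [mul_nonneg hζ hz.le]
    · have := (le_abs_self _).trans (Complex.abs_im_le_norm (ζ - (starRingEnd ℂ) z))
      simp only [Complex.sub_im, Complex.conj_im] at this
      linarith
  -- The pole of `(f(ζ) - f(z)) / ((ζ - z)(ζ - z̄))` at `ζ = z` is removable, and on the real line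
  -- `1 / ((x - z)(x - z̄))` is `π / Im z` times the Poisson kernel.
  set g : ℂ → ℂ := fun ζ => dslope f z ζ / (ζ - (starRingEnd ℂ) z) with hg
  have hgd : DifferentiableOn ℂ g {z | 0 ≤ z.im} := by
    refine hds.div (by fun_prop) fun ζ hζ => ?_
    exact norm_pos_iff.1 (hz.trans_le (hzc ζ hζ).2)
  obtain ⟨M, hM⟩ := ((isCompact_closedBall z 1).inter_right
    (isClosed_le continuous_const Complex.continuous_im)).exists_bound_of_continuousOn
    (hds.continuousOn.mono (Set.inter_subset_right (s := Metric.closedBall z 1)))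
  have hM0 : 0 ≤ M := (norm_nonneg _).trans (hM z ⟨by simp, hz.le⟩)
  have hC0 : 0 ≤ C := (norm_nonneg _).trans (hC z hz.le)
  have hgb : ∀ ζ : ℂ, 0 ≤ ζ.im →
      ‖g ζ‖ ≤ ((M * (z.im)⁻¹ + 2 * C) * (1 + (1 + ‖z‖) ^ 2)) * (1 + ‖ζ‖ ^ 2)⁻¹ := by
    intro ζ hζ
    rw [← div_eq_mul_inv, le_div_iff₀ (by positivity)]
    simp only [hg, norm_div]
    obtain ⟨k1, k2⟩ := hzc ζ hζ
    have k3 : ‖ζ‖ ≤ ‖ζ - z‖ + ‖z‖ := by simpa using norm_add_le (ζ - z) z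
    have hzn := norm_nonneg z
    rcases le_total ‖ζ - z‖ 1 with h1 | h1
    · have m1 : ‖dslope f z ζ‖ ≤ M := hM ζ ⟨by simpa [dist_eq_norm] using h1, hζ⟩
      have m2 : ‖dslope f z ζ‖ / ‖ζ - (starRingEnd ℂ) z‖ ≤ M * (z.im)⁻¹ + 2 * C := by
        rw [div_eq_mul_inv]
        have : ‖dslope f z ζ‖ * ‖ζ - (starRingEnd ℂ) z‖⁻¹ ≤ M * (z.im)⁻¹ := by
          gcongr
        linarith
      have m3 : ‖ζ‖ ≤ 1 + ‖z‖ := by linarith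
      gcongr
    · have hne : ζ ≠ z := by
        rintro rfl
        simp at h1
        linarith
      have m1 : ‖dslope f z ζ‖ ≤ 2 * C / ‖ζ - z‖ := by
        rw [dslope_of_ne _ hne, slope_def_field, norm_div]
        gcongr
        exact (norm_sub_le _ _).trans (by linarith [hC ζ hζ, hC z hz.le])
      have hp : 0 < ‖ζ - z‖ := by linarith
      have m2 : ‖dslope f z ζ‖ / ‖ζ - (starRingEnd ℂ) z‖ ≤ 2 * C / ‖ζ - z‖ / ‖ζ - z‖ := by
        gcongr
      have m3 : ‖ζ‖ ≤ (1 + ‖z‖) * ‖ζ - z‖ := by nlinarith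
      have m4 : 1 + ‖ζ‖ ^ 2 ≤ (1 + (1 + ‖z‖) ^ 2) * ‖ζ - z‖ ^ 2 := by
        have := pow_le_pow_left₀ (norm_nonneg _) m3 2
        nlinarith
      calc _ ≤ (2 * C / ‖ζ - z‖ / ‖ζ - z‖) * ((1 + (1 + ‖z‖) ^ 2) * ‖ζ - z‖ ^ 2) := by gcongr
        _ = 2 * C * (1 + (1 + ‖z‖) ^ 2) := by field_simp
        _ ≤ (M * (z.im)⁻¹ + 2 * C) * (1 + (1 + ‖z‖) ^ 2) := by
          gcongr
          have : 0 ≤ M * (z.im)⁻¹ := by positivity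
          linarith
  obtain ⟨hint, hzero⟩ := integral_ofReal_eq_zero hgd hgb
  have hgx : ∀ x : ℝ, (z.im / Real.pi : ℂ) * g x
      = (poisson z.im (z.re - x) : ℂ) * f x - (poisson z.im (z.re - x) : ℂ) * f z := by
    intro x
    have hne : (x : ℂ) ≠ z := by
      intro h
      rw [← h] at hz
      simp at hz
    have hne2 : (x : ℂ) - (starRingEnd ℂ) z ≠ 0 :=
      norm_pos_iff.1 (hz.trans_le (hzc x (by simp)).2)
    have hprod : ((x : ℂ) - z) * ((x : ℂ) - (starRingEnd ℂ) z)
        = (((z.re - x) ^ 2 + z.im ^ 2 : ℝ) : ℂ) := by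
      apply Complex.ext
      · simp only [Complex.mul_re, Complex.sub_re, Complex.sub_im, Complex.conj_re,
          Complex.conj_im, Complex.ofReal_re, Complex.ofReal_im]
        ring
      · simp only [Complex.mul_im, Complex.sub_re, Complex.sub_im, Complex.conj_re,
          Complex.conj_im, Complex.ofReal_re, Complex.ofReal_im]
        ring
    simp only [hg]
    rw [dslope_of_ne _ hne, slope_def_field, div_div, hprod, poisson]
    have hpi : (Real.pi : ℂ) ≠ 0 := by exact_mod_cast Real.pi_ne_zero
    have hden : (((z.re - x) ^ 2 + z.im ^ 2 : ℝ) : ℂ) ≠ 0 := by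
      have : 0 < (z.re - x) ^ 2 + z.im ^ 2 := by positivity
      exact_mod_cast this.ne'
    push_cast at hden ⊢
    field_simp
  have hP : Integrable fun x : ℝ => (poisson z.im (z.re - x) : ℂ) :=
    (integrable_poisson_sub hz z.re).ofReal
  have hPf : Integrable fun x : ℝ => (poisson z.im (z.re - x) : ℂ) * f x := by
    have := (hint.const_mul (z.im / Real.pi : ℂ)).add (hP.mul_const (f z))
    refine this.congr (Eventually.of_forall fun x => ?_)
    simp only [Pi.add_apply, hgx]
    ring
  have h1 : ∫ x : ℝ, (z.im / Real.pi : ℂ) * g x = 0 := by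
    rw [integral_const_mul, hzero, mul_zero]
  simp only [hgx] at h1
  rw [integral_sub hPf (hP.mul_const _), integral_mul_const, integral_complex_ofReal,
    integral_poisson_sub hz] at h1
  simpa [sub_eq_zero] using h1

/-- The density `-π⁻¹ Im f(· + i ε)` of the Stieltjes inversion formula. -/
noncomputable def inversionDensity (f : ℂ → ℂ) (ε x : ℝ) : ℝ :=
  -(Real.pi⁻¹ * (f (x + ε * Complex.I)).im)

section

variable {f : ℂ → ℂ}

lemma continuous_inversionDensity (hf : DifferentiableOn ℂ f {z | 0 < z.im}) {ε : ℝ}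
    (hε : 0 < ε) : Continuous (inversionDensity f ε) := by
  unfold inversionDensity
  have : Continuous fun x : ℝ => f (x + ε * Complex.I) :=
    hf.continuousOn.comp_continuous (by fun_prop) (fun x => by simpa using hε)
  exact (continuous_const.mul (Complex.continuous_im.comp this)).neg

lemma inversionDensity_nonneg (him : ∀ z : ℂ, 0 < z.im → (f z).im ≤ 0) {ε : ℝ} (hε : 0 < ε)
    (x : ℝ) : 0 ≤ inversionDensity f ε x := by
  unfold inversionDensity
  have h1 := him (x + ε * Complex.I) (by simpa using hε)
  have h2 : 0 < Real.pi⁻¹ := inv_pos.2 Real.pi_pos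
  nlinarith

lemma abs_inversionDensity_le (hb : ∀ z : ℂ, 0 < z.im → ‖f z‖ ≤ (z.im)⁻¹) {ε : ℝ} (hε : 0 < ε)
    (x : ℝ) : |inversionDensity f ε x| ≤ Real.pi⁻¹ * ε⁻¹ := by
  unfold inversionDensity
  rw [abs_neg, abs_mul, abs_of_pos (inv_pos.2 Real.pi_pos)]
  gcongr
  have h := (Complex.abs_im_le_norm _).trans (hb (x + ε * Complex.I) (by simpa using hε))
  simpa using h

/-- The inversion densities at different heights are related by the Poisson semigroup. -/
lemma inversionDensity_add (hf : DifferentiableOn ℂ f {z | 0 < z.im})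
    (hb : ∀ z : ℂ, 0 < z.im → ‖f z‖ ≤ (z.im)⁻¹) {ε η : ℝ} (hε : 0 < ε) (hη : 0 < η) (x : ℝ) :
    ∫ y, poisson η (x - y) * inversionDensity f ε y = inversionDensity f (ε + η) x := by
  have hd : DifferentiableOn ℂ (fun z => f (z + ε * Complex.I)) {z | 0 ≤ z.im} := by
    refine hf.comp (by fun_prop) fun z hz => ?_
    simp only [Set.mem_ofPred_eq, Complex.add_im, Complex.mul_im, Complex.ofReal_re, Complex.I_im,
      mul_one, Complex.ofReal_im, Complex.I_re, mul_zero, add_zero] at hz ⊢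
    linarith
  have hbd : ∀ z : ℂ, 0 ≤ z.im → ‖f (z + ε * Complex.I)‖ ≤ ε⁻¹ := by
    intro z hz
    have him : (z + ε * Complex.I).im = z.im + ε := by simp
    refine (hb _ (by rw [him]; linarith)).trans ?_
    rw [him]
    exact inv_anti₀ hε (by linarith)
  have h := poisson_formula hd hbd (z := x + η * Complex.I) (by simpa using hη)
  have e1 : ((x : ℂ) + η * Complex.I).im = η := by simp
  have e2 : ((x : ℂ) + η * Complex.I).re = x := by simp
  rw [e1, e2] at h
  have hcont : Continuous fun y : ℝ => f (y + ε * Complex.I) :=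
    hf.continuousOn.comp_continuous (by fun_prop) (fun x => by simpa using hε)
  have hint : Integrable fun y : ℝ => (poisson η (x - y) : ℂ) * f (y + ε * Complex.I) := by
    refine ((integrable_poisson_sub hη x).mul_const ε⁻¹).mono'
      (Continuous.aestronglyMeasurable ?_) (Eventually.of_forall fun y => ?_)
    · exact (Complex.continuous_ofReal.comp ((continuous_poisson hη).comp (by fun_prop))).mul hcont
    · rw [norm_mul, Complex.norm_real, Real.norm_of_nonneg (poisson_pos hη _).le]
      have := (poisson_pos hη (x - y)).le
      gcongr
      exact hbd y (by simp)
  have him := integral_im hint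
  simp only [RCLike.im_to_complex, Complex.im_ofReal_mul] at him
  rw [h] at him
  have e3 : ∀ y, poisson η (x - y) * inversionDensity f ε y
      = -Real.pi⁻¹ * (poisson η (x - y) * (f (y + ε * Complex.I)).im) := by
    intro y
    unfold inversionDensity
    ring
  simp only [e3]
  rw [integral_const_mul, him, inversionDensity]
  push_cast
  rw [show (x : ℂ) + η * Complex.I + ε * Complex.I = x + (ε + η) * Complex.I by ring]
  ring

/-- Total mass as a limit of Poisson averages. -/
lemma lintegral_eq_one_of_poisson {h : ℝ → ℝ} (hm : Measurable h) (h0 : ∀ x, 0 ≤ h x)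
    {C : ℝ} (hC : ∀ x, h x ≤ C)
    (hlim : Tendsto (fun n : ℕ => Real.pi * ((n : ℝ) + 1) * ∫ y, poisson ((n : ℝ) + 1) (0 - y) * h y)
      atTop (𝓝 1)) :
    ∫⁻ y, ENNReal.ofReal (h y) = 1 := by
  have hker : ∀ (n : ℕ) (y : ℝ), Real.pi * ((n : ℝ) + 1) * (poisson ((n : ℝ) + 1) (0 - y) * h y)
      = (1 - y ^ 2 / (y ^ 2 + ((n : ℝ) + 1) ^ 2)) * h y := by
    intro n y
    have := Real.pi_pos
    unfold poisson
    field_simp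
    ring
  have hk : ∀ (n : ℕ) (y : ℝ), 0 ≤ 1 - y ^ 2 / (y ^ 2 + ((n : ℝ) + 1) ^ 2) := by
    intro n y
    rw [sub_nonneg, div_le_one (by positivity)]
    have : 0 ≤ ((n : ℝ) + 1) ^ 2 := by positivity
    linarith
  have h1 : Tendsto (fun n : ℕ => ∫⁻ y, ENNReal.ofReal
      ((1 - y ^ 2 / (y ^ 2 + ((n : ℝ) + 1) ^ 2)) * h y)) atTop
      (𝓝 (∫⁻ y, ENNReal.ofReal (h y))) := by
    refine lintegral_tendsto_of_tendsto_of_monotone ?_ ?_ ?_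
    · intro n
      refine Measurable.aemeasurable ?_
      fun_prop
    · refine Eventually.of_forall fun y n m hnm => ENNReal.ofReal_le_ofReal ?_
      refine mul_le_mul_of_nonneg_right ?_ (h0 y)
      have : (n : ℝ) ≤ m := by exact_mod_cast hnm
      gcongr
    · refine Eventually.of_forall fun y => ?_
      refine (ENNReal.continuous_ofReal.tendsto _).comp ?_
      have h2 : Tendsto (fun n : ℕ => y ^ 2 + ((n : ℝ) + 1) ^ 2) atTop atTop := by
        refine tendsto_atTop_add_const_left _ _ ?_
        exact (tendsto_pow_atTop two_ne_zero).comp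
          (tendsto_atTop_add_const_right _ _ tendsto_natCast_atTop_atTop)
      have h3 := ((h2.const_div_atTop (y ^ 2)).const_sub 1).mul_const (h y)
      simpa using h3
  have h2 : ∀ n : ℕ, ∫⁻ y, ENNReal.ofReal ((1 - y ^ 2 / (y ^ 2 + ((n : ℝ) + 1) ^ 2)) * h y)
      = ENNReal.ofReal (Real.pi * ((n : ℝ) + 1) * ∫ y, poisson ((n : ℝ) + 1) (0 - y) * h y) := by
    intro n
    have hn : (0 : ℝ) < (n : ℝ) + 1 := by positivity
    rw [← integral_const_mul]
    simp only [hker]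
    rw [ofReal_integral_eq_lintegral_ofReal]
    · have : Integrable fun y => Real.pi * ((n : ℝ) + 1) * (poisson ((n : ℝ) + 1) (0 - y) * h y) := by
        refine Integrable.const_mul ?_ _
        refine ((integrable_poisson_sub hn 0).mul_const C).mono'
          (((continuous_poisson hn).measurable.comp (by fun_prop)).mul hm).aestronglyMeasurable
          (Eventually.of_forall fun y => ?_)
        have hp := (poisson_pos hn (0 - y)).le
        rw [Real.norm_of_nonneg (mul_nonneg hp (h0 y))]
        exact mul_le_mul_of_nonneg_left (hC y) hp
      simpa only [hker] using this
    · exact Eventually.of_forall fun y => mul_nonneg (hk n y) (h0 y)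
  simp only [h2] at h1
  have h3 := (ENNReal.continuous_ofReal.tendsto 1).comp hlim
  rw [ENNReal.ofReal_one] at h3
  exact tendsto_nhds_unique h1 h3

lemma tendsto_inversionDensity (hlim : Tendsto (fun y : ℝ => (y * Complex.I) * f (y * Complex.I))
    atTop (𝓝 1)) (ε : ℝ) :
    Tendsto (fun n : ℕ => Real.pi * ((n : ℝ) + 1) * inversionDensity f (ε + ((n : ℝ) + 1)) 0)
      atTop (𝓝 1) := by
  have hn : Tendsto (fun n : ℕ => ε + ((n : ℝ) + 1)) atTop atTop :=
    tendsto_atTop_add_const_left _ _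
      (tendsto_atTop_add_const_right _ _ tendsto_natCast_atTop_atTop)
  have h1 := (Complex.continuous_re.tendsto _).comp (hlim.comp hn)
  have h2 : Tendsto (fun n : ℕ => 1 - ε / (ε + ((n : ℝ) + 1))) atTop (𝓝 1) := by
    simpa using (hn.const_div_atTop ε).const_sub 1
  have h3 := h2.mul h1
  simp only [Complex.one_re, mul_one] at h3
  refine h3.congr' ?_
  filter_upwards [hn.eventually_gt_atTop 0] with n hn0
  have hpi := Real.pi_pos
  simp only [Function.comp_apply, inversionDensity, Complex.ofReal_zero, zero_add]
  rw [mul_assoc, Complex.re_ofReal_mul, Complex.I_mul_re]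
  field_simp
  ring

/-- A holomorphic function of the upper half-plane with nonpositive imaginary part and normalized
like `1/z` has inversion densities of total mass one. -/
lemma lintegral_inversionDensity (hf : DifferentiableOn ℂ f {z | 0 < z.im})
    (him : ∀ z : ℂ, 0 < z.im → (f z).im ≤ 0) (hb : ∀ z : ℂ, 0 < z.im → ‖f z‖ ≤ (z.im)⁻¹)
    (hlim : Tendsto (fun y : ℝ => (y * Complex.I) * f (y * Complex.I)) atTop (𝓝 1))
    {ε : ℝ} (hε : 0 < ε) : ∫⁻ x, ENNReal.ofReal (inversionDensity f ε x) = 1 := by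
  refine lintegral_eq_one_of_poisson (continuous_inversionDensity hf hε).measurable
    (inversionDensity_nonneg him hε)
    (fun x => (le_abs_self _).trans (abs_inversionDensity_le hb hε x)) ?_
  refine (tendsto_inversionDensity hlim ε).congr fun n => ?_
  rw [inversionDensity_add hf hb hε (by positivity)]

end

/-! ### The free convolution of a measure with a semicircle law -/

open Classical in
/-- The subordination function: `subord μ t z` is the point `w` of the upper half-plane with
`w + t G(w) = z`. It is unique, and the value `z` is used only outside the domain `t ≥ 0`,
`Im z > 0`. -/
noncomputable def subord (μ : Measure ℝ) (t : ℝ) (z : ℂ) : ℂ :=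
  if h : ∃ w : ℂ, 0 < w.im ∧ w + t * stieltjes μ w = z then h.choose else z

/-- The Stieltjes transform of the free convolution of `μ` with the semicircle law of
variance `t`. -/
noncomputable def freeStieltjes (μ : Measure ℝ) (t : ℝ) (z : ℂ) : ℂ :=
  stieltjes μ (subord μ t z)

section

variable {μ : Measure ℝ} [IsProbabilityMeasure μ] {t : ℝ}

lemma subord_spec (ht : 0 ≤ t) {z : ℂ} (hz : 0 < z.im) :
    0 < (subord μ t z).im ∧ subord μ t z + t * stieltjes μ (subord μ t z) = z := by
  have h := exists_subordination (μ := μ) ht hz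
  rw [subord, dif_pos h]
  exact h.choose_spec

lemma subord_eq (ht : 0 ≤ t) {z : ℂ} (hz : 0 < z.im) :
    subord μ t z = z - t * freeStieltjes μ t z :=
  eq_sub_of_add_eq (subord_spec ht hz).2

lemma im_le_subord_im (ht : 0 ≤ t) {z : ℂ} (hz : 0 < z.im) : z.im ≤ (subord μ t z).im :=
  im_le_of_subordination ht (subord_spec ht hz).1 (subord_spec ht hz).2

lemma freeStieltjes_zero {z : ℂ} (hz : 0 < z.im) : freeStieltjes μ 0 z = stieltjes μ z := by
  rw [freeStieltjes, subord_eq le_rfl hz]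
  simp

lemma freeStieltjes_im_nonpos (ht : 0 ≤ t) {z : ℂ} (hz : 0 < z.im) :
    (freeStieltjes μ t z).im ≤ 0 :=
  stieltjes_im_nonpos (subord_spec ht hz).1

lemma norm_freeStieltjes_le (ht : 0 ≤ t) {z : ℂ} (hz : 0 < z.im) :
    ‖freeStieltjes μ t z‖ ≤ (z.im)⁻¹ :=
  (norm_stieltjes_le (subord_spec ht hz).1).trans (inv_anti₀ hz (im_le_subord_im ht hz))

/-- The free convolution regularizes: its Stieltjes transform is bounded by `t ^ (-1/2)`. -/
lemma mul_norm_freeStieltjes_sq_le (ht : 0 ≤ t) {z : ℂ} (hz : 0 < z.im) :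
    t * ‖freeStieltjes μ t z‖ ^ 2 ≤ 1 := by
  obtain ⟨h1, h2⟩ := subord_spec (μ := μ) ht hz
  have h3 := mul_resolventSq_eq h1 h2
  have h4 : 0 ≤ z.im / (subord μ t z).im := by positivity
  calc t * ‖freeStieltjes μ t z‖ ^ 2 ≤ t * resolventSq μ (subord μ t z) := by
        gcongr
        exact norm_stieltjes_sq_le h1
    _ ≤ 1 := by linarith

lemma norm_freeStieltjes_le_inv_sqrt (ht : 0 < t) {z : ℂ} (hz : 0 < z.im) :
    ‖freeStieltjes μ t z‖ ≤ (√t)⁻¹ := by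
  have h := mul_norm_freeStieltjes_sq_le (μ := μ) ht.le hz
  rw [← Real.sqrt_inv]
  refine Real.le_sqrt_of_sq_le ?_
  rw [← one_div, le_div_iff₀ ht]
  linarith

lemma continuousAt_subord (ht : 0 ≤ t) {z : ℂ} (hz : 0 < z.im) :
    ContinuousAt (subord μ t) z := by
  set η := z.im / 2 with hη
  have hη0 : 0 < η := by positivity
  have hk : 0 < η ^ 2 / (η ^ 2 + t) := by positivity
  rw [ContinuousAt, tendsto_iff_norm_sub_tendsto_zero]
  have hlim : Tendsto (fun w : ℂ => ‖w - z‖ / (η ^ 2 / (η ^ 2 + t))) (𝓝 z) (𝓝 0) := by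
    have : Tendsto (fun w : ℂ => ‖w - z‖) (𝓝 z) (𝓝 0) :=
      tendsto_iff_norm_sub_tendsto_zero.1 tendsto_id
    simpa using this.div_const (η ^ 2 / (η ^ 2 + t))
  refine squeeze_zero' (Eventually.of_forall fun _ => norm_nonneg _) ?_ hlim
  filter_upwards [Complex.continuous_im.continuousAt.eventually
    (lt_mem_nhds (show η < z.im by rw [hη]; linarith))] with w hw
  have hw0 : 0 < w.im := hη0.trans hw
  rw [le_div_iff₀ hk]
  have := norm_subordination_sub_le ht le_rfl hη0 hw.le (by rw [hη]; linarith)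
    (subord_spec (μ := μ) ht hw0).1 (subord_spec (μ := μ) ht hz).1 (subord_spec ht hw0).2
    (subord_spec ht hz).2
  simpa using this

lemma norm_deriv_stieltjes_le_resolventSq {z : ℂ} (hz : 0 < z.im) :
    ‖deriv (stieltjes μ) z‖ ≤ resolventSq μ z := by
  rw [(hasDerivAt_stieltjes hz).deriv]
  refine (norm_integral_le_integral_norm _).trans_eq ?_
  rw [resolventSq]
  congr 1
  ext x
  rw [norm_neg, norm_mul, norm_inv, ← mul_inv, sq]

lemma differentiableAt_subord (ht : 0 ≤ t) {z : ℂ} (hz : 0 < z.im) :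
    DifferentiableAt ℂ (subord μ t) z := by
  obtain ⟨h1, h2⟩ := subord_spec (μ := μ) ht hz
  have hd : HasDerivAt (fun w => w + t * stieltjes μ w)
      (1 + t * deriv (stieltjes μ) (subord μ t z)) (subord μ t z) :=
    (hasDerivAt_id _).add ((hasDerivAt_stieltjes h1).differentiableAt.hasDerivAt.const_mul (t : ℂ))
  have hne : 1 + t * deriv (stieltjes μ) (subord μ t z) ≠ 0 := by
    intro h0
    have h3 : ‖(t : ℂ) * deriv (stieltjes μ) (subord μ t z)‖ < 1 := by
      rw [norm_mul, Complex.norm_real, Real.norm_of_nonneg ht]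
      have h4 := mul_le_mul_of_nonneg_left (norm_deriv_stieltjes_le_resolventSq (μ := μ) h1) ht
      rw [mul_resolventSq_eq h1 h2] at h4
      have : 0 < z.im / (subord μ t z).im := by positivity
      linarith
    rw [eq_neg_of_add_eq_zero_right h0] at h3
    simp at h3
  refine (HasDerivAt.of_local_left_inverse (continuousAt_subord ht hz) hd hne ?_).differentiableAt
  filter_upwards [Complex.continuous_im.continuousAt.eventually (lt_mem_nhds hz)] with w hw
  exact (subord_spec ht hw).2

lemma differentiableOn_freeStieltjes (ht : 0 ≤ t) :
    DifferentiableOn ℂ (freeStieltjes μ t) {z | 0 < z.im} := fun z hz =>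
  ((hasDerivAt_stieltjes (subord_spec ht hz).1).differentiableAt.comp z
    (differentiableAt_subord ht hz)).differentiableWithinAt

lemma tendsto_mul_freeStieltjes (ht : 0 ≤ t) :
    Tendsto (fun y : ℝ => (y * Complex.I) * freeStieltjes μ t (y * Complex.I)) atTop (𝓝 1) := by
  have h0 : Tendsto (fun y : ℝ => (y * Complex.I) * (freeStieltjes μ t (y * Complex.I)
      - stieltjes μ (y * Complex.I))) atTop (𝓝 0) := by
    have hb : Tendsto (fun y : ℝ => t * (y⁻¹ * y⁻¹)) atTop (𝓝 0) := by
      simpa using (tendsto_inv_atTop_zero.mul tendsto_inv_atTop_zero).const_mul t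
    refine squeeze_zero_norm' ?_ hb
    filter_upwards [eventually_gt_atTop 0] with y hy
    set z : ℂ := y * Complex.I with hzdef
    have hzi : z.im = y := by simp [hzdef]
    have hz : 0 < z.im := by rwa [hzi]
    have hzn : ‖z‖ = y := by simp [hzdef, abs_of_pos hy]
    obtain ⟨h1, h2⟩ := subord_spec (μ := μ) ht hz
    have h3 := im_le_subord_im (μ := μ) ht hz
    have e1 : z - subord μ t z = t * freeStieltjes μ t z := by
      rw [subord_eq ht hz]; ring
    rw [norm_mul, hzn, freeStieltjes, stieltjes_sub hz h1, norm_mul, e1, norm_mul,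
      Complex.norm_real, Real.norm_of_nonneg ht]
    have b1 := norm_freeStieltjes_le (μ := μ) ht hz
    rw [hzi] at b1 h3
    have b2 : ‖∫ x : ℝ, (subord μ t z - x)⁻¹ * (z - x)⁻¹ ∂μ‖ ≤ y⁻¹ * y⁻¹ := by
      have c1 := resolventSq_le (μ := μ) h1
      have c2 := resolventSq_le (μ := μ) hz
      have c3 : ((subord μ t z).im ^ 2)⁻¹ ≤ (y ^ 2)⁻¹ := by gcongr
      rw [hzi] at c2
      refine (norm_integral_inv_mul_le _ _).trans
        ((integral_norm_inv_mul_le hz h1 one_pos).trans ?_)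
      rw [← mul_inv, ← sq]
      linarith
    calc y * (t * ‖freeStieltjes μ t z‖ * ‖∫ x : ℝ, (subord μ t z - x)⁻¹ * (z - x)⁻¹ ∂μ‖)
        ≤ y * (t * y⁻¹ * (y⁻¹ * y⁻¹)) := by gcongr
      _ = t * (y⁻¹ * y⁻¹) := by field_simp
  have h1 := h0.add (tendsto_mul_stieltjes (μ := μ))
  rw [zero_add] at h1
  refine h1.congr fun y => ?_
  ring

/-- The semigroup property of the free convolution flow, on Stieltjes transforms. -/
lemma freeStieltjes_semigroup {s : ℝ} (ht : 0 ≤ t) (hs : 0 ≤ s) {z : ℂ} (hz : 0 < z.im)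
    (hz' : 0 < (z - (s - t) * freeStieltjes μ s z).im) :
    freeStieltjes μ t (z - (s - t) * freeStieltjes μ s z) = freeStieltjes μ s z := by
  obtain ⟨h1, h2⟩ := subord_spec (μ := μ) hs hz
  have h3 : subord μ s z + t * stieltjes μ (subord μ s z)
      = z - (s - t) * freeStieltjes μ s z := by
    rw [freeStieltjes]
    linear_combination h2
  have h4 := subordination_unique ht hz' (subord_spec ht hz').1 h1 (subord_spec ht hz').2 h3
  rw [freeStieltjes, h4, freeStieltjes]

end

lemma ofReal_add_mul_I_im (x η : ℝ) : ((x : ℂ) + η * Complex.I).im = η := by simp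

lemma ofReal_add_mul_I_re (x η : ℝ) : ((x : ℂ) + η * Complex.I).re = x := by simp

lemma im_inv_eq_poisson (η x y : ℝ) :
    (((x : ℂ) + η * Complex.I - y)⁻¹).im = -(Real.pi * poisson η (x - y)) := by
  rw [im_inv_sub_ofReal, norm_sq_sub_ofReal, ofReal_add_mul_I_im, ofReal_add_mul_I_re, poisson]
  have := Real.pi_pos
  rw [← mul_div_assoc, mul_div_mul_left _ _ this.ne', div_eq_mul_inv, neg_mul]

/-- The inversion density of a Stieltjes transform is a Poisson average of the measure. -/
lemma inversionDensity_stieltjes (μ : Measure ℝ) [IsFiniteMeasure μ] {η : ℝ} (hη : 0 < η)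
    (x : ℝ) : inversionDensity (stieltjes μ) η x = ∫ y, poisson η (x - y) ∂μ := by
  have hz : 0 < ((x : ℂ) + η * Complex.I).im := by simpa using hη
  have h := integral_im (integrable_inv_sub (μ := μ) hz)
  simp only [RCLike.im_to_complex] at h
  rw [inversionDensity, stieltjes, ← h]
  simp only [im_inv_eq_poisson]
  rw [integral_neg, integral_const_mul]
  have := Real.pi_pos
  field_simp

/-- Two functions holomorphic in the upper half-plane with the same inversion densities and the
same normalization at `i∞` agree. -/
lemma eqOn_of_inversionDensity_eq {f g : ℂ → ℂ} (hf : DifferentiableOn ℂ f {z | 0 < z.im})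
    (hg : DifferentiableOn ℂ g {z | 0 < z.im})
    (hlf : Tendsto (fun y : ℝ => (y * Complex.I) * f (y * Complex.I)) atTop (𝓝 1))
    (hlg : Tendsto (fun y : ℝ => (y * Complex.I) * g (y * Complex.I)) atTop (𝓝 1))
    (h : ∀ η x : ℝ, 0 < η → inversionDensity f η x = inversionDensity g η x) {z : ℂ}
    (hz : 0 < z.im) : f z = g z := by
  have hopen : IsOpen {z : ℂ | 0 < z.im} := isOpen_lt continuous_const Complex.continuous_im
  have hconn : IsConnected {z : ℂ | 0 < z.im} :=
    (convex_halfSpace_im_gt 0).isConnected ⟨Complex.I, by simp⟩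
  have ha : AnalyticOnNhd ℂ (fun z => f z - g z) {z : ℂ | 0 < z.im} :=
    (hf.sub hg).analyticOnNhd hopen
  have him : ∀ z ∈ {z : ℂ | 0 < z.im}, (f z - g z).im = 0 := by
    intro z hz
    have h1 := h z.im z.re hz
    unfold inversionDensity at h1
    rw [Complex.re_add_im] at h1
    have h2 := mul_left_cancel₀ (inv_pos.2 Real.pi_pos).ne' (neg_injective h1)
    rw [Complex.sub_im, h2, sub_self]
  obtain ⟨c, hc⟩ := ha.eq_const_of_im_eq_const him hopen hconn
  have hlim : Tendsto (fun y : ℝ => (y * Complex.I) * c) atTop (𝓝 0) := by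
    have := hlf.sub hlg
    rw [sub_self] at this
    refine this.congr' ?_
    filter_upwards [eventually_gt_atTop 0] with y hy
    rw [← mul_sub, hc (y * Complex.I) (by simpa using hy)]
  have hc0 : c = 0 := by
    have h1 : Tendsto (fun y : ℝ => y⁻¹ * ‖(y * Complex.I) * c‖) atTop (𝓝 0) := by
      simpa using tendsto_inv_atTop_zero.mul hlim.norm
    have h2 : Tendsto (fun _ : ℝ => ‖c‖) atTop (𝓝 0) := by
      refine h1.congr' ?_
      filter_upwards [eventually_gt_atTop 0] with y hy
      simp only [norm_mul, Complex.norm_real, Complex.norm_I, mul_one]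
      rw [Real.norm_of_nonneg hy.le]
      field_simp
    exact norm_eq_zero.1 (tendsto_nhds_unique tendsto_const_nhds h2)
  have := hc z hz
  rw [hc0] at this
  exact sub_eq_zero.1 this

/-- The boundary value `-π⁻¹ Im G_t(x + i 0)`, which is the density of the free convolution of `μ`
with the semicircle law of variance `t > 0`. The limit exists at every `x`, because the Stieltjes
transform is uniformly continuous up to the real line on bounded sets. -/
noncomputable def freeDensity (μ : Measure ℝ) (t x : ℝ) : ℝ :=
  limUnder atTop fun n : ℕ => inversionDensity (freeStieltjes μ t) (1 / ((n : ℝ) + 1)) x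

section

variable {μ : Measure ℝ} [IsProbabilityMeasure μ] {t : ℝ}

lemma tendsto_freeDensity (ht : 0 < t) (x : ℝ) :
    Tendsto (fun n : ℕ => inversionDensity (freeStieltjes μ t) (1 / ((n : ℝ) + 1)) x) atTop
      (𝓝 (freeDensity μ t x)) := by
  set a : ℕ → ℝ := fun n => 1 / ((n : ℝ) + 1) with ha
  have ha0 : ∀ n, 0 < a n := fun n => by simp only [ha]; positivity
  have ha1 : ∀ n, a n ≤ 1 := fun n => by
    simp only [ha]
    rw [div_le_one (by positivity)]
    linarith [(Nat.cast_nonneg n : (0 : ℝ) ≤ n)]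
  set z : ℕ → ℂ := fun n => x + a n * Complex.I with hz
  have hzi : ∀ n, 0 < (z n).im := fun n => by
    simp only [hz]; rw [ofReal_add_mul_I_im]; exact ha0 n
  set w : ℕ → ℂ := fun n => subord μ t (z n) with hw
  set B : ℝ := |x| + 1 + t * (√t)⁻¹ with hB
  have hwB : ∀ n, ‖w n‖ ≤ B := by
    intro n
    simp only [hw]
    rw [subord_eq ht.le (hzi n)]
    refine (norm_sub_le _ _).trans ?_
    rw [norm_mul, Complex.norm_real, Real.norm_of_nonneg ht.le]
    have h1 := norm_freeStieltjes_le_inv_sqrt (μ := μ) ht (hzi n)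
    have h2 : ‖z n‖ ≤ |x| + 1 := by
      simp only [hz]
      refine (norm_add_le _ _).trans ?_
      simp only [norm_mul, Complex.norm_real, Complex.norm_I, mul_one, Real.norm_eq_abs]
      rw [abs_of_pos (ha0 n)]
      linarith [ha1 n]
    have h3 := mul_le_mul_of_nonneg_left h1 ht.le
    linarith
  set c : ℝ := t / 2 * (∫ x : ℝ, ((1 + B + |x|) ^ 4)⁻¹ ∂μ) with hc
  have hB0 : 0 ≤ B := by positivity
  have hc0 : 0 < c := by
    refine mul_pos (by positivity) ?_
    rw [integral_pos_iff_support_of_nonneg (fun x => by positivity)]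
    · have : Function.support (fun x : ℝ => ((1 + B + |x|) ^ 4)⁻¹) = Set.univ := by
        ext x
        simp only [Function.mem_support, Set.mem_univ, iff_true]
        positivity
      rw [this]
      simp
    · refine Integrable.of_bound (Continuous.aestronglyMeasurable ?_) 1
        (Eventually.of_forall fun x => ?_)
      · exact Continuous.inv₀ (by fun_prop) fun x => by positivity
      · rw [Real.norm_of_nonneg (by positivity)]
        refine inv_le_one_of_one_le₀ (one_le_pow₀ ?_)
        have := abs_nonneg x
        linarith
  have hcauchy : CauchySeq w := by
    have hac : CauchySeq a := tendsto_one_div_add_atTop_nhds_zero_nat.cauchySeq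
    rw [Metric.cauchySeq_iff] at hac ⊢
    intro ε hε
    obtain ⟨N, hN⟩ := hac (c * ε ^ 3) (by positivity)
    refine ⟨N, fun m hm n hn => ?_⟩
    have h1 := hN m hm n hn
    have h2 := norm_subordination_sub_cube_le ht.le (hzi m) (hzi n)
      (subord_spec (μ := μ) ht.le (hzi m)).1 (subord_spec (μ := μ) ht.le (hzi n)).1
      (subord_spec ht.le (hzi m)).2 (subord_spec ht.le (hzi n)).2 (hwB m) (hwB n)
    have h3 : ‖z m - z n‖ = dist (a m) (a n) := by
      simp only [hz]
      rw [add_sub_add_left_eq_sub, ← sub_mul, norm_mul, Complex.norm_I, mul_one,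
        ← Complex.ofReal_sub, Complex.norm_real, dist_eq_norm]
    rw [h3] at h2
    have h4 : c * ‖w m - w n‖ ^ 3 < c * ε ^ 3 := h2.trans_lt h1
    rw [dist_eq_norm]
    exact lt_of_pow_lt_pow_left₀ 3 hε.le (lt_of_mul_lt_mul_left h4 hc0.le)
  obtain ⟨w₀, hw₀⟩ := cauchySeq_tendsto_of_complete hcauchy
  have hz0 : Tendsto z atTop (𝓝 (x + (0 : ℝ) * Complex.I)) := by
    refine Tendsto.const_add _ (Tendsto.mul_const _ ?_)
    exact (Complex.continuous_ofReal.tendsto 0).comp tendsto_one_div_add_atTop_nhds_zero_nat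
  have hf : Tendsto (fun n => freeStieltjes μ t (z n)) atTop
      (𝓝 ((x + (0 : ℝ) * Complex.I - w₀) / t)) := by
    refine ((hz0.sub hw₀).div_const (t : ℂ)).congr fun n => ?_
    have : (t : ℂ) ≠ 0 := by exact_mod_cast ht.ne'
    simp only [hw]
    rw [subord_eq ht.le (hzi n)]
    field_simp
    ring
  have h := (((Complex.continuous_im.tendsto _).comp hf).const_mul Real.pi⁻¹).neg
  exact tendsto_nhds_limUnder ⟨_, h⟩

lemma measurable_freeDensity (ht : 0 < t) : Measurable (freeDensity μ t) := by
  refine measurable_of_tendsto_metrizable (fun n : ℕ => ?_)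
    (tendsto_pi_nhds.2 (tendsto_freeDensity (μ := μ) ht))
  exact (continuous_inversionDensity (differentiableOn_freeStieltjes ht.le)
    (by positivity)).measurable

lemma freeDensity_nonneg (ht : 0 < t) (x : ℝ) : 0 ≤ freeDensity μ t x :=
  ge_of_tendsto' (tendsto_freeDensity ht x) fun n =>
    inversionDensity_nonneg (fun _ hz => freeStieltjes_im_nonpos ht.le hz) (by positivity) x

lemma inversionDensity_freeStieltjes_le (ht : 0 < t) {ε : ℝ} (hε : 0 < ε) (x : ℝ) :
    inversionDensity (freeStieltjes μ t) ε x ≤ Real.pi⁻¹ * (√t)⁻¹ := by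
  have h1 := (neg_le_abs _).trans ((Complex.abs_im_le_norm _).trans
    (norm_freeStieltjes_le_inv_sqrt (μ := μ) (z := x + ε * Complex.I) ht (by simpa using hε)))
  rw [inversionDensity, ← mul_neg]
  have := Real.pi_pos
  gcongr

lemma freeDensity_le (ht : 0 < t) (x : ℝ) : freeDensity μ t x ≤ Real.pi⁻¹ * (√t)⁻¹ :=
  le_of_tendsto' (tendsto_freeDensity ht x) fun n =>
    inversionDensity_freeStieltjes_le ht (by positivity) x

/-- The inversion densities of the free convolution are the Poisson averages of its boundary
value. -/
lemma integral_poisson_mul_freeDensity (ht : 0 < t) {η : ℝ} (hη : 0 < η) (x : ℝ) :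
    ∫ y, poisson η (x - y) * freeDensity μ t y = inversionDensity (freeStieltjes μ t) η x := by
  have hd := differentiableOn_freeStieltjes (μ := μ) ht.le
  have h1 : Tendsto (fun n : ℕ => ∫ y, poisson η (x - y) *
      inversionDensity (freeStieltjes μ t) (1 / ((n : ℝ) + 1)) y) atTop
      (𝓝 (∫ y, poisson η (x - y) * freeDensity μ t y)) := by
    refine tendsto_integral_of_dominated_convergence
      (fun y => poisson η (x - y) * (Real.pi⁻¹ * (√t)⁻¹)) (fun n => ?_)
      ((integrable_poisson_sub hη x).mul_const _) (fun n => Eventually.of_forall fun y => ?_)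
      (Eventually.of_forall fun y => (tendsto_freeDensity ht y).const_mul _)
    · exact (((continuous_poisson hη).comp (by fun_prop)).mul
        (continuous_inversionDensity hd (by positivity))).aestronglyMeasurable
    · have h2 := (poisson_pos hη (x - y)).le
      have h3 := inversionDensity_nonneg (f := freeStieltjes μ t)
        (fun _ hz => freeStieltjes_im_nonpos ht.le hz)
        (ε := 1 / ((n : ℝ) + 1)) (by positivity) y
      rw [Real.norm_of_nonneg (mul_nonneg h2 h3)]
      gcongr
      exact inversionDensity_freeStieltjes_le ht (by positivity) y
  have h2 : Tendsto (fun n : ℕ => inversionDensity (freeStieltjes μ t) (1 / ((n : ℝ) + 1) + η) x)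
      atTop (𝓝 (inversionDensity (freeStieltjes μ t) η x)) := by
    have hc : ContinuousAt (fun ε : ℝ => inversionDensity (freeStieltjes μ t) ε x) η := by
      unfold inversionDensity
      have hz : 0 < ((x : ℂ) + η * Complex.I).im := by simpa using hη
      have hca : ContinuousAt (freeStieltjes μ t) (x + η * Complex.I) :=
        (hd.differentiableAt ((isOpen_lt continuous_const Complex.continuous_im).mem_nhds
          hz)).continuousAt
      have : ContinuousAt (fun ε : ℝ => freeStieltjes μ t (x + ε * Complex.I)) η :=
        ContinuousAt.comp (f := fun ε : ℝ => (x : ℂ) + ε * Complex.I) hca (by fun_prop)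
      exact (continuousAt_const.mul (Complex.continuous_im.continuousAt.comp this)).neg
    refine hc.tendsto.comp ?_
    simpa using (tendsto_one_div_add_atTop_nhds_zero_nat (𝕜 := ℝ)).add_const η
  refine tendsto_nhds_unique (h1.congr fun n => ?_) h2
  exact inversionDensity_add hd (fun _ hz => norm_freeStieltjes_le ht.le hz) (by positivity) hη x

lemma lintegral_freeDensity (ht : 0 < t) : ∫⁻ x, ENNReal.ofReal (freeDensity μ t x) = 1 := by
  refine lintegral_eq_one_of_poisson (measurable_freeDensity ht) (freeDensity_nonneg ht)
    (freeDensity_le ht) ?_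
  have := tendsto_inversionDensity (tendsto_mul_freeStieltjes (μ := μ) ht.le) 0
  refine this.congr fun n => ?_
  rw [integral_poisson_mul_freeDensity ht (by positivity), zero_add]

end

open Classical in
/-- The free convolution of `μ` with the semicircle law of variance `t`, understood as `μ` itself
for `t ≤ 0`. -/
noncomputable def freeConv (μ : Measure ℝ) (t : ℝ) : Measure ℝ :=
  if 0 < t then volume.withDensity fun x => ENNReal.ofReal (freeDensity μ t x) else μ

lemma freeConv_of_pos {μ : Measure ℝ} {t : ℝ} (ht : 0 < t) :
    freeConv μ t = volume.withDensity fun x => ENNReal.ofReal (freeDensity μ t x) :=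
  if_pos ht

lemma freeConv_zero {μ : Measure ℝ} : freeConv μ 0 = μ := if_neg (lt_irrefl _)

section

variable {μ : Measure ℝ} [IsProbabilityMeasure μ] {t : ℝ}

instance isProbabilityMeasure_freeConv : IsProbabilityMeasure (freeConv μ t) := by
  by_cases ht : 0 < t
  · rw [freeConv_of_pos ht]
    exact ⟨by rw [withDensity_apply _ MeasurableSet.univ, setLIntegral_univ,
      lintegral_freeDensity ht]⟩
  · rw [freeConv, if_neg ht]
    infer_instance

lemma integral_freeConv (ht : 0 < t) (φ : ℝ → ℝ) :
    ∫ y, φ y ∂(freeConv μ t) = ∫ y, φ y * freeDensity μ t y := by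
  rw [freeConv_of_pos ht, integral_withDensity_eq_integral_toReal_smul
    (measurable_freeDensity ht).ennreal_ofReal (Eventually.of_forall fun _ => by simp)]
  refine integral_congr_ae (Eventually.of_forall fun y => ?_)
  simp only [smul_eq_mul]
  rw [ENNReal.toReal_ofReal (freeDensity_nonneg ht y), mul_comm]

lemma differentiableOn_stieltjes : DifferentiableOn ℂ (stieltjes μ) {z | 0 < z.im} :=
  fun _ hz => (hasDerivAt_stieltjes hz).differentiableAt.differentiableWithinAt

lemma stieltjes_freeConv (ht : 0 ≤ t) {z : ℂ} (hz : 0 < z.im) :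
    stieltjes (freeConv μ t) z = freeStieltjes μ t z := by
  rcases ht.eq_or_lt with rfl | ht'
  · rw [freeConv_zero, freeStieltjes_zero hz]
  · refine eqOn_of_inversionDensity_eq differentiableOn_stieltjes
      (differentiableOn_freeStieltjes ht) tendsto_mul_stieltjes (tendsto_mul_freeStieltjes ht)
      (fun η x hη => ?_) hz
    rw [inversionDensity_stieltjes _ hη, integral_freeConv ht',
      integral_poisson_mul_freeDensity ht' hη]

/-- The free convolution flow along characteristics: `G_s(z) = G_t(z - (s - t) G_s(z))`. -/
lemma stieltjes_freeConv_semigroup {s : ℝ} (ht : 0 ≤ t) (hs : 0 ≤ s) {z : ℂ} (hz : 0 < z.im)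
    (hz' : 0 < (z - (s - t) * stieltjes (freeConv μ s) z).im) :
    stieltjes (freeConv μ t) (z - (s - t) * stieltjes (freeConv μ s) z)
      = stieltjes (freeConv μ s) z := by
  rw [stieltjes_freeConv hs hz] at hz' ⊢
  rw [stieltjes_freeConv ht hz', freeStieltjes_semigroup ht hs hz hz']

end

/-! ### Decay of the `L^p` norms -/

/-- A doubly substochastic kernel contracts every `L^p` norm. -/
lemma eLpNorm_lintegral_kernel_le {κ : ℝ → ℝ → ℝ≥0∞} (hκ : Measurable (Function.uncurry κ))
    (h1 : ∀ y, ∫⁻ x, κ y x = 1) (h2 : ∀ x, ∫⁻ y, κ y x ≤ 1) {f : ℝ → ℝ≥0∞} (hf : Measurable f)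
    {p : ℝ≥0∞} (hp : 1 ≤ p) :
    eLpNorm (fun y => ∫⁻ x, κ y x * f x) p volume ≤ eLpNorm f p volume := by
  have hκy : ∀ y, Measurable (κ y) := fun y => hκ.comp measurable_prodMk_left
  have hκx : ∀ x, Measurable fun y => κ y x := fun x => hκ.comp measurable_prodMk_right
  have hprob : ∀ y, IsProbabilityMeasure (volume.withDensity (κ y)) := fun y =>
    ⟨by rw [withDensity_apply _ MeasurableSet.univ, setLIntegral_univ, h1]⟩
  have hjensen : ∀ y, ∫⁻ x, κ y x * f x ≤ eLpNorm f p (volume.withDensity (κ y)) := by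
    intro y
    have := hprob y
    have h := eLpNorm_le_eLpNorm_of_exponent_le (μ := volume.withDensity (κ y)) hp
      hf.aestronglyMeasurable
    rw [eLpNorm_one_eq_lintegral_enorm,
      lintegral_withDensity_eq_lintegral_mul _ (hκy y) hf.enorm] at h
    simpa using h
  by_cases htop : p = ∞
  · subst htop
    rw [eLpNorm_exponent_top]
    refine essSup_le_of_ae_le _ (Eventually.of_forall fun y => ?_)
    simp only [enorm_eq_self]
    refine (hjensen y).trans ?_
    rw [eLpNorm_exponent_top]
    exact eLpNormEssSup_mono_measure f (withDensity_absolutelyContinuous _ _)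
  · have hp0 : p ≠ 0 := (zero_lt_one.trans_le hp).ne'
    have hpr : 0 < p.toReal := ENNReal.toReal_pos hp0 htop
    rw [eLpNorm_eq_lintegral_rpow_enorm_toReal hp0 htop,
      eLpNorm_eq_lintegral_rpow_enorm_toReal hp0 htop]
    refine ENNReal.rpow_le_rpow ?_ (by positivity)
    simp only [enorm_eq_self]
    calc ∫⁻ y, (∫⁻ x, κ y x * f x) ^ p.toReal
        ≤ ∫⁻ y, ∫⁻ x, κ y x * f x ^ p.toReal := by
          refine lintegral_mono fun y => ?_
          have h := ENNReal.rpow_le_rpow (hjensen y) hpr.le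
          rw [eLpNorm_eq_lintegral_rpow_enorm_toReal hp0 htop, ← ENNReal.rpow_mul,
            one_div, inv_mul_cancel₀ hpr.ne', ENNReal.rpow_one,
            lintegral_withDensity_eq_lintegral_mul _ (hκy y) (hf.enorm.pow_const _)] at h
          simpa using h
      _ = ∫⁻ x, ∫⁻ y, κ y x * f x ^ p.toReal := by
          refine lintegral_lintegral_swap ?_
          exact (hκ.mul ((hf.comp measurable_snd).pow_const _)).aemeasurable
      _ ≤ ∫⁻ x, f x ^ p.toReal := by
          refine lintegral_mono fun x => ?_
          rw [lintegral_mul_const _ (hκx x)]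
          exact mul_le_of_le_one_left' (h2 x)

lemma lintegral_ofReal_poisson_sub {η : ℝ} (hη : 0 < η) (x : ℝ) :
    ∫⁻ y, ENNReal.ofReal (poisson η (x - y)) = 1 := by
  rw [← ofReal_integral_eq_lintegral_ofReal (integrable_poisson_sub hη x)
    (Eventually.of_forall fun y => (poisson_pos hη _).le), integral_poisson_sub hη,
    ENNReal.ofReal_one]

section

variable {μ : Measure ℝ} [IsProbabilityMeasure μ] {t : ℝ}

/-- The characteristic `z ↦ z - t G(z)` moves points of the upper half-plane upwards. -/
lemma im_le_im_characteristic (ht : 0 ≤ t) {z : ℂ} (hz : 0 < z.im) :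
    z.im ≤ (z - t * stieltjes μ z).im := by
  rw [im_sub_mul_stieltjes t z hz]
  have := mul_nonneg ht (mul_nonneg hz.le (resolventSq_nonneg (μ := μ) z))
  linarith

/-- For fixed `x`, the Poisson kernels at the characteristics have total mass one as functions of
the real part of the starting point: they are the inversion densities of `(z - t G(z) - x)⁻¹`, which
is normalized at `i∞` like a Stieltjes transform. -/
lemma lintegral_poisson_characteristic (ht : 0 ≤ t) {ε : ℝ} (hε : 0 < ε) (x : ℝ) :
    ∫⁻ y : ℝ, ENNReal.ofReal (poisson ((y + ε * Complex.I : ℂ) -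
        t * stieltjes μ (y + ε * Complex.I)).im (((y + ε * Complex.I : ℂ) -
        t * stieltjes μ (y + ε * Complex.I)).re - x)) = 1 := by
  set f : ℂ → ℂ := fun z => ((z - t * stieltjes μ z) - x)⁻¹ with hf
  have hpos : ∀ z : ℂ, 0 < z.im → 0 < (z - t * stieltjes μ z).im := fun z hz =>
    hz.trans_le (im_le_im_characteristic ht hz)
  have hd : DifferentiableOn ℂ f {z | 0 < z.im} := by
    refine DifferentiableOn.inv ?_ fun z hz => sub_ofReal_ne_zero (hpos z hz) x
    exact (differentiableOn_id.sub (differentiableOn_stieltjes.const_mul _)).sub_const _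
  have him : ∀ z : ℂ, 0 < z.im → (f z).im ≤ 0 := by
    intro z hz
    simp only [hf]
    rw [im_inv_sub_ofReal]
    have h1 := hpos z hz
    have h2 : 0 ≤ (‖(z - t * stieltjes μ z) - x‖ ^ 2)⁻¹ := by positivity
    nlinarith
  have hb : ∀ z : ℂ, 0 < z.im → ‖f z‖ ≤ (z.im)⁻¹ := fun z hz =>
    (norm_inv_sub_ofReal_le (hpos z hz) x).trans (inv_anti₀ hz (im_le_im_characteristic ht hz))
  have hlim : Tendsto (fun y : ℝ => (y * Complex.I) * f (y * Complex.I)) atTop (𝓝 1) := by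
    have h0 : Tendsto (fun y : ℝ => (t * stieltjes μ (y * Complex.I) + x) * f (y * Complex.I))
        atTop (𝓝 0) := by
      have hbd : Tendsto (fun y : ℝ => (t * y⁻¹ + |x|) * y⁻¹) atTop (𝓝 0) := by
        simpa using ((tendsto_inv_atTop_zero.const_mul t).add_const |x|).mul tendsto_inv_atTop_zero
      refine squeeze_zero_norm' ?_ hbd
      filter_upwards [eventually_gt_atTop 0] with y hy
      have hi : (y * Complex.I : ℂ).im = y := by simp
      have hz : 0 < (y * Complex.I : ℂ).im := by rwa [hi]
      have b1 := hb _ hz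
      have b2 := norm_stieltjes_le (μ := μ) hz
      rw [hi] at b1 b2
      rw [norm_mul]
      gcongr
      refine (norm_add_le _ _).trans ?_
      rw [norm_mul, Complex.norm_real, Complex.norm_real, Real.norm_of_nonneg ht,
        Real.norm_eq_abs]
      gcongr
    have h1 := h0.const_add 1
    rw [add_zero] at h1
    refine h1.congr' ?_
    filter_upwards [eventually_gt_atTop 0] with y hy
    have hz : 0 < (y * Complex.I : ℂ).im := by simpa using hy
    have hne := sub_ofReal_ne_zero (hpos _ hz) x
    simp only [hf]
    field_simp
    ring
  rw [← lintegral_inversionDensity hd him hb hlim hε]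
  refine lintegral_congr fun y => ?_
  congr 1
  rw [inversionDensity]
  simp only [hf]
  set w := (y + ε * Complex.I : ℂ) - t * stieltjes μ (y + ε * Complex.I)
  have := im_inv_eq_poisson w.im w.re x
  rw [Complex.re_add_im] at this
  rw [this]
  have := Real.pi_pos
  field_simp

/-- The smoothed density at time `s` is obtained from the measure at an earlier time `t` by
averaging against the Poisson kernels at the characteristics. -/
lemma inversionDensity_freeStieltjes_eq {s : ℝ} (ht : 0 ≤ t) (hts : t ≤ s) {ε : ℝ} (hε : 0 < ε)
    (y : ℝ) :
    inversionDensity (freeStieltjes μ s) ε y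
      = ∫ x, poisson ((y + ε * Complex.I : ℂ) -
          (s - t : ℝ) * stieltjes (freeConv μ s) (y + ε * Complex.I)).im
        (((y + ε * Complex.I : ℂ) -
          (s - t : ℝ) * stieltjes (freeConv μ s) (y + ε * Complex.I)).re - x)
        ∂(freeConv μ t) := by
  have hz : 0 < (y + ε * Complex.I : ℂ).im := by simpa using hε
  have hs := ht.trans hts
  set w := (y + ε * Complex.I : ℂ) - (s - t : ℝ) * stieltjes (freeConv μ s) (y + ε * Complex.I)
    with hw
  have hw0 : 0 < w.im :=
    hz.trans_le (im_le_im_characteristic (μ := freeConv μ s) (sub_nonneg.2 hts) hz)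
  have h := stieltjes_freeConv_semigroup (μ := μ) (s := s) ht hs hz
    (by rw [← Complex.ofReal_sub]; exact hw0)
  rw [← Complex.ofReal_sub, ← hw, stieltjes_freeConv hs hz] at h
  rw [← inversionDensity_stieltjes (freeConv μ t) hw0, inversionDensity, inversionDensity,
    Complex.re_add_im, h]

/-- The `L^p` norms decrease along the flow, because the regularizations of the later density are
averages of the earlier one against doubly stochastic kernels. -/
lemma lpNorm_freeConv_le {p : ℝ≥0∞} (hp : 1 ≤ p) {s : ℝ} (ht : 0 ≤ t) (hts : t ≤ s) :
    lpNorm p (freeConv μ s) ≤ lpNorm p (freeConv μ t) := by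
  rcases hts.eq_or_lt with rfl | hlt
  · exact le_rfl
  by_cases hac : freeConv μ t ≪ volume
  swap
  · rw [lpNorm, lpNorm, if_neg hac]
    exact le_top
  have hs : 0 < s := ht.trans_lt hlt
  have hacs : freeConv μ s ≪ volume := by
    rw [freeConv_of_pos hs]
    exact withDensity_absolutelyContinuous _ _
  rw [lpNorm, lpNorm, if_pos hac, if_pos hacs]
  have hgm : Measurable fun x => ENNReal.ofReal (freeDensity μ s x) :=
    (measurable_freeDensity hs).ennreal_ofReal
  have hrn : (freeConv μ s).rnDeriv volume =ᵐ[volume]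
      fun x => ENNReal.ofReal (freeDensity μ s x) := by
    rw [freeConv_of_pos hs]
    exact Measure.rnDeriv_withDensity volume hgm
  rw [eLpNorm_congr_ae hrn]
  set f := (freeConv μ t).rnDeriv volume with hf
  have hfm : Measurable f := Measure.measurable_rnDeriv _ _
  have hν : freeConv μ t = volume.withDensity f := (Measure.withDensity_rnDeriv_eq _ _ hac).symm
  set W : ℕ → ℝ → ℂ := fun n y => (y + (1 / ((n : ℝ) + 1) : ℝ) * Complex.I : ℂ) -
    (s - t : ℝ) * stieltjes (freeConv μ s) (y + (1 / ((n : ℝ) + 1) : ℝ) * Complex.I) with hW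
  set κ : ℕ → ℝ → ℝ → ℝ≥0∞ := fun n y x =>
    ENNReal.ofReal (poisson (W n y).im ((W n y).re - x)) with hκ
  have hε : ∀ n : ℕ, 0 < 1 / ((n : ℝ) + 1) := fun n => by positivity
  have hz : ∀ (n : ℕ) (y : ℝ), 0 < (y + (1 / ((n : ℝ) + 1) : ℝ) * Complex.I : ℂ).im :=
    fun n y => by rw [ofReal_add_mul_I_im]; exact hε n
  have hWpos : ∀ n y, 0 < (W n y).im := fun n y =>
    (hz n y).trans_le (im_le_im_characteristic (μ := freeConv μ s) (sub_nonneg.2 hts) (hz n y))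
  have hWc : ∀ n, Continuous (W n) := by
    intro n
    have h1 : Continuous fun y : ℝ =>
        stieltjes (freeConv μ s) (y + (1 / ((n : ℝ) + 1) : ℝ) * Complex.I) :=
      (differentiableOn_stieltjes (μ := freeConv μ s)).continuousOn.comp_continuous
        (by fun_prop) (hz n)
    exact (by fun_prop : Continuous fun y : ℝ => (y + (1 / ((n : ℝ) + 1) : ℝ) * Complex.I : ℂ)).sub
      (continuous_const.mul h1)
  have hκm : ∀ n, Measurable (Function.uncurry (κ n)) := by
    intro n
    refine Measurable.ennreal_ofReal (Continuous.measurable ?_)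
    have c1 : Continuous fun q : ℝ × ℝ => (W n q.1).im :=
      Complex.continuous_im.comp ((hWc n).comp continuous_fst)
    have c2 : Continuous fun q : ℝ × ℝ => (W n q.1).re :=
      Complex.continuous_re.comp ((hWc n).comp continuous_fst)
    refine Continuous.div c1 (continuous_const.mul (((c2.sub continuous_snd).pow 2).add
      (c1.pow 2))) fun q => ?_
    have h1 := hWpos n q.1
    have h2 := Real.pi_pos
    positivity
  have hκ1 : ∀ n y, ∫⁻ x, κ n y x = 1 := fun n y => lintegral_ofReal_poisson_sub (hWpos n y) _
  have hκ2 : ∀ n x, ∫⁻ y, κ n y x ≤ 1 := fun n x =>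
    (lintegral_poisson_characteristic (μ := freeConv μ s) (sub_nonneg.2 hts) (hε n) x).le
  have hcontr : ∀ n, eLpNorm (fun y => ∫⁻ x, κ n y x * f x) p volume ≤ eLpNorm f p volume :=
    fun n => eLpNorm_lintegral_kernel_le (hκm n) (hκ1 n) (hκ2 n) hfm hp
  have hid : ∀ n y, ∫⁻ x, κ n y x * f x
      = ENNReal.ofReal (inversionDensity (freeStieltjes μ s) (1 / ((n : ℝ) + 1)) y) := by
    intro n y
    have hcp : Continuous fun x => poisson (W n y).im ((W n y).re - x) :=
      (continuous_poisson (hWpos n y)).comp (by fun_prop)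
    rw [inversionDensity_freeStieltjes_eq ht hts (hε n) y,
      ofReal_integral_eq_lintegral_ofReal, hν,
      lintegral_withDensity_eq_lintegral_mul _ hfm hcp.measurable.ennreal_ofReal]
    · exact lintegral_congr fun x => mul_comm _ _
    · refine Integrable.of_bound hcp.aestronglyMeasurable ((Real.pi * (W n y).im)⁻¹)
        (Eventually.of_forall fun x => ?_)
      rw [Real.norm_of_nonneg (poisson_pos (hWpos n y) _).le]
      exact poisson_le (hWpos n y) _
    · exact Eventually.of_forall fun x => (poisson_pos (hWpos n y) _).le
  have hlim : ∀ y, Tendsto (fun n => ∫⁻ x, κ n y x * f x) atTop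
      (𝓝 (ENNReal.ofReal (freeDensity μ s y))) := by
    intro y
    simp only [hid]
    exact (ENNReal.continuous_ofReal.tendsto _).comp (tendsto_freeDensity hs y)
  have hκfm : ∀ n, Measurable fun y => ∫⁻ x, κ n y x * f x := fun n =>
    Measurable.lintegral_prod_right ((hκm n).mul (hfm.comp measurable_snd))
  by_cases htop : p = ∞
  · subst htop
    simp only [eLpNorm_exponent_top] at hcontr ⊢
    refine essSup_le_of_ae_le _ ?_
    have hae : ∀ᵐ y, ∀ n, ∫⁻ x, κ n y x * f x ≤ eLpNormEssSup f volume := by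
      refine ae_all_iff.2 fun n => ?_
      filter_upwards [ae_le_eLpNormEssSup (f := fun y => ∫⁻ x, κ n y x * f x) (μ := volume)]
        with y hy
      exact hy.trans (hcontr n)
    filter_upwards [hae] with y hy
    exact le_of_tendsto' (hlim y) hy
  · have hp0 : p ≠ 0 := (zero_lt_one.trans_le hp).ne'
    have hpr : 0 < p.toReal := ENNReal.toReal_pos hp0 htop
    simp only [eLpNorm_eq_lintegral_rpow_enorm_toReal hp0 htop, enorm_eq_self] at hcontr ⊢
    have hcontr' : ∀ n, ∫⁻ y, (∫⁻ x, κ n y x * f x) ^ p.toReal ≤ ∫⁻ x, f x ^ p.toReal :=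
      fun n => (ENNReal.rpow_le_rpow_iff (by positivity)).1 (hcontr n)
    refine ENNReal.rpow_le_rpow ?_ (by positivity)
    have hl : ∀ y, liminf (fun n => (∫⁻ x, κ n y x * f x) ^ p.toReal) atTop
        = ENNReal.ofReal (freeDensity μ s y) ^ p.toReal := fun y =>
      ((ENNReal.continuous_rpow_const.tendsto _).comp (hlim y)).liminf_eq
    calc ∫⁻ y, ENNReal.ofReal (freeDensity μ s y) ^ p.toReal
        = ∫⁻ y, liminf (fun n => (∫⁻ x, κ n y x * f x) ^ p.toReal) atTop := by simp only [hl]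
      _ ≤ liminf (fun n => ∫⁻ y, (∫⁻ x, κ n y x * f x) ^ p.toReal) atTop :=
          lintegral_liminf_le fun n => (hκfm n).pow_const _
      _ ≤ ∫⁻ x, f x ^ p.toReal := by
          refine liminf_le_of_le (by isBoundedDefault) fun b hb => ?_
          obtain ⟨n, hn⟩ := hb.exists
          exact hn.trans (hcontr' n)

end

/-! ### The half-Laplacian of functions with bounded second differences -/

/-- Bounded continuous functions whose second differences at scale `z` are at most `K z²`; this
class contains the bounded `C^{1,1}` functions and is all that the half-Laplacian needs. -/
structure SecondDiffBound (f : ℝ → ℝ) (K M : ℝ) : Prop where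
  continuous : Continuous f
  bound : ∀ x, |f x| ≤ M
  second : ∀ x z, |2 * f x - f (x + z) - f (x - z)| ≤ K * z ^ 2

/-- An integrable majorant of `min K (4 M / z²)`, with a free cut-off scale `L`. -/
noncomputable def majorant (K M L z : ℝ) : ℝ := if z ≤ L then K else 4 * M * z ^ (-2 : ℝ)

lemma integrableOn_majorant (K M : ℝ) {L : ℝ} (hL : 0 < L) :
    IntegrableOn (majorant K M L) (Set.Ioi 0) ∧
      ∫ z in Set.Ioi 0, majorant K M L z = K * L + 4 * M / L := by
  have h1 : IntegrableOn (majorant K M L) (Set.Ioc 0 L) := by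
    refine (integrableOn_const (C := K) (by simp)).congr_fun (fun z hz => ?_) measurableSet_Ioc
    rw [majorant, if_pos hz.2]
  have h2 : IntegrableOn (majorant K M L) (Set.Ioi L) := by
    refine IntegrableOn.congr_fun ((integrableOn_Ioi_rpow_of_lt (by norm_num : (-2 : ℝ) < -1)
      hL).const_mul (4 * M)) (fun z hz => ?_) measurableSet_Ioi
    rw [majorant, if_neg (not_le.2 hz)]
  have e1 : ∫ z in Set.Ioc 0 L, majorant K M L z = K * L := by
    rw [setIntegral_congr_fun (g := fun _ => K) measurableSet_Ioc fun z hz => by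
      simp only [majorant, if_pos hz.2]]
    simp [hL.le, mul_comm]
  have e2 : ∫ z in Set.Ioi L, majorant K M L z = 4 * M / L := by
    rw [setIntegral_congr_fun (g := fun z : ℝ => 4 * M * z ^ (-2 : ℝ)) measurableSet_Ioi
      fun z hz => by
        rw [Set.mem_Ioi] at hz
        simp only [majorant, if_neg (not_le.2 hz)]]
    rw [integral_const_mul, integral_Ioi_rpow_of_lt (by norm_num) hL]
    norm_num
    rw [Real.rpow_neg_one]
    rfl
  rw [← Set.Ioc_union_Ioi_eq_Ioi hL.le]
  refine ⟨h1.union h2, ?_⟩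
  rw [setIntegral_union (Set.Ioc_disjoint_Ioi le_rfl) measurableSet_Ioi h1 h2, e1, e2]

lemma SecondDiffBound.abs_le_majorant {f : ℝ → ℝ} {K M : ℝ} (hf : SecondDiffBound f K M) (L x : ℝ)
    {z : ℝ} (hz : 0 < z) : |(2 * f x - f (x + z) - f (x - z)) / z ^ 2| ≤ majorant K M L z := by
  rw [abs_div, abs_of_pos (pow_pos hz 2), div_le_iff₀ (pow_pos hz 2), majorant]
  split_ifs
  · exact hf.second x z
  · have e : z ^ (-2 : ℝ) = (z ^ 2)⁻¹ := by
      rw [Real.rpow_neg hz.le]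
      norm_cast
    rw [e, mul_assoc, inv_mul_cancel₀ (by positivity), mul_one]
    have h1 := abs_le.1 (hf.bound x)
    have h2 := abs_le.1 (hf.bound (x + z))
    have h3 := abs_le.1 (hf.bound (x - z))
    rw [abs_le]
    constructor <;> linarith [h1.1, h1.2, h2.1, h2.2, h3.1, h3.2]

lemma measurableSet_near (δ : ℝ≥0∞) : MeasurableSet {z : ℝ | 0 < z ∧ ENNReal.ofReal z < δ} :=
  measurableSet_Ioi.inter (measurableSet_lt ENNReal.measurable_ofReal measurable_const)

lemma measurableSet_far (δ : ℝ≥0∞) : MeasurableSet {z : ℝ | 0 < z ∧ δ ≤ ENNReal.ofReal z} :=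
  measurableSet_Ioi.inter (measurableSet_le measurable_const ENNReal.measurable_ofReal)

lemma SecondDiffBound.integrableOn {f : ℝ → ℝ} {K M : ℝ} (hf : SecondDiffBound f K M) (x : ℝ) :
    IntegrableOn (fun z => (2 * f x - f (x + z) - f (x - z)) / z ^ 2) (Set.Ioi 0) := by
  refine (integrableOn_majorant K M one_pos).1.mono' ?_ ?_
  · have := hf.continuous
    refine Measurable.aestronglyMeasurable (Measurable.div (Continuous.measurable ?_)
      (by fun_prop))
    fun_prop
  · refine (ae_restrict_iff' measurableSet_Ioi).2 (Eventually.of_forall fun z hz => ?_)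
    exact hf.abs_le_majorant 1 x hz

lemma halfLaplacianNear_top (f : ℝ → ℝ) (x : ℝ) :
    halfLaplacianNear ∞ f x = ∫ z in Set.Ioi 0, (2 * f x - f (x + z) - f (x - z)) / z ^ 2 := by
  rw [halfLaplacianNear]
  congr 2
  ext z
  simp

/-- Interpolation bound for the half-Laplacian, splitting the integral at scale `L`. -/
lemma SecondDiffBound.abs_halfLaplacianNear_le {f : ℝ → ℝ} {K M : ℝ} (hf : SecondDiffBound f K M)
    {L : ℝ} (hL : 0 < L) (δ : ℝ≥0∞) (x : ℝ) :
    |halfLaplacianNear δ f x| ≤ K * L + 4 * M / L := by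
  obtain ⟨h1, h2⟩ := integrableOn_majorant K M hL
  have hnn : ∀ z ∈ Set.Ioi (0 : ℝ), 0 ≤ majorant K M L z := fun z hz =>
    (abs_nonneg _).trans (hf.abs_le_majorant L x hz)
  have hsub : {z : ℝ | 0 < z ∧ ENNReal.ofReal z < δ} ⊆ Set.Ioi 0 := fun z hz => hz.1
  rw [← h2, halfLaplacianNear, ← Real.norm_eq_abs]
  calc _ ≤ ∫ z in {z : ℝ | 0 < z ∧ ENNReal.ofReal z < δ}, majorant K M L z := by
        refine norm_integral_le_of_norm_le (h1.mono_set hsub) ?_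
        refine (ae_restrict_iff' (measurableSet_near δ)).2 (Eventually.of_forall fun z hz => ?_)
        exact hf.abs_le_majorant L x hz.1
    _ ≤ _ := setIntegral_mono_set h1
        ((ae_restrict_iff' measurableSet_Ioi).2 (Eventually.of_forall hnn)) hsub.eventuallyLE

lemma SecondDiffBound.of_hasDerivAt {f f' : ℝ → ℝ} {K : ℝ≥0} {M : ℝ}
    (hf : ∀ x, HasDerivAt f (f' x) x) (hK : LipschitzWith K f') (hM : ∀ x, |f x| ≤ M) :
    SecondDiffBound f (2 * K) M where
  continuous := continuous_iff_continuousAt.2 fun x => (hf x).continuousAt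
  bound := hM
  second x z := by
    have hmain : ∀ y : ℝ, ‖(f' (x + y) - f' (x - y))‖ ≤ 2 * K * |y| := by
      intro y
      have := hK.dist_le_mul (x + y) (x - y)
      rw [dist_eq_norm, dist_eq_norm] at this
      refine this.trans_eq ?_
      rw [show x + y - (x - y) = 2 * y by ring, norm_mul, Real.norm_two, Real.norm_eq_abs]
      ring
    have hd : ∀ y, HasDerivAt (fun y => f (x + y) + f (x - y)) (f' (x + y) - f' (x - y)) y := by
      intro y
      have h1 := (hf (x + y)).comp_const_add x y
      have h2 := (hf (x - y)).comp_const_sub x y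
      exact (h1.add h2).congr_deriv (by ring)
    have hseg := (convex_segment (0 : ℝ) z).norm_image_sub_le_of_norm_hasDerivWithin_le
      (f := fun y => f (x + y) + f (x - y)) (C := 2 * K * |z|)
      (fun y _ => (hd y).hasDerivWithinAt) (fun y hy => (hmain y).trans ?_)
      (left_mem_segment ℝ 0 z) (right_mem_segment ℝ 0 z)
    · simp only [add_zero, sub_zero] at hseg
      rw [Real.norm_eq_abs, Real.norm_eq_abs] at hseg
      rw [← abs_neg]
      calc |-(2 * f x - f (x + z) - f (x - z))| = |f (x + z) + f (x - z) - (f x + f x)| := by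
            congr 1; ring
        _ ≤ 2 * K * |z| * |z| := hseg
        _ = 2 * K * z ^ 2 := by rw [mul_assoc, abs_mul_abs_self, sq]
    · obtain ⟨a, b, ha, hb, hab, rfl⟩ := hy
      refine mul_le_mul_of_nonneg_left ?_ (by positivity)
      simp only [smul_eq_mul, mul_zero, zero_add, abs_mul, abs_of_nonneg hb]
      have := abs_nonneg z
      nlinarith

/-- Symmetrized form of the far part of the half-Laplacian. -/
lemma halfLaplacianFar_eq {u : ℝ → ℝ} (hu : Measurable u) {M : ℝ} (hM : ∀ x, |u x| ≤ M)
    {δ : ℝ≥0∞} (hδ : 0 < δ) (x : ℝ) :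
    halfLaplacianFar δ u x
      = ∫ z in {z : ℝ | 0 < z ∧ δ ≤ ENNReal.ofReal z},
          (2 * u x - u (x + z) - u (x - z)) / z ^ 2 := by
  rcases eq_or_ne δ ∞ with rfl | htop
  · rw [halfLaplacianFar]
    have e1 : {y : ℝ | ∞ ≤ edist x y} = ∅ := by
      ext y
      simp [edist_ne_top]
    have e2 : {z : ℝ | 0 < z ∧ ∞ ≤ ENNReal.ofReal z} = ∅ := by
      ext z
      simp
    rw [e1, e2]
    simp
  obtain ⟨d, hd0, rfl⟩ : ∃ d : ℝ, 0 < d ∧ δ = ENNReal.ofReal d :=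
    ⟨δ.toReal, ENNReal.toReal_pos hδ.ne' htop, (ENNReal.ofReal_toReal htop).symm⟩
  have e1 : {y : ℝ | ENNReal.ofReal d ≤ edist x y} = {y : ℝ | d ≤ |x - y|} := by
    ext y
    simp only [Set.mem_ofPred_eq]
    rw [edist_dist, Real.dist_eq, ENNReal.ofReal_le_ofReal_iff (abs_nonneg _)]
  have e2 : {z : ℝ | 0 < z ∧ ENNReal.ofReal d ≤ ENNReal.ofReal z} = Set.Ici d := by
    ext z
    simp only [Set.mem_ofPred_eq, Set.mem_Ici]
    constructor
    · rintro ⟨h1, h2⟩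
      exact (ENNReal.ofReal_le_ofReal_iff h1.le).1 h2
    · intro h
      exact ⟨hd0.trans_le h, ENNReal.ofReal_le_ofReal h⟩
  have hset : MeasurableSet {y : ℝ | d ≤ |x - y|} :=
    measurableSet_le measurable_const (by fun_prop)
  have hM0 : 0 ≤ M := (abs_nonneg _).trans (hM 0)
  have hint : ∀ v : ℝ → ℝ, Measurable v → (∀ z, |v z| ≤ M) →
      IntegrableOn (fun z => (u x - v z) / z ^ 2) (Set.Ici d) := by
    intro v hv hvM
    rw [integrableOn_Ici_iff_integrableOn_Ioi]
    refine ((integrableOn_Ioi_rpow_of_lt (by norm_num : (-2 : ℝ) < -1) hd0).const_mul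
      (2 * M)).mono' (Measurable.aestronglyMeasurable (by fun_prop)) ?_
    refine (ae_restrict_iff' measurableSet_Ioi).2 (Eventually.of_forall fun z hz => ?_)
    have hz0 : 0 < z := hd0.trans hz
    have e : z ^ (-2 : ℝ) = (z ^ 2)⁻¹ := by
      rw [Real.rpow_neg hz0.le]
      norm_cast
    rw [e, Real.norm_eq_abs, abs_div, abs_of_pos (pow_pos hz0 2), div_eq_mul_inv]
    gcongr
    have h1 := abs_le.1 (hM x)
    have h2 := abs_le.1 (hvM z)
    rw [abs_le]
    constructor <;> linarith [h1.1, h1.2, h2.1, h2.2]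
  have hr := hint (fun z => u (x + z)) (by fun_prop) (fun z => hM _)
  have hl := hint (fun z => u (x - z)) (by fun_prop) (fun z => hM _)
  rw [halfLaplacianFar, e1, e2, ← integral_indicator hset]
  rw [← integral_add_left_eq_self _ x]
  have e3 : ∀ z : ℝ, ({y : ℝ | d ≤ |x - y|}.indicator (fun y => (u x - u y) / (x - y) ^ 2)) (x + z)
      = (Set.Ici d).indicator (fun z => (u x - u (x + z)) / z ^ 2) z
        + (Set.Ici d).indicator (fun z => (u x - u (x - z)) / z ^ 2) (-z) := by
    intro z
    simp only [Set.indicator, Set.mem_ofPred_eq, Set.mem_Ici, sub_add_cancel_left, abs_neg,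
      even_two.neg_pow, sub_neg_eq_add]
    by_cases h1 : d ≤ z
    · have h2 : ¬ d ≤ -z := by linarith
      have h3 : d ≤ |z| := h1.trans (le_abs_self z)
      simp [h1, h2, h3]
    · by_cases h2 : d ≤ -z
      · have h3 : d ≤ |z| := h2.trans (neg_le_abs z)
        simp [h1, h2, h3]
      · have h3 : ¬ d ≤ |z| := by
          rw [not_le, abs_lt]
          constructor <;> linarith
        simp [h1, h2, h3]
  have i1 := hr.integrable_indicator measurableSet_Ici
  have i2 := hl.integrable_indicator measurableSet_Ici
  rw [integral_congr_ae (Eventually.of_forall e3), integral_add i1 i2.comp_neg,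
    integral_neg_eq_self, ← integral_add i1 i2, ← integral_indicator measurableSet_Ici]
  refine integral_congr_ae (Eventually.of_forall fun z => ?_)
  simp only [Set.indicator]
  split_ifs
  · ring
  · simp

/-- For a regular function the splitting radius is irrelevant. -/
lemma SecondDiffBound.near_add_far {f : ℝ → ℝ} {K M : ℝ} (hf : SecondDiffBound f K M)
    {δ : ℝ≥0∞} (hδ : 0 < δ) (x : ℝ) :
    halfLaplacianNear δ f x + halfLaplacianFar δ f x = halfLaplacianNear ∞ f x := by
  rw [halfLaplacianFar_eq hf.continuous.measurable hf.bound hδ, halfLaplacianNear_top,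
    halfLaplacianNear, ← setIntegral_union]
  · congr 2
    ext z
    simp only [Set.mem_union, Set.mem_ofPred_eq, Set.mem_Ioi]
    constructor
    · rintro (h | h) <;> exact h.1
    · intro h
      rcases lt_or_ge (ENNReal.ofReal z) δ with h1 | h1
      · exact Or.inl ⟨h, h1⟩
      · exact Or.inr ⟨h, h1⟩
  · rw [Set.disjoint_left]
    rintro z ⟨_, h1⟩ ⟨_, h2⟩
    exact absurd h1 (not_lt.2 h2)
  · exact measurableSet_far δ
  · exact (hf.integrableOn x).mono_set fun z hz => hz.1
  · exact (hf.integrableOn x).mono_set fun z hz => hz.1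

/-- The half-Laplacian commutes with averaging over translations. -/
lemma SecondDiffBound.halfLaplacianNear_average {f : ℝ → ℝ} {K M : ℝ}
    (hf : SecondDiffBound f K M) (μ : Measure ℝ) [IsFiniteMeasure μ] (x : ℝ) :
    halfLaplacianNear ∞ (fun x => ∫ a, f (x - a) ∂μ) x
      = ∫ a, halfLaplacianNear ∞ f (x - a) ∂μ := by
  have hfi : ∀ y, Integrable (fun a => f (y - a)) μ := fun y =>
    Integrable.of_bound (hf.continuous.comp (by fun_prop)).aestronglyMeasurable M
      (Eventually.of_forall fun a => hf.bound _)
  simp only [halfLaplacianNear_top]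
  have e : ∀ z : ℝ, (2 * (∫ a, f (x - a) ∂μ) - (∫ a, f (x + z - a) ∂μ) - ∫ a, f (x - z - a) ∂μ)
      / z ^ 2 = ∫ a, (2 * f (x - a) - f (x - a + z) - f (x - a - z)) / z ^ 2 ∂μ := by
    intro z
    have h2 : Integrable (fun a => 2 * f (x - a)) μ := (hfi x).const_mul 2
    have h3 : Integrable (fun a => 2 * f (x - a) - f (x + z - a)) μ := h2.sub (hfi _)
    rw [← integral_const_mul, ← integral_sub h2 (hfi _), ← integral_sub h3 (hfi _),
      ← integral_div]
    refine integral_congr_ae (Eventually.of_forall fun a => ?_)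
    simp only
    rw [show x - a + z = x + z - a by ring, show x - a - z = x - z - a by ring]
  simp only [e]
  rw [integral_integral_swap]
  have hm := (integrableOn_majorant K M one_pos).1.mul_prod (integrable_const (1 : ℝ) (μ := μ))
  refine hm.mono' ?_ ?_
  · have := hf.continuous
    refine Measurable.aestronglyMeasurable (Measurable.div (Continuous.measurable ?_)
      (by fun_prop))
    fun_prop
  · rw [Measure.ae_prod_iff_ae_ae]
    · refine (ae_restrict_iff' measurableSet_Ioi).2 (Eventually.of_forall fun z hz => ?_)
      refine Eventually.of_forall fun a => ?_
      simp only [Function.uncurry, mul_one]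
      exact hf.abs_le_majorant 1 (x - a) hz
    · refine measurableSet_le ?_ ?_
      · have := hf.continuous
        refine Measurable.norm (Measurable.div (Continuous.measurable ?_) (by fun_prop))
        fun_prop
      · refine Measurable.mul ?_ measurable_const
        refine Measurable.comp (g := majorant K M 1) ?_ measurable_fst
        exact Measurable.ite measurableSet_Iic measurable_const (by fun_prop)

/-! ### Poisson regularization of distribution functions -/

/-- The distribution function of the Cauchy law of scale `η`. -/
noncomputable def cauchyCDF (η x : ℝ) : ℝ := 1 / 2 + Real.pi⁻¹ * Real.arctan (x / η)

lemma cauchyCDF_nonneg (η x : ℝ) : 0 ≤ cauchyCDF η x := by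
  have h := Real.neg_pi_div_two_lt_arctan (x / η)
  have hpi := Real.pi_pos
  have : Real.pi⁻¹ * (-(Real.pi / 2)) ≤ Real.pi⁻¹ * Real.arctan (x / η) := by gcongr
  have e : Real.pi⁻¹ * (-(Real.pi / 2)) = -(1 / 2) := by field_simp
  unfold cauchyCDF
  linarith

lemma cauchyCDF_neg (η x : ℝ) : cauchyCDF η (-x) = 1 - cauchyCDF η x := by
  unfold cauchyCDF
  rw [neg_div, Real.arctan_neg]
  ring

lemma cauchyCDF_le_one (η x : ℝ) : cauchyCDF η x ≤ 1 := by
  have := cauchyCDF_nonneg η (-x)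
  rw [cauchyCDF_neg] at this
  linarith

lemma abs_cauchyCDF_le (η x : ℝ) : |cauchyCDF η x| ≤ 1 := by
  rw [abs_of_nonneg (cauchyCDF_nonneg η x)]
  exact cauchyCDF_le_one η x

lemma monotone_cauchyCDF {η : ℝ} (hη : 0 < η) : Monotone (cauchyCDF η) := by
  intro x y hxy
  have hpi := Real.pi_pos
  unfold cauchyCDF
  have : Real.arctan (x / η) ≤ Real.arctan (y / η) := Real.arctan_strictMono.monotone (by gcongr)
  gcongr

lemma hasDerivAt_cauchyCDF {η : ℝ} (hη : 0 < η) (x : ℝ) :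
    HasDerivAt (cauchyCDF η) (poisson η x) x := by
  have h := (((hasDerivAt_id x).div_const η).arctan.const_mul Real.pi⁻¹).const_add (1 / 2)
  refine h.congr_deriv ?_
  rw [poisson_eq hη]
  simp only [id]
  ring

lemma hasDerivAt_poisson {η : ℝ} (hη : 0 < η) (x : ℝ) :
    HasDerivAt (poisson η) (-(2 * x * η) / (Real.pi * (x ^ 2 + η ^ 2) ^ 2)) x := by
  have hpi := Real.pi_pos
  have h1 : HasDerivAt (fun x : ℝ => Real.pi * (x ^ 2 + η ^ 2)) (Real.pi * (2 * x)) x := by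
    have := (((hasDerivAt_id x).pow 2).add_const (η ^ 2)).const_mul Real.pi
    simpa using this
  have h2 := (hasDerivAt_const x η).div h1 (by positivity)
  refine h2.congr_deriv ?_
  field_simp
  ring

lemma lipschitzWith_poisson {η : ℝ} (hη : 0 < η) :
    LipschitzWith (Real.toNNReal (Real.pi * η ^ 2)⁻¹) (poisson η) := by
  refine lipschitzWith_of_nnnorm_deriv_le (fun x => (hasDerivAt_poisson hη x).differentiableAt)
    fun x => ?_
  have hpi := Real.pi_pos
  rw [← NNReal.coe_le_coe, coe_nnnorm, Real.coe_toNNReal _ (by positivity),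
    (hasDerivAt_poisson hη x).deriv, Real.norm_eq_abs, abs_div, abs_neg,
    abs_of_pos (show 0 < Real.pi * (x ^ 2 + η ^ 2) ^ 2 by positivity), ← one_div,
    div_le_div_iff₀ (by positivity) (by positivity), one_mul]
  have h1 : |2 * x * η| ≤ x ^ 2 + η ^ 2 := by
    rw [abs_le]
    constructor <;> nlinarith [sq_nonneg (x - η), sq_nonneg (x + η)]
  have h2 : η ^ 2 ≤ x ^ 2 + η ^ 2 := by nlinarith [sq_nonneg x]
  calc |2 * x * η| * (Real.pi * η ^ 2)
      ≤ (x ^ 2 + η ^ 2) * (Real.pi * (x ^ 2 + η ^ 2)) := by gcongr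
    _ = _ := by ring

lemma secondDiffBound_cauchyCDF {η : ℝ} (hη : 0 < η) :
    SecondDiffBound (cauchyCDF η) (2 * Real.toNNReal (Real.pi * η ^ 2)⁻¹) 1 :=
  SecondDiffBound.of_hasDerivAt (hasDerivAt_cauchyCDF hη) (lipschitzWith_poisson hη)
    (abs_cauchyCDF_le η)

/-- The half-Laplacian of the Cauchy distribution function is the Hilbert transform of its
density. -/
lemma halfLaplacianNear_cauchyCDF {η : ℝ} (hη : 0 < η) (x : ℝ) :
    halfLaplacianNear ∞ (cauchyCDF η) x = x / (x ^ 2 + η ^ 2) := by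
  have hpi := Real.pi_pos
  have hS := secondDiffBound_cauchyCDF hη
  rw [halfLaplacianNear_top]
  set S : ℝ → ℝ := fun z => 2 * cauchyCDF η x - cauchyCDF η (x + z) - cauchyCDF η (x - z)
    with hSdef
  -- Integrating `S z / z²` by parts leaves `S' z / z`, a rational function with primitive `Ψ`.
  set Ψ : ℝ → ℝ := fun z => η / (Real.pi * (x ^ 2 + η ^ 2)) *
    ((Real.log ((z + x) ^ 2 + η ^ 2) - Real.log ((z - x) ^ 2 + η ^ 2)) / 2
      + x / η * (Real.arctan ((z + x) / η) + Real.arctan ((z - x) / η))) with hΨ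
  have hB : ∀ z, 0 < (z + x) ^ 2 + η ^ 2 := fun z => by positivity
  have hA : ∀ z, 0 < (z - x) ^ 2 + η ^ 2 := fun z => by positivity
  have hΨd : ∀ z, HasDerivAt Ψ (η / (Real.pi * (x ^ 2 + η ^ 2)) *
      ((2 * x + z) / ((z + x) ^ 2 + η ^ 2) + (2 * x - z) / ((z - x) ^ 2 + η ^ 2))) z := by
    intro z
    have b1 : HasDerivAt (fun z : ℝ => (z + x) ^ 2 + η ^ 2) (2 * (z + x)) z := by
      have := (((hasDerivAt_id z).add_const x).pow 2).add_const (η ^ 2)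
      simpa using this
    have a1 : HasDerivAt (fun z : ℝ => (z - x) ^ 2 + η ^ 2) (2 * (z - x)) z := by
      have := (((hasDerivAt_id z).sub_const x).pow 2).add_const (η ^ 2)
      simpa using this
    have b2 := (((hasDerivAt_id z).add_const x).div_const η).arctan
    have a2 := (((hasDerivAt_id z).sub_const x).div_const η).arctan
    have h := ((((b1.log (hB z).ne').sub (a1.log (hA z).ne')).div_const 2).add
      ((b2.add a2).const_mul (x / η))).const_mul (η / (Real.pi * (x ^ 2 + η ^ 2)))
    refine h.congr_deriv ?_
    have e1 : 1 / (1 + ((id z + x) / η) ^ 2) * (1 / η) = η / ((z + x) ^ 2 + η ^ 2) := by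
      have := hB z
      simp only [id]
      field_simp
      ring
    have e2 : 1 / (1 + ((id z - x) / η) ^ 2) * (1 / η) = η / ((z - x) ^ 2 + η ^ 2) := by
      have := hA z
      simp only [id]
      field_simp
      ring
    rw [e1, e2]
    have := hB z
    have := hA z
    field_simp
    ring
  have hSd : ∀ z, HasDerivAt S (poisson η (x - z) - poisson η (x + z)) z := by
    intro z
    have h1 := (hasDerivAt_cauchyCDF hη (x + z)).comp_const_add x z
    have h2 := (hasDerivAt_cauchyCDF hη (x - z)).comp_const_sub x z
    exact ((h1.const_sub (2 * cauchyCDF η x)).sub h2).congr_deriv (by ring)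
  have hSb : ∀ z, 0 < z → |S z / z| ≤ 2 * Real.toNNReal (Real.pi * η ^ 2)⁻¹ * z := by
    intro z hz
    rw [abs_div, abs_of_pos hz, div_le_iff₀ hz, mul_assoc, ← sq]
    exact hS.second x z
  have hS4 : ∀ z, 0 < z → |S z / z| ≤ 4 * z⁻¹ := by
    intro z hz
    rw [abs_div, abs_of_pos hz, div_eq_mul_inv]
    have h1 := abs_le.1 (hS.bound x)
    have h2 := abs_le.1 (hS.bound (x + z))
    have h3 := abs_le.1 (hS.bound (x - z))
    gcongr
    rw [abs_le]
    constructor <;> linarith [h1.1, h1.2, h2.1, h2.2, h3.1, h3.2]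
  set Φ : ℝ → ℝ := fun z => Ψ z - S z / z with hΦ
  have hΦ0 : Φ 0 = 0 := by
    simp only [hΦ, hΨ]
    simp [neg_div, Real.arctan_neg]
  have hcont : ContinuousWithinAt Φ (Set.Ici 0) 0 := by
    refine (hΨd 0).continuousAt.continuousWithinAt.sub ?_
    rw [ContinuousWithinAt]
    simp only [div_zero]
    have hb : Tendsto (fun z : ℝ => 2 * Real.toNNReal (Real.pi * η ^ 2)⁻¹ * z)
        (𝓝[Set.Ici 0] 0) (𝓝 0) := by
      have : Continuous fun z : ℝ => 2 * Real.toNNReal (Real.pi * η ^ 2)⁻¹ * z := by fun_prop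
      simpa using (this.tendsto 0).mono_left nhdsWithin_le_nhds
    refine squeeze_zero_norm' ?_ hb
    filter_upwards [self_mem_nhdsWithin] with z hz
    rcases (Set.mem_Ici.1 hz).eq_or_lt with h0 | h0
    · rw [← h0]; simp
    · exact hSb z h0
  have hderiv : ∀ z ∈ Set.Ioi (0 : ℝ), HasDerivAt Φ (S z / z ^ 2) z := by
    intro z hz
    have hz' : z ≠ 0 := (Set.mem_Ioi.1 hz).ne'
    have h := (hΨd z).sub ((hSd z).div (hasDerivAt_id z) hz')
    refine h.congr_deriv ?_
    have := hB z
    have := hA z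
    have hA' : 0 < (x - z) ^ 2 + η ^ 2 := by positivity
    have hB' : 0 < (x + z) ^ 2 + η ^ 2 := by positivity
    have e : poisson η (x - z) - poisson η (x + z) = z * (η / (Real.pi * (x ^ 2 + η ^ 2)) *
        ((2 * x + z) / ((z + x) ^ 2 + η ^ 2) + (2 * x - z) / ((z - x) ^ 2 + η ^ 2))) := by
      unfold poisson
      rw [show (z + x) ^ 2 = (x + z) ^ 2 by ring, show (z - x) ^ 2 = (x - z) ^ 2 by ring]
      field_simp
      ring
    rw [e]
    simp only [id]
    field_simp
    ring
  have hlim : Tendsto Φ atTop (𝓝 (x / (x ^ 2 + η ^ 2))) := by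
    have hS0 : Tendsto (fun z => S z / z) atTop (𝓝 0) := by
      have hb : Tendsto (fun z : ℝ => 4 * z⁻¹) atTop (𝓝 0) := by
        simpa using tendsto_inv_atTop_zero.const_mul (4 : ℝ)
      refine squeeze_zero_norm' ?_ hb
      filter_upwards [eventually_gt_atTop 0] with z hz using hS4 z hz
    have hat : ∀ c : ℝ, Tendsto (fun z => Real.arctan ((z + c) / η)) atTop (𝓝 (Real.pi / 2)) := by
      intro c
      have h1 : Tendsto (fun z : ℝ => (z + c) / η) atTop atTop :=
        (tendsto_atTop_add_const_right _ c tendsto_id).atTop_div_const hη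
      exact (Real.tendsto_arctan_atTop.mono_right nhdsWithin_le_nhds).comp h1
    have hlog : Tendsto (fun z => Real.log ((z + x) ^ 2 + η ^ 2) - Real.log ((z - x) ^ 2 + η ^ 2))
        atTop (𝓝 0) := by
      have hq : Tendsto (fun z => 4 * x * z / ((z - x) ^ 2 + η ^ 2)) atTop (𝓝 0) := by
        have hb : Tendsto (fun z : ℝ => 16 * |x| * z⁻¹) atTop (𝓝 0) := by
          simpa using tendsto_inv_atTop_zero.const_mul (16 * |x|)
        refine squeeze_zero_norm' ?_ hb
        filter_upwards [eventually_gt_atTop 0, eventually_ge_atTop (2 * |x|)] with z hz hzx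
        rw [Real.norm_eq_abs, abs_div, abs_of_pos (hA z), div_le_iff₀ (hA z), abs_mul, abs_mul,
          abs_of_pos hz, abs_of_pos (by norm_num : (0 : ℝ) < 4)]
        have h1 : z / 2 ≤ z - x := by linarith [le_abs_self x]
        have h2 : (z / 2) ^ 2 ≤ (z - x) ^ 2 := pow_le_pow_left₀ (by positivity) h1 2
        have h3 : z ^ 2 / 4 ≤ (z - x) ^ 2 + η ^ 2 := by nlinarith [sq_nonneg η]
        calc 4 * |x| * z = 16 * |x| * z⁻¹ * (z ^ 2 / 4) := by field_simp; ring
          _ ≤ _ := by gcongr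
      have h1 := (hq.const_add 1)
      rw [add_zero] at h1
      have h2 := (Real.continuousAt_log one_ne_zero).tendsto.comp h1
      rw [Real.log_one] at h2
      refine h2.congr fun z => ?_
      rw [← Real.log_div (hB z).ne' (hA z).ne', Function.comp_apply]
      congr 1
      have := hA z
      field_simp
      ring
    have h := ((hlog.div_const 2).add (((hat x).add (hat (-x))).const_mul (x / η))).const_mul
      (η / (Real.pi * (x ^ 2 + η ^ 2)))
    have h' := h.sub hS0
    have e : η / (Real.pi * (x ^ 2 + η ^ 2)) * (0 / 2 + x / η * (Real.pi / 2 + Real.pi / 2)) - 0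
        = x / (x ^ 2 + η ^ 2) := by
      have : 0 < x ^ 2 + η ^ 2 := by positivity
      field_simp
      ring
    rw [e] at h'
    simpa only [← sub_eq_add_neg] using h'
  have := integral_Ioi_of_hasDerivAt_of_tendsto hcont hderiv (hS.integrableOn x) hlim
  rw [this, hΦ0, sub_zero]

/-- The distribution function of `μ` convolved with the Cauchy law of scale `η`. -/
noncomputable def smoothCDF (μ : Measure ℝ) (η x : ℝ) : ℝ := ∫ a, cauchyCDF η (x - a) ∂μ

lemma smoothCDF_nonneg (μ : Measure ℝ) (η x : ℝ) : 0 ≤ smoothCDF μ η x :=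
  integral_nonneg fun _ => cauchyCDF_nonneg _ _

section

variable {μ : Measure ℝ} [IsProbabilityMeasure μ] {η : ℝ}

lemma continuous_cauchyCDF (hη : 0 < η) : Continuous (cauchyCDF η) :=
  (secondDiffBound_cauchyCDF hη).continuous

lemma integrable_cauchyCDF_sub (hη : 0 < η) (x : ℝ) :
    Integrable (fun a => cauchyCDF η (x - a)) μ :=
  Integrable.of_bound ((continuous_cauchyCDF hη).comp (by fun_prop)).aestronglyMeasurable 1
    (Eventually.of_forall fun _ => abs_cauchyCDF_le _ _)

lemma smoothCDF_le_one (hη : 0 < η) (x : ℝ) : smoothCDF μ η x ≤ 1 := by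
  calc smoothCDF μ η x ≤ ∫ _, (1 : ℝ) ∂μ :=
        integral_mono (integrable_cauchyCDF_sub hη x) (integrable_const _)
          fun _ => cauchyCDF_le_one _ _
    _ = 1 := by simp

lemma abs_smoothCDF_le (hη : 0 < η) (x : ℝ) : |smoothCDF μ η x| ≤ 1 := by
  rw [abs_of_nonneg (smoothCDF_nonneg μ η x)]
  exact smoothCDF_le_one hη x

lemma hasDerivAt_smoothCDF (hη : 0 < η) (x : ℝ) :
    HasDerivAt (smoothCDF μ η) (inversionDensity (stieltjes μ) η x) x := by
  rw [inversionDensity_stieltjes μ hη]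
  refine (hasDerivAt_integral_of_dominated_loc_of_deriv_le
    (F := fun x a => cauchyCDF η (x - a)) (F' := fun x a => poisson η (x - a))
    (bound := fun _ => (Real.pi * η)⁻¹) univ_mem
    (Eventually.of_forall fun y => (integrable_cauchyCDF_sub hη y).aestronglyMeasurable)
    (integrable_cauchyCDF_sub hη x)
    ((continuous_poisson hη).comp (by fun_prop)).aestronglyMeasurable ?_ (integrable_const _)
    (Eventually.of_forall fun a y _ => ?_)).2
  · refine Eventually.of_forall fun a y _ => ?_
    rw [Real.norm_of_nonneg (poisson_pos hη _).le]
    exact poisson_le hη _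
  · exact (hasDerivAt_cauchyCDF hη (y - a)).comp_sub_const y a

/-- The half-Laplacian of the regularized distribution function is the Hilbert transform. -/
lemma halfLaplacianNear_smoothCDF (hη : 0 < η) (x : ℝ) :
    halfLaplacianNear ∞ (smoothCDF μ η) x = (stieltjes μ (x + η * Complex.I)).re := by
  have hz : 0 < ((x : ℂ) + η * Complex.I).im := by simpa using hη
  have h := integral_re (integrable_inv_sub (μ := μ) hz)
  simp only [RCLike.re_to_complex] at h
  rw [stieltjes, ← h]
  change halfLaplacianNear ∞ (fun x => ∫ a, cauchyCDF η (x - a) ∂μ) x = _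
  rw [(secondDiffBound_cauchyCDF hη).halfLaplacianNear_average μ x]
  refine integral_congr_ae (Eventually.of_forall fun a => ?_)
  simp only
  rw [halfLaplacianNear_cauchyCDF hη, Complex.inv_re, Complex.normSq_eq_norm_sq,
    norm_sq_sub_ofReal, ofReal_add_mul_I_re, ofReal_add_mul_I_im, Complex.sub_re,
    ofReal_add_mul_I_re, Complex.ofReal_re]

/-- The regularized distribution function is bounded below by the distribution function, up to a
shift and a small error. -/
lemma cdf_le_smoothCDF (hη : 0 < η) (x ε : ℝ) :
    μ.real (Set.Iic x) ≤ smoothCDF μ η (x + ε) + cauchyCDF η (-ε) := by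
  have h : ∫ a, (Set.Iic x).indicator (fun _ => (1 : ℝ)) a ∂μ
      ≤ ∫ a, (cauchyCDF η (x + ε - a) + cauchyCDF η (-ε)) ∂μ := by
    refine integral_mono ((integrable_const 1).indicator measurableSet_Iic)
      ((integrable_cauchyCDF_sub hη _).add (integrable_const _)) fun a => ?_
    simp only [Set.indicator]
    split_ifs with ha
    · have h1 : cauchyCDF η ε ≤ cauchyCDF η (x + ε - a) :=
        monotone_cauchyCDF hη (by linarith [Set.mem_Iic.1 ha])
      rw [cauchyCDF_neg]
      linarith
    · exact add_nonneg (cauchyCDF_nonneg _ _) (cauchyCDF_nonneg _ _)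
  rw [integral_indicator measurableSet_Iic, integral_add (integrable_cauchyCDF_sub hη _)
    (integrable_const _)] at h
  simpa [smoothCDF] using h

lemma smoothCDF_le_cdf (hη : 0 < η) (x ε : ℝ) :
    smoothCDF μ η x ≤ μ.real (Set.Iic (x + ε)) + cauchyCDF η (-ε) := by
  have h : ∫ a, cauchyCDF η (x - a) ∂μ
      ≤ ∫ a, ((Set.Iic (x + ε)).indicator (fun _ => (1 : ℝ)) a + cauchyCDF η (-ε)) ∂μ := by
    refine integral_mono (integrable_cauchyCDF_sub hη _)
      (((integrable_const 1).indicator measurableSet_Iic).add (integrable_const _)) fun a => ?_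
    simp only [Set.indicator]
    split_ifs with ha
    · linarith [cauchyCDF_le_one η (x - a), cauchyCDF_nonneg η (-ε)]
    · rw [Set.mem_Iic, not_le] at ha
      rw [zero_add]
      exact monotone_cauchyCDF hη (by linarith)
  rw [integral_add ((integrable_const 1).indicator measurableSet_Iic) (integrable_const _),
    integral_indicator measurableSet_Iic] at h
  simpa [smoothCDF] using h

end

/-- The error term in the comparison of a distribution function with its regularization vanishes
with the scale. -/
lemma tendsto_cauchyCDF_neg {ε : ℝ} (hε : 0 < ε) :
    Tendsto (fun η => cauchyCDF η (-ε)) (𝓝[>] 0) (𝓝 0) := by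
  have h1 : Tendsto (fun η : ℝ => ε / η) (𝓝[>] 0) atTop := by
    simp only [div_eq_mul_inv]
    exact tendsto_inv_nhdsGT_zero.const_mul_atTop hε
  have h2 := ((Real.tendsto_arctan_atTop.mono_right nhdsWithin_le_nhds).comp h1).const_mul Real.pi⁻¹
  have h3 := h2.const_sub (1 / 2)
  have hpi := Real.pi_pos
  rw [show 1 / 2 - Real.pi⁻¹ * (Real.pi / 2) = 0 by field_simp; norm_num] at h3
  refine h3.congr fun η => ?_
  simp only [cauchyCDF, Function.comp_apply, neg_div, Real.arctan_neg]
  ring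

/-! ### The regularized flow as a classical solution -/

/-- A bounded function whose partial derivatives are bounded and Lipschitz is of class
`C^{1,1}_b`. -/
lemma IsC11b.of_partials {w p q : ℝ × ℝ → ℝ} {C Cp Cq : ℝ} {Kp Kq : ℝ≥0}
    (hq : ∀ t x, HasDerivAt (fun s => w (s, x)) (q (t, x)) t)
    (hp : ∀ t x, HasDerivAt (fun y => w (t, y)) (p (t, x)) x)
    (hw : ∀ z, |w z| ≤ C) (hpb : ∀ z, |p z| ≤ Cp) (hqb : ∀ z, |q z| ≤ Cq)
    (hpl : LipschitzWith Kp p) (hql : LipschitzWith Kq q) : IsC11b w := by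
  set L : ℝ × ℝ → (ℝ × ℝ →L[ℝ] ℝ) := fun z =>
    (ContinuousLinearMap.toSpanSingleton ℝ (q z)).coprod
      (ContinuousLinearMap.toSpanSingleton ℝ (p z)) with hL
  have hts : Continuous fun r : ℝ => ContinuousLinearMap.toSpanSingleton ℝ r :=
    (ContinuousLinearMap.toSpanSingletonCLE (𝕜 := ℝ) (E := ℝ)).continuous
  have hd : ∀ z, HasFDerivAt w (L z) z := by
    intro z
    have h := hasStrictFDerivAt_uncurry_coprod (𝕜 := ℝ) (u := z) (f := fun s y => w (s, y))
      (f₁ := fun s y => ContinuousLinearMap.toSpanSingleton ℝ (q (s, y)))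
      (f₂ := fun s y => ContinuousLinearMap.toSpanSingleton ℝ (p (s, y)))
      (Eventually.of_forall fun v => (hq v.1 v.2).hasFDerivAt)
      (Eventually.of_forall fun v => (hp v.1 v.2).hasFDerivAt)
      (hts.comp hql.continuous).continuousAt (hts.comp hpl.continuous).continuousAt
    exact h.hasFDerivAt
  have hnorm : ∀ (a b : ℝ), ‖(ContinuousLinearMap.toSpanSingleton ℝ a).coprod
      (ContinuousLinearMap.toSpanSingleton ℝ b)‖ ≤ |a| + |b| := by
    intro a b
    refine ContinuousLinearMap.opNorm_le_bound _ (by positivity) fun v => ?_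
    simp only [ContinuousLinearMap.coprod_apply, ContinuousLinearMap.toSpanSingleton_apply,
      smul_eq_mul]
    refine (norm_add_le _ _).trans ?_
    rw [norm_mul, norm_mul, Real.norm_eq_abs a, Real.norm_eq_abs b]
    have h1 := norm_fst_le v
    have h2 := norm_snd_le v
    have := mul_le_mul_of_nonneg_right h1 (abs_nonneg a)
    have := mul_le_mul_of_nonneg_right h2 (abs_nonneg b)
    linarith
  have hfd : ∀ z, fderiv ℝ w z = L z := fun z => (hd z).fderiv
  refine ⟨fun z => (hd z).differentiableAt, ⟨C, hw⟩, ⟨Cq + Cp, fun z => ?_⟩, ⟨Kq + Kp, ?_⟩⟩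
  · rw [hfd]
    exact (hnorm _ _).trans (add_le_add (hqb z) (hpb z))
  · refine LipschitzWith.of_dist_le_mul fun z z' => ?_
    rw [hfd, hfd, dist_eq_norm]
    have e : L z - L z' = (ContinuousLinearMap.toSpanSingleton ℝ (q z - q z')).coprod
        (ContinuousLinearMap.toSpanSingleton ℝ (p z - p z')) := by
      refine ContinuousLinearMap.ext fun v => ?_
      simp only [hL, sub_apply, ContinuousLinearMap.coprod_apply,
        ContinuousLinearMap.toSpanSingleton_apply, smul_eq_mul]
      ring
    rw [e]
    refine (hnorm _ _).trans ?_
    have h1 := hql.dist_le_mul z z'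
    have h2 := hpl.dist_le_mul z z'
    rw [Real.dist_eq] at h1 h2
    push_cast
    linarith

section

variable {μ : Measure ℝ} [IsProbabilityMeasure μ]

lemma norm_stieltjes_sub_le {η : ℝ} (hη : 0 < η) {z w : ℂ} (hz : η ≤ z.im) (hw : η ≤ w.im) :
    ‖stieltjes μ z - stieltjes μ w‖ ≤ (η ^ 2)⁻¹ * ‖z - w‖ := by
  have hz0 := hη.trans_le hz
  have hw0 := hη.trans_le hw
  rw [stieltjes_sub hw0 hz0, norm_mul, mul_comm, norm_sub_rev w z]
  gcongr
  refine (norm_integral_inv_mul_le _ _).trans ((integral_norm_inv_mul_le hw0 hz0 one_pos).trans ?_)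
  have c1 := resolventSq_le (μ := μ) hz0
  have c2 := resolventSq_le (μ := μ) hw0
  have c3 : (z.im ^ 2)⁻¹ ≤ (η ^ 2)⁻¹ := by gcongr
  have c4 : (w.im ^ 2)⁻¹ ≤ (η ^ 2)⁻¹ := by gcongr
  linarith

lemma continuousWithinAt_stieltjes_freeConv {t : ℝ} (ht : 0 ≤ t) {z : ℂ} (hz : 0 < z.im) :
    ContinuousWithinAt (fun s => stieltjes (freeConv μ s) z) (Set.Ici 0) t := by
  have hw : ContinuousWithinAt (fun s => subord μ s z) (Set.Ici 0) t := by
    rw [ContinuousWithinAt, tendsto_iff_norm_sub_tendsto_zero]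
    have hk : ∀ s ∈ Set.Ici (0 : ℝ), 0 < z.im ^ 2 / (z.im ^ 2 + max s t) := by
      intro s hs
      have : 0 ≤ max s t := ht.trans (le_max_right _ _)
      positivity
    have hlim : Tendsto (fun s : ℝ => |s - t| * (z.im)⁻¹ / (z.im ^ 2 / (z.im ^ 2 + max s t)))
        (𝓝[Set.Ici 0] t) (𝓝 0) := by
      have hc : ContinuousAt
          (fun s : ℝ => |s - t| * (z.im)⁻¹ / (z.im ^ 2 / (z.im ^ 2 + max s t))) t := by
        refine ContinuousAt.div (by fun_prop) ?_ (hk t ht).ne'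
        refine ContinuousAt.div (by fun_prop) (by fun_prop) ?_
        rw [max_self]
        positivity
      have := hc.tendsto.mono_left (nhdsWithin_le_nhds (s := Set.Ici 0))
      simpa using this
    refine squeeze_zero' (Eventually.of_forall fun _ => norm_nonneg _) ?_ hlim
    filter_upwards [self_mem_nhdsWithin] with s hs
    have hs' : 0 ≤ s := hs
    rw [le_div_iff₀ (hk s hs)]
    obtain ⟨a1, a2⟩ := subord_spec (μ := μ) hs' hz
    obtain ⟨b1, b2⟩ := subord_spec (μ := μ) ht hz
    rcases le_total s t with h | h
    · have := norm_subordination_sub_le hs' h hz le_rfl le_rfl a1 b1 a2 b2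
      rw [max_eq_right h, abs_of_nonpos (by linarith)]
      simpa using this
    · have := norm_subordination_sub_le ht h hz le_rfl le_rfl b1 a1 b2 a2
      rw [max_eq_left h, abs_of_nonneg (by linarith), norm_sub_rev]
      simpa using this
  have h := ContinuousAt.comp_continuousWithinAt (g := stieltjes μ) (f := fun s => subord μ s z)
    (hasDerivAt_stieltjes (μ := μ) (subord_spec ht hz).1).continuousAt hw
  refine h.congr (fun s hs => ?_) ?_
  · rw [stieltjes_freeConv hs hz]; rfl
  · rw [stieltjes_freeConv ht hz]; rfl

/-- The complex Burgers equation `∂ₜG + G ∂_z G = 0`, from the semigroup property. -/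
lemma hasDerivWithinAt_stieltjes_freeConv {t : ℝ} (ht : 0 ≤ t) {z : ℂ} (hz : 0 < z.im) :
    HasDerivWithinAt (fun s => stieltjes (freeConv μ s) z)
      (-(stieltjes (freeConv μ t) z * deriv (stieltjes (freeConv μ t)) z)) (Set.Ici 0) t := by
  set c : ℝ → ℂ := fun s => z - (s - t) * stieltjes (freeConv μ s) z with hc
  have hct : c t = z := by simp [hc]
  have hcd : HasDerivWithinAt c (-stieltjes (freeConv μ t) z) (Set.Ici 0) t := by
    rw [hasDerivWithinAt_iff_tendsto_slope]
    have h1 : Tendsto (fun s => -stieltjes (freeConv μ s) z) (𝓝[Set.Ici 0] t)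
        (𝓝 (-stieltjes (freeConv μ t) z)) :=
      (continuousWithinAt_stieltjes_freeConv (μ := μ) ht hz).neg.tendsto
    refine (h1.mono_left (nhdsWithin_mono t Set.sdiff_subset)).congr' ?_
    filter_upwards [self_mem_nhdsWithin] with s hs
    have hst : ((s - t : ℝ) : ℂ) ≠ 0 := by
      have : s ≠ t := fun h => hs.2 (by simp [h])
      exact_mod_cast sub_ne_zero.2 this
    rw [slope_def_module, hct, Complex.real_smul]
    simp only [hc]
    push_cast at hst ⊢
    field_simp
    ring
  have hd : HasDerivAt (stieltjes (freeConv μ t)) (deriv (stieltjes (freeConv μ t)) z) (c t) := by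
    rw [hct]
    exact (hasDerivAt_stieltjes hz).differentiableAt.hasDerivAt
  have h := HasDerivAt.scomp_hasDerivWithinAt t hd hcd
  rw [smul_eq_mul, neg_mul] at h
  refine h.congr_of_eventuallyEq ?_ ?_
  · have him : ∀ᶠ s in 𝓝[Set.Ici 0] t, 0 < (c s).im := by
      have := (Complex.continuous_im.continuousAt.comp_continuousWithinAt hcd.continuousWithinAt)
      refine this.tendsto.eventually (lt_mem_nhds ?_)
      simp only [Function.comp_apply, hct]
      exact hz
    filter_upwards [him, self_mem_nhdsWithin] with s hs1 hs2
    exact (stieltjes_freeConv_semigroup ht hs2 hz hs1).symm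
  · simp only [Function.comp_apply, hct]

lemma norm_stieltjes_freeConv_sub_le {s t : ℝ} (hs : 0 ≤ s) (ht : 0 ≤ t) {z : ℂ}
    (hz : 0 < z.im) :
    ‖stieltjes (freeConv μ t) z - stieltjes (freeConv μ s) z‖ ≤ (z.im ^ 3)⁻¹ * |t - s| := by
  have := (convex_Ici (0 : ℝ)).norm_image_sub_le_of_norm_hasDerivWithin_le
    (f := fun s => stieltjes (freeConv μ s) z) (C := (z.im ^ 3)⁻¹)
    (fun r hr => hasDerivWithinAt_stieltjes_freeConv hr hz) (fun r _ => ?_) hs ht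
  · simpa using this
  · rw [norm_neg, norm_mul]
    have h1 := norm_stieltjes_le (μ := freeConv μ r) hz
    have h2 := norm_deriv_stieltjes_le (μ := freeConv μ r) hz
    calc _ ≤ (z.im)⁻¹ * ((z.im)⁻¹ * (z.im)⁻¹) := by gcongr
      _ = (z.im ^ 3)⁻¹ := by field_simp

variable (μ) in
/-- The Stieltjes transform of the flow on the line at height `η`, extended evenly in time so that
it is defined and Lipschitz on the whole plane. -/
noncomputable def lineStieltjes (η : ℝ) (z : ℝ × ℝ) : ℂ :=
  stieltjes (freeConv μ |z.1|) (z.2 + η * Complex.I)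

variable {η : ℝ}

lemma norm_lineStieltjes_le (hη : 0 < η) (z : ℝ × ℝ) : ‖lineStieltjes μ η z‖ ≤ η⁻¹ := by
  have := norm_stieltjes_le (μ := freeConv μ |z.1|) (z := z.2 + η * Complex.I) (by simpa using hη)
  rwa [ofReal_add_mul_I_im] at this

lemma lipschitzWith_lineStieltjes (hη : 0 < η) :
    LipschitzWith (Real.toNNReal ((η ^ 3)⁻¹ + (η ^ 2)⁻¹)) (lineStieltjes μ η) := by
  refine LipschitzWith.of_dist_le_mul fun z w => ?_
  rw [Real.coe_toNNReal _ (by positivity), dist_eq_norm]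
  have him : ∀ x : ℝ, ((x : ℂ) + η * Complex.I).im = η := fun x => ofReal_add_mul_I_im x η
  have h1 := norm_stieltjes_freeConv_sub_le (μ := μ) (abs_nonneg w.1) (abs_nonneg z.1)
    (z := z.2 + η * Complex.I) (by rw [him]; exact hη)
  have h2 := norm_stieltjes_sub_le (μ := freeConv μ |w.1|) hη (z := z.2 + η * Complex.I)
    (w := w.2 + η * Complex.I) (by rw [him]) (by rw [him])
  rw [him] at h1
  rw [add_sub_add_right_eq_sub, ← Complex.ofReal_sub, Complex.norm_real, Real.norm_eq_abs] at h2
  have h3 := norm_add_le (stieltjes (freeConv μ |z.1|) (z.2 + η * Complex.I)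
    - stieltjes (freeConv μ |w.1|) (z.2 + η * Complex.I))
    (stieltjes (freeConv μ |w.1|) (z.2 + η * Complex.I)
    - stieltjes (freeConv μ |w.1|) (w.2 + η * Complex.I))
  rw [sub_add_sub_cancel] at h3
  have d1 : |(|z.1| - |w.1|)| ≤ dist z w :=
    (abs_abs_sub_abs_le_abs_sub _ _).trans (le_max_left _ _)
  have d2 : |z.2 - w.2| ≤ dist z w := le_max_right _ _
  calc _ ≤ (η ^ 3)⁻¹ * |(|z.1| - |w.1|)| + (η ^ 2)⁻¹ * |z.2 - w.2| := h3.trans (add_le_add h1 h2)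
    _ ≤ (η ^ 3)⁻¹ * dist z w + (η ^ 2)⁻¹ * dist z w := by gcongr
    _ = _ := by ring

variable (μ) in
/-- The time derivative of the regularized flow: minus the flux of the regularized density in the
velocity field given by its Hilbert transform. -/
noncomputable def timeRate (η : ℝ) (z : ℝ × ℝ) : ℝ :=
  Real.pi⁻¹ * ((lineStieltjes μ η z).im * (lineStieltjes μ η z).re)

lemma abs_im_mul_re_le (z : ℂ) : |z.im * z.re| ≤ ‖z‖ ^ 2 := by
  rw [abs_mul, sq]
  exact mul_le_mul (Complex.abs_im_le_norm z) (Complex.abs_re_le_norm z) (abs_nonneg _)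
    (norm_nonneg _)

lemma abs_timeRate_le (hη : 0 < η) (z : ℝ × ℝ) : |timeRate μ η z| ≤ Real.pi⁻¹ * (η⁻¹) ^ 2 := by
  rw [timeRate, abs_mul, abs_of_pos (inv_pos.2 Real.pi_pos)]
  have := norm_lineStieltjes_le (μ := μ) hη z
  have hpi := Real.pi_pos
  gcongr
  exact (abs_im_mul_re_le _).trans (by gcongr)

lemma lipschitzWith_timeRate (hη : 0 < η) :
    ∃ K : ℝ≥0, LipschitzWith K (timeRate μ η) := by
  refine ⟨Real.toNNReal (Real.pi⁻¹ * (2 * η⁻¹ * ((η ^ 3)⁻¹ + (η ^ 2)⁻¹))),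
    LipschitzWith.of_dist_le_mul fun z w => ?_⟩
  have hpi := Real.pi_pos
  rw [Real.coe_toNNReal _ (by positivity), Real.dist_eq, timeRate, timeRate, ← mul_sub, abs_mul,
    abs_of_pos (inv_pos.2 hpi), mul_assoc]
  refine mul_le_mul_of_nonneg_left ?_ (inv_pos.2 hpi).le
  have hl := (lipschitzWith_lineStieltjes (μ := μ) hη).dist_le_mul z w
  rw [Real.coe_toNNReal _ (by positivity), dist_eq_norm] at hl
  set a := lineStieltjes μ η z
  set b := lineStieltjes μ η w
  have ha : ‖a‖ ≤ η⁻¹ := norm_lineStieltjes_le hη z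
  have hb : ‖b‖ ≤ η⁻¹ := norm_lineStieltjes_le hη w
  have h1 : |a.im| * |a.re - b.re| ≤ η⁻¹ * ‖a - b‖ :=
    mul_le_mul ((Complex.abs_im_le_norm a).trans ha) (by
      simpa using Complex.abs_re_le_norm (a - b)) (abs_nonneg _) (by positivity)
  have h2 : |a.im - b.im| * |b.re| ≤ ‖a - b‖ * η⁻¹ :=
    mul_le_mul (by simpa using Complex.abs_im_le_norm (a - b))
      ((Complex.abs_re_le_norm b).trans hb) (abs_nonneg _) (norm_nonneg _)
  calc |a.im * a.re - b.im * b.re| = |a.im * (a.re - b.re) + (a.im - b.im) * b.re| := by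
        congr 1; ring
    _ ≤ |a.im| * |a.re - b.re| + |a.im - b.im| * |b.re| := by
        rw [← abs_mul, ← abs_mul]
        exact abs_add_le _ _
    _ ≤ 2 * η⁻¹ * ‖a - b‖ := by linarith
    _ ≤ 2 * η⁻¹ * (((η ^ 3)⁻¹ + (η ^ 2)⁻¹) * dist z w) := by gcongr
    _ = _ := by ring

lemma continuous_timeRate (hη : 0 < η) : Continuous (timeRate μ η) :=
  (lipschitzWith_timeRate hη).choose_spec.continuous

/-- The product `G ∂_z G` is a time derivative, hence measurable in time. -/
lemma aestronglyMeasurable_mul_deriv {t : ℝ} (ht : 0 ≤ t) {z : ℂ} (hz : 0 < z.im) :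
    AEStronglyMeasurable
      (fun r => stieltjes (freeConv μ r) z * deriv (stieltjes (freeConv μ r)) z)
      (volume.restrict (Set.uIoc 0 t)) := by
  have h := (measurable_deriv fun s => stieltjes (freeConv μ s) z).neg
  refine h.aestronglyMeasurable.congr ?_
  refine (ae_restrict_iff' measurableSet_uIoc).2 (Eventually.of_forall fun r hr => ?_)
  rw [Set.uIoc_of_le ht] at hr
  have := (hasDerivWithinAt_stieltjes_freeConv (μ := μ) hr.1.le hz).hasDerivAt
    (Ici_mem_nhds hr.1)
  rw [Pi.neg_apply, this.deriv, neg_neg]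

lemma norm_mul_deriv_stieltjes_le {r : ℝ} {z : ℂ} (hz : 0 < z.im) :
    ‖stieltjes (freeConv μ r) z * deriv (stieltjes (freeConv μ r)) z‖
      ≤ (z.im)⁻¹ * ((z.im)⁻¹ * (z.im)⁻¹) := by
  rw [norm_mul]
  have h1 := norm_stieltjes_le (μ := freeConv μ r) hz
  have h2 := norm_deriv_stieltjes_le (μ := freeConv μ r) hz
  gcongr

lemma intervalIntegrable_mul_deriv {t : ℝ} (ht : 0 ≤ t) {z : ℂ} (hz : 0 < z.im) :
    IntervalIntegrable
      (fun r => stieltjes (freeConv μ r) z * deriv (stieltjes (freeConv μ r)) z) volume 0 t := by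
  rw [intervalIntegrable_iff]
  have : IsFiniteMeasure (volume.restrict (Set.uIoc 0 t)) := by
    rw [Set.uIoc_of_le ht]
    infer_instance
  exact Integrable.of_bound (aestronglyMeasurable_mul_deriv ht hz) _
    (Eventually.of_forall fun r => norm_mul_deriv_stieltjes_le hz)

lemma integral_mul_deriv {t : ℝ} (ht : 0 ≤ t) {z : ℂ} (hz : 0 < z.im) :
    ∫ r in (0 : ℝ)..t, stieltjes (freeConv μ r) z * deriv (stieltjes (freeConv μ r)) z
      = stieltjes μ z - stieltjes (freeConv μ t) z := by
  have h := intervalIntegral.integral_eq_sub_of_hasDerivAt_of_le ht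
    (f := fun s => stieltjes (freeConv μ s) z)
    (fun r hr => (continuousWithinAt_stieltjes_freeConv hr.1 hz).mono Set.Icc_subset_Ici_self)
    (fun r hr => (hasDerivWithinAt_stieltjes_freeConv hr.1.le hz).hasDerivAt (Ici_mem_nhds hr.1))
    (intervalIntegrable_mul_deriv ht hz).neg
  rw [intervalIntegral.integral_neg, freeConv_zero] at h
  linear_combination -h

end

lemma tendsto_cauchyCDF_atBot {η : ℝ} (hη : 0 < η) : Tendsto (cauchyCDF η) atBot (𝓝 0) := by
  have h1 : Tendsto (fun x : ℝ => x / η) atBot atBot := tendsto_id.atBot_div_const hη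
  have h2 := (((Real.tendsto_arctan_atBot.mono_right nhdsWithin_le_nhds).comp h1).const_mul
    Real.pi⁻¹).const_add (1 / 2)
  have hpi := Real.pi_pos
  rw [show 1 / 2 + Real.pi⁻¹ * (-(Real.pi / 2)) = 0 by field_simp; norm_num] at h2
  exact h2

lemma tendsto_smoothCDF_atBot {μ : Measure ℝ} [IsProbabilityMeasure μ] {η : ℝ} (hη : 0 < η) :
    Tendsto (smoothCDF μ η) atBot (𝓝 0) := by
  have h : Tendsto (fun x => ∫ a, cauchyCDF η (x - a) ∂μ) atBot (𝓝 (∫ _, (0 : ℝ) ∂μ)) := by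
    refine tendsto_integral_filter_of_dominated_convergence (fun _ => 1)
      (Eventually.of_forall fun x => (integrable_cauchyCDF_sub hη x).aestronglyMeasurable)
      (Eventually.of_forall fun x => Eventually.of_forall fun a => abs_cauchyCDF_le _ _)
      (integrable_const _) (Eventually.of_forall fun a => ?_)
    exact (tendsto_cauchyCDF_atBot hη).comp (tendsto_atBot_add_const_right _ (-a) tendsto_id)
  rw [integral_zero] at h
  exact h

lemma tendsto_stieltjes_atBot {μ : Measure ℝ} [IsProbabilityMeasure μ] {η : ℝ} (hη : 0 < η) :
    Tendsto (fun x : ℝ => stieltjes μ (x + η * Complex.I)) atBot (𝓝 0) := by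
  have hz : ∀ x : ℝ, 0 < ((x : ℂ) + η * Complex.I).im := fun x => by simpa using hη
  have h : Tendsto (fun x : ℝ => ∫ a : ℝ, ((x : ℂ) + η * Complex.I - a)⁻¹ ∂μ) atBot
      (𝓝 (∫ _, (0 : ℂ) ∂μ)) := by
    refine tendsto_integral_filter_of_dominated_convergence (fun _ => η⁻¹)
      (Eventually.of_forall fun x => (integrable_inv_sub (hz x)).aestronglyMeasurable)
      (Eventually.of_forall fun x => Eventually.of_forall fun a => ?_)
      (integrable_const _) (Eventually.of_forall fun a => ?_)
    · have := norm_inv_sub_ofReal_le (hz x) a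
      rwa [ofReal_add_mul_I_im] at this
    · refine tendsto_inv₀_cobounded.comp ?_
      rw [← tendsto_norm_atTop_iff_cobounded]
      have h1 : Tendsto (fun x : ℝ => |x - a|) atBot atTop :=
        tendsto_abs_atBot_atTop.comp (tendsto_atBot_add_const_right _ (-a) tendsto_id)
      refine tendsto_atTop_mono (fun x => ?_) h1
      have := Complex.abs_re_le_norm ((x : ℂ) + η * Complex.I - a)
      simpa using this
  rw [integral_zero] at h
  exact h

section

variable {μ : Measure ℝ} [IsProbabilityMeasure μ] {η : ℝ}

lemma hasDerivAt_timeRate (hη : 0 < η) {r : ℝ} (hr : 0 ≤ r) (x : ℝ) :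
    HasDerivAt (fun y => timeRate μ η (r, y))
      (Real.pi⁻¹ * (stieltjes (freeConv μ r) (x + η * Complex.I)
        * deriv (stieltjes (freeConv μ r)) (x + η * Complex.I)).im) x := by
  have hz : 0 < ((x : ℂ) + η * Complex.I).im := by simpa using hη
  have hl : HasDerivAt (fun y : ℝ => (y : ℂ) + η * Complex.I) 1 x :=
    (Complex.ofRealCLM.hasDerivAt (x := x)).add_const _
  have hd := ((hasDerivAt_stieltjes (μ := freeConv μ r) hz).differentiableAt.hasDerivAt.scomp x hl)
  rw [one_smul] at hd
  have hre := Complex.reCLM.hasFDerivAt.comp_hasDerivAt x hd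
  have him := Complex.imCLM.hasFDerivAt.comp_hasDerivAt x hd
  have h := (him.mul hre).const_mul Real.pi⁻¹
  have e : (fun y => timeRate μ η (r, y)) = fun y : ℝ => Real.pi⁻¹ *
      ((Complex.imCLM ∘ (stieltjes (freeConv μ r) ∘ fun y : ℝ => (y : ℂ) + η * Complex.I)) y *
        (Complex.reCLM ∘ (stieltjes (freeConv μ r) ∘ fun y : ℝ => (y : ℂ) + η * Complex.I)) y) := by
    ext y
    simp [timeRate, lineStieltjes, abs_of_nonneg hr]
  rw [e]
  refine h.congr_deriv ?_
  simp only [Complex.imCLM_apply, Complex.reCLM_apply, Function.comp_apply, Complex.mul_im]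
  ring

/-- Duhamel form of the evolution of the regularized distribution function: both sides have the
same spatial derivative by the complex Burgers equation, and the same limit at `-∞`. -/
lemma smoothCDF_freeConv (hη : 0 < η) {t : ℝ} (ht : 0 ≤ t) (x : ℝ) :
    smoothCDF (freeConv μ t) η x
      = smoothCDF μ η x + ∫ r in (0 : ℝ)..t, timeRate μ η (r, x) := by
  set D : ℝ → ℝ := fun x => smoothCDF (freeConv μ t) η x - smoothCDF μ η x
    - ∫ r in (0 : ℝ)..t, timeRate μ η (r, x) with hD
  have hz : ∀ x : ℝ, 0 < ((x : ℂ) + η * Complex.I).im := fun x => by simpa using hη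
  have hcr : ∀ x, Continuous fun r => timeRate μ η (r, x) := fun x =>
    (continuous_timeRate hη).comp (by fun_prop)
  have hint : ∀ x : ℝ, HasDerivAt (fun x => ∫ r in (0 : ℝ)..t, timeRate μ η (r, x))
      (∫ r in (0 : ℝ)..t, Real.pi⁻¹ * (stieltjes (freeConv μ r) (x + η * Complex.I)
        * deriv (stieltjes (freeConv μ r)) (x + η * Complex.I)).im) x := by
    intro x
    refine (intervalIntegral.hasDerivAt_integral_of_dominated_loc_of_deriv_le
      (a := 0) (b := t) (F := fun y r => timeRate μ η (r, y))
      (F' := fun y r => Real.pi⁻¹ * (stieltjes (freeConv μ r) ((y : ℂ) + η * Complex.I)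
        * deriv (stieltjes (freeConv μ r)) ((y : ℂ) + η * Complex.I)).im)
      (bound := fun _ => Real.pi⁻¹ * (η⁻¹ * (η⁻¹ * η⁻¹))) univ_mem
      (Eventually.of_forall fun y => (hcr y).aestronglyMeasurable)
      ((hcr x).intervalIntegrable _ _) ?_ ?_
      (intervalIntegrable_const (μ := volume)) ?_).2
    · exact (Complex.continuous_im.comp_aestronglyMeasurable
        (aestronglyMeasurable_mul_deriv ht (hz x))).const_mul _
    · refine Eventually.of_forall fun r _ y _ => ?_
      rw [norm_mul, Real.norm_of_nonneg (inv_pos.2 Real.pi_pos).le]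
      have hpi := Real.pi_pos
      gcongr
      refine (Complex.abs_im_le_norm _).trans ?_
      have := norm_mul_deriv_stieltjes_le (μ := μ) (r := r) (hz y)
      rwa [ofReal_add_mul_I_im] at this
    · refine Eventually.of_forall fun r hr y _ => ?_
      rw [Set.uIoc_of_le ht] at hr
      exact hasDerivAt_timeRate hη hr.1.le y
  have hDd : ∀ x : ℝ, HasDerivAt D 0 x := by
    intro x
    have h := ((hasDerivAt_smoothCDF (μ := freeConv μ t) hη x).sub
      (hasDerivAt_smoothCDF (μ := μ) hη x)).sub (hint x)
    refine h.congr_deriv ?_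
    rw [intervalIntegral.integral_const_mul]
    have him : ∫ r in (0 : ℝ)..t, (stieltjes (freeConv μ r) (x + η * Complex.I)
        * deriv (stieltjes (freeConv μ r)) (x + η * Complex.I)).im
        = (∫ r in (0 : ℝ)..t, stieltjes (freeConv μ r) (x + η * Complex.I)
        * deriv (stieltjes (freeConv μ r)) (x + η * Complex.I)).im := by
      have h1 := (intervalIntegrable_mul_deriv (μ := μ) ht (hz x)).1
      have h2 := integral_im h1
      simp only [RCLike.im_to_complex] at h2
      rw [intervalIntegral.integral_of_le ht, intervalIntegral.integral_of_le ht, h2]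
    rw [him, integral_mul_deriv ht (hz x), inversionDensity, inversionDensity, Complex.sub_im]
    ring
  have hconst : ∀ y, D x = D y := fun y =>
    is_const_of_deriv_eq_zero (fun x => (hDd x).differentiableAt) (fun x => (hDd x).deriv) x y
  have hlim : Tendsto D atBot (𝓝 0) := by
    have h1 : Tendsto (fun x => ∫ r in (0 : ℝ)..t, timeRate μ η (r, x)) atBot
        (𝓝 (∫ r in (0 : ℝ)..t, (0 : ℝ))) := by
      refine intervalIntegral.tendsto_integral_filter_of_dominated_convergence
        (fun _ => Real.pi⁻¹ * (η⁻¹) ^ 2)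
        (Eventually.of_forall fun y => (hcr y).aestronglyMeasurable)
        (Eventually.of_forall fun y => Eventually.of_forall fun r _ => abs_timeRate_le hη _)
        intervalIntegrable_const (Eventually.of_forall fun r _ => ?_)
      have h2 := tendsto_stieltjes_atBot (μ := freeConv μ |r|) hη
      have h3 := (((Complex.continuous_im.tendsto _).comp h2).mul
        ((Complex.continuous_re.tendsto _).comp h2)).const_mul Real.pi⁻¹
      simp only [Complex.zero_im, Complex.zero_re, mul_zero] at h3
      exact h3
    have h2 := ((tendsto_smoothCDF_atBot (μ := freeConv μ t) hη).sub
      (tendsto_smoothCDF_atBot (μ := μ) hη)).sub h1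
    simpa using h2
  have hDx : D x = 0 := by
    refine tendsto_nhds_unique ?_ hlim
    exact tendsto_const_nhds.congr hconst
  simp only [hD] at hDx
  linarith

variable (μ) in
/-- The regularized flow, extended to negative times by reflection so as to be a test function of
class `C^{1,1}_b` on the whole plane. -/
noncomputable def smoothSolution (η : ℝ) (z : ℝ × ℝ) : ℝ :=
  smoothCDF (freeConv μ (max z.1 0)) η z.2 - smoothCDF (freeConv μ (max (-z.1) 0)) η z.2
    + smoothCDF μ η z.2

omit [IsProbabilityMeasure μ] in
lemma smoothSolution_of_nonneg {t : ℝ} (ht : 0 ≤ t) (x : ℝ) :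
    smoothSolution μ η (t, x) = smoothCDF (freeConv μ t) η x := by
  simp only [smoothSolution]
  rw [max_eq_left ht, max_eq_right (by linarith), freeConv_zero]
  ring

lemma smoothSolution_eq_integral (hη : 0 < η) (t x : ℝ) :
    smoothSolution μ η (t, x) = smoothCDF μ η x + ∫ r in (0 : ℝ)..t, timeRate μ η (r, x) := by
  rcases le_total 0 t with ht | ht
  · rw [smoothSolution_of_nonneg ht, smoothCDF_freeConv hη ht]
  · simp only [smoothSolution]
    rw [max_eq_right ht, max_eq_left (by linarith), freeConv_zero,
      smoothCDF_freeConv hη (by linarith : (0 : ℝ) ≤ -t)]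
    have h : ∫ r in (0 : ℝ)..-t, timeRate μ η (r, x)
        = -∫ r in (0 : ℝ)..t, timeRate μ η (r, x) := by
      have e : ∀ r, timeRate μ η (r, x) = timeRate μ η (-r, x) := fun r => by
        simp [timeRate, lineStieltjes]
      calc ∫ r in (0 : ℝ)..-t, timeRate μ η (r, x)
          = ∫ r in (0 : ℝ)..-t, timeRate μ η (-r, x) :=
            intervalIntegral.integral_congr fun r _ => e r
        _ = ∫ r in t..0, timeRate μ η (r, x) := by
            rw [intervalIntegral.integral_comp_neg (fun r => timeRate μ η (r, x))]
            simp
        _ = _ := intervalIntegral.integral_symm _ _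
    rw [h]
    ring

lemma hasDerivAt_smoothSolution_time (hη : 0 < η) (t x : ℝ) :
    HasDerivAt (fun s => smoothSolution μ η (s, x)) (timeRate μ η (t, x)) t := by
  simp only [smoothSolution_eq_integral hη]
  have hc : Continuous fun r => timeRate μ η (r, x) :=
    (continuous_timeRate hη).comp (by fun_prop)
  exact (hc.integral_hasStrictDerivAt 0 t).hasDerivAt.const_add _

variable (μ) in
/-- The spatial derivative of `smoothSolution`, the regularized density at nonnegative times. -/
noncomputable def spaceRate (η : ℝ) (z : ℝ × ℝ) : ℝ :=
  -(Real.pi⁻¹ * (lineStieltjes μ η (max z.1 0, z.2) - lineStieltjes μ η (max (-z.1) 0, z.2)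
    + lineStieltjes μ η (0, z.2)).im)

lemma hasDerivAt_smoothSolution_space (hη : 0 < η) (t x : ℝ) :
    HasDerivAt (fun y => smoothSolution μ η (t, y)) (spaceRate μ η (t, x)) x := by
  have h := ((hasDerivAt_smoothCDF (μ := freeConv μ (max t 0)) hη x).sub
    (hasDerivAt_smoothCDF (μ := freeConv μ (max (-t) 0)) hη x)).add
    (hasDerivAt_smoothCDF (μ := μ) hη x)
  refine h.congr_deriv ?_
  simp only [spaceRate, lineStieltjes, inversionDensity, Complex.add_im, Complex.sub_im]
  rw [abs_of_nonneg (le_max_right t 0), abs_of_nonneg (le_max_right (-t) 0), abs_zero,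
    freeConv_zero]
  ring

omit [IsProbabilityMeasure μ] in
lemma spaceRate_of_nonneg {t : ℝ} (ht : 0 ≤ t) (x : ℝ) :
    spaceRate μ η (t, x) = inversionDensity (stieltjes (freeConv μ t)) η x := by
  simp only [spaceRate, lineStieltjes]
  rw [max_eq_left ht, max_eq_right (by linarith), abs_of_nonneg ht]
  simp [inversionDensity]

lemma abs_smoothSolution_le (hη : 0 < η) (z : ℝ × ℝ) : |smoothSolution μ η z| ≤ 3 := by
  have h1 := abs_le.1 (abs_smoothCDF_le (μ := freeConv μ (max z.1 0)) hη z.2)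
  have h2 := abs_le.1 (abs_smoothCDF_le (μ := freeConv μ (max (-z.1) 0)) hη z.2)
  have h3 := abs_le.1 (abs_smoothCDF_le (μ := μ) hη z.2)
  rw [smoothSolution, abs_le]
  constructor <;> linarith [h1.1, h1.2, h2.1, h2.2, h3.1, h3.2]

lemma isC11b_smoothSolution (hη : 0 < η) : IsC11b (smoothSolution μ η) := by
  obtain ⟨K, hK⟩ := lipschitzWith_timeRate (μ := μ) hη
  have hpi := Real.pi_pos
  have hl := lipschitzWith_lineStieltjes (μ := μ) hη
  set L := Real.toNNReal ((η ^ 3)⁻¹ + (η ^ 2)⁻¹)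
  have hl1 : LipschitzWith L fun z : ℝ × ℝ => lineStieltjes μ η (max z.1 0, z.2) := by
    have h1 : LipschitzWith 1 fun z : ℝ × ℝ => (max z.1 0, z.2) := by
      have := (LipschitzWith.prod_fst (α := ℝ) (β := ℝ)).max_const 0
      simpa using this.prodMk LipschitzWith.prod_snd
    have h2 := hl.comp h1
    rw [mul_one] at h2
    exact h2
  have hl2 : LipschitzWith L fun z : ℝ × ℝ => lineStieltjes μ η (max (-z.1) 0, z.2) := by
    have h1 : LipschitzWith 1 fun z : ℝ × ℝ => (max (-z.1) 0, z.2) := by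
      have := (LipschitzWith.prod_fst (α := ℝ) (β := ℝ)).neg.max_const 0
      simpa using this.prodMk LipschitzWith.prod_snd
    have h2 := hl.comp h1
    rw [mul_one] at h2
    exact h2
  have hl3 : LipschitzWith L fun z : ℝ × ℝ => lineStieltjes μ η (0, z.2) := by
    have h1 : LipschitzWith 1 fun z : ℝ × ℝ => ((0 : ℝ), z.2) := by
      have := (LipschitzWith.const (α := ℝ × ℝ) (0 : ℝ)).prodMk
        (LipschitzWith.prod_snd (α := ℝ) (β := ℝ))
      simpa using this
    have h2 := hl.comp h1
    rw [mul_one] at h2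
    exact h2
  have hp : LipschitzWith (Real.toNNReal Real.pi⁻¹ * (L + L + L)) (spaceRate μ η) := by
    have h := (hl1.sub hl2).add hl3
    refine LipschitzWith.of_dist_le_mul fun z w => ?_
    have h1 := h.dist_le_mul z w
    rw [dist_eq_norm] at h1
    rw [Real.dist_eq, spaceRate, spaceRate]
    rw [← neg_add', abs_neg, ← sub_eq_add_neg, ← mul_sub, abs_mul, ← Complex.sub_im,
      abs_of_pos (inv_pos.2 hpi), NNReal.coe_mul, Real.coe_toNNReal _ (inv_pos.2 hpi).le,
      mul_assoc]
    gcongr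
    exact (Complex.abs_im_le_norm _).trans h1
  have hpb : ∀ z, |spaceRate μ η z| ≤ Real.pi⁻¹ * (η⁻¹ + η⁻¹ + η⁻¹) := by
    intro z
    rw [spaceRate, abs_neg, abs_mul, abs_of_pos (inv_pos.2 hpi)]
    gcongr
    refine (Complex.abs_im_le_norm _).trans ((norm_add_le _ _).trans ?_)
    gcongr
    · refine (norm_sub_le _ _).trans ?_
      gcongr <;> exact norm_lineStieltjes_le hη _
    · exact norm_lineStieltjes_le hη _
  exact IsC11b.of_partials (C := 3) (hasDerivAt_smoothSolution_time hη)
    (hasDerivAt_smoothSolution_space hη) (abs_smoothSolution_le hη) hpb (abs_timeRate_le hη) hp hK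

/-- The regularized flow solves the primitive Dyson equation in the classical sense. -/
lemma smoothSolution_equation (hη : 0 < η) {t : ℝ} (ht : 0 ≤ t) (x : ℝ) :
    timeRate μ η (t, x) + spaceRate μ η (t, x) *
      halfLaplacianNear ∞ (fun y => smoothSolution μ η (t, y)) x = 0 := by
  have e : (fun y => smoothSolution μ η (t, y)) = smoothCDF (freeConv μ t) η := by
    ext y
    exact smoothSolution_of_nonneg ht y
  rw [e, halfLaplacianNear_smoothCDF hη, spaceRate_of_nonneg ht, timeRate, lineStieltjes,
    inversionDensity, abs_of_nonneg ht]
  ring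

end

/-! ### Calculus of test functions -/

section

variable {φ ψ : ℝ × ℝ → ℝ}

lemma IsC11b.hasDerivAt_time (h : IsC11b φ) (t x : ℝ) :
    HasDerivAt (fun s => φ (s, x)) (fderiv ℝ φ (t, x) (1, 0)) t :=
  (h.differentiable (t, x)).hasFDerivAt.comp_hasDerivAt t
    ((hasDerivAt_id t).prodMk (hasDerivAt_const t x))

lemma IsC11b.hasDerivAt_space (h : IsC11b φ) (t x : ℝ) :
    HasDerivAt (fun y => φ (t, y)) (fderiv ℝ φ (t, x) (0, 1)) x :=
  (h.differentiable (t, x)).hasFDerivAt.comp_hasDerivAt x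
    ((hasDerivAt_const x t).prodMk (hasDerivAt_id x))

lemma IsC11b.abs_deriv_space_le (h : IsC11b φ) :
    ∃ C : ℝ, ∀ t x, |deriv (fun y => φ (t, y)) x| ≤ C := by
  obtain ⟨C, hC⟩ := h.fderiv_bounded
  refine ⟨C, fun t x => ?_⟩
  rw [(h.hasDerivAt_space t x).deriv]
  have h1 := (fderiv ℝ φ (t, x)).le_opNorm (0, 1)
  have h2 : ‖((0 : ℝ), (1 : ℝ))‖ = 1 := by simp [Prod.norm_def]
  rw [h2, mul_one] at h1
  exact h1.trans (hC _)

lemma IsC11b.exists_secondDiffBound (h : IsC11b φ) :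
    ∃ K M : ℝ, ∀ t, SecondDiffBound (fun y => φ (t, y)) K M := by
  obtain ⟨M, hM⟩ := h.bounded
  obtain ⟨K, hK⟩ := h.fderiv_lipschitz
  refine ⟨2 * K, M, fun t => SecondDiffBound.of_hasDerivAt (f' := fun x => fderiv ℝ φ (t, x) (0, 1))
    (fun x => h.hasDerivAt_space t x) (LipschitzWith.of_dist_le_mul fun x y => ?_)
    (fun x => hM _)⟩
  have h1 := (fderiv ℝ φ (t, x) - fderiv ℝ φ (t, y)).le_opNorm (0, 1)
  have h2 : ‖((0 : ℝ), (1 : ℝ))‖ = 1 := by simp [Prod.norm_def]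
  have h3 := hK.dist_le_mul (t, x) (t, y)
  rw [h2, mul_one, sub_apply] at h1
  rw [dist_eq_norm] at h3
  have h4 : dist ((t, x) : ℝ × ℝ) (t, y) = dist x y := by simp [Prod.dist_eq]
  rw [h4] at h3
  rw [dist_eq_norm]
  exact h1.trans h3

lemma IsC11b.add (h : IsC11b φ) (h' : IsC11b ψ) : IsC11b fun z => φ z + ψ z := by
  obtain ⟨C, hC⟩ := h.bounded
  obtain ⟨C', hC'⟩ := h'.bounded
  obtain ⟨D, hD⟩ := h.fderiv_bounded
  obtain ⟨D', hD'⟩ := h'.fderiv_bounded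
  obtain ⟨K, hK⟩ := h.fderiv_lipschitz
  obtain ⟨K', hK'⟩ := h'.fderiv_lipschitz
  have e : fderiv ℝ (fun z => φ z + ψ z) = fun z => fderiv ℝ φ z + fderiv ℝ ψ z :=
    funext fun z => fderiv_fun_add (h.differentiable z) (h'.differentiable z)
  refine ⟨h.differentiable.add h'.differentiable,
    ⟨C + C', fun z => (abs_add_le _ _).trans (add_le_add (hC z) (hC' z))⟩,
    ⟨D + D', fun z => ?_⟩, ⟨K + K', ?_⟩⟩
  · rw [e]
    exact (norm_add_le _ _).trans (add_le_add (hD z) (hD' z))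
  · rw [e]
    exact hK.add hK'

lemma IsC11b.const_mul (h : IsC11b φ) (c : ℝ) : IsC11b fun z => c * φ z := by
  obtain ⟨C, hC⟩ := h.bounded
  obtain ⟨D, hD⟩ := h.fderiv_bounded
  obtain ⟨K, hK⟩ := h.fderiv_lipschitz
  have e : fderiv ℝ (fun z => c * φ z) = fun z => c • fderiv ℝ φ z :=
    funext fun z => fderiv_const_mul (h.differentiable z) c
  refine ⟨h.differentiable.const_mul c, ⟨|c| * C, fun z => ?_⟩, ⟨|c| * D, fun z => ?_⟩,
    ⟨‖c‖₊ * K, ?_⟩⟩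
  · rw [abs_mul]
    exact mul_le_mul_of_nonneg_left (hC z) (abs_nonneg c)
  · rw [e, norm_smul, Real.norm_eq_abs]
    exact mul_le_mul_of_nonneg_left (hD z) (abs_nonneg c)
  · rw [e]
    exact (lipschitzWith_smul c).comp hK

lemma IsC11b.neg (h : IsC11b φ) : IsC11b fun z => -φ z := by
  simpa using h.const_mul (-1)

lemma IsC11b.translate (h : IsC11b φ) (a : ℝ × ℝ) : IsC11b fun z => φ (z + a) := by
  obtain ⟨C, hC⟩ := h.bounded
  obtain ⟨D, hD⟩ := h.fderiv_bounded
  obtain ⟨K, hK⟩ := h.fderiv_lipschitz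
  have e : fderiv ℝ (fun z => φ (z + a)) = fun z => fderiv ℝ φ (z + a) :=
    funext fun z => fderiv_comp_add_right a
  refine ⟨h.differentiable.comp (differentiable_id.add_const a), ⟨C, fun z => hC _⟩,
    ⟨D, fun z => ?_⟩, ⟨K, ?_⟩⟩
  · rw [e]
    exact hD _
  · rw [e]
    refine LipschitzWith.of_dist_le_mul fun z w => ?_
    simpa using hK.dist_le_mul (z + a) (w + a)

/-- A test function depending on time plus one depending on space. -/
lemma isC11b_add_of_hasDerivAt {f f' g g' : ℝ → ℝ} {Cf Cf' Cg Cg' : ℝ} {Kf Kg : ℝ≥0}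
    (hf : ∀ t, HasDerivAt f (f' t) t) (hg : ∀ x, HasDerivAt g (g' x) x)
    (hfb : ∀ t, |f t| ≤ Cf) (hgb : ∀ x, |g x| ≤ Cg) (hfb' : ∀ t, |f' t| ≤ Cf')
    (hgb' : ∀ x, |g' x| ≤ Cg') (hfl : LipschitzWith Kf f') (hgl : LipschitzWith Kg g') :
    IsC11b fun z => f z.1 + g z.2 := by
  refine IsC11b.of_partials (q := fun z => f' z.1) (p := fun z => g' z.2) (C := Cf + Cg)
    (fun t x => (hf t).add_const (g x)) (fun t x => (hg x).const_add (f t))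
    (fun z => (abs_add_le _ _).trans (add_le_add (hfb _) (hgb _))) (fun z => hgb' _)
    (fun z => hfb' _) (hgl.comp LipschitzWith.prod_snd) (hfl.comp LipschitzWith.prod_fst)

end

/-- The penalty profile `x² / (1 + x²)`. -/
noncomputable def bump (x : ℝ) : ℝ := 1 - (1 + x ^ 2)⁻¹

lemma bump_nonneg (x : ℝ) : 0 ≤ bump x := by
  rw [bump, sub_nonneg]
  exact inv_le_one_of_one_le₀ (by nlinarith [sq_nonneg x])

lemma bump_le_one (x : ℝ) : bump x ≤ 1 := by
  rw [bump, sub_le_self_iff]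
  positivity

lemma abs_bump_le (x : ℝ) : |bump x| ≤ 1 := by
  rw [abs_of_nonneg (bump_nonneg x)]
  exact bump_le_one x

lemma bump_le_sq (x : ℝ) : bump x ≤ x ^ 2 := by
  rw [bump, sub_le_iff_le_add, ← sub_le_iff_le_add', ← one_div, le_div_iff₀ (by positivity)]
  nlinarith [sq_nonneg x, sq_nonneg (x ^ 2)]

lemma half_le_bump {x : ℝ} (hx : 1 ≤ |x|) : 1 / 2 ≤ bump x := by
  have h : 1 ≤ x ^ 2 := by
    rw [← sq_abs]
    nlinarith
  rw [bump, le_sub_comm]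
  calc (1 + x ^ 2)⁻¹ ≤ (1 + 1)⁻¹ := by gcongr
    _ = _ := by norm_num

/-- The derivative of `bump`. -/
noncomputable def bumpDeriv (x : ℝ) : ℝ := 2 * x / (1 + x ^ 2) ^ 2

lemma hasDerivAt_bump (x : ℝ) : HasDerivAt bump (bumpDeriv x) x := by
  have h := (((hasDerivAt_pow 2 x).const_add 1).fun_inv (by positivity)).const_sub 1
  refine h.congr_deriv ?_
  simp only [bumpDeriv]
  norm_num
  ring

lemma abs_bumpDeriv_le (x : ℝ) : |bumpDeriv x| ≤ 1 := by
  rw [bumpDeriv, abs_div, abs_of_pos (show (0 : ℝ) < (1 + x ^ 2) ^ 2 by positivity),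
    div_le_one (by positivity), abs_le]
  constructor <;> nlinarith [sq_nonneg (x - 1), sq_nonneg (x + 1), sq_nonneg x, sq_nonneg (x ^ 2)]

lemma lipschitzWith_bumpDeriv : LipschitzWith 6 bumpDeriv := by
  have hd : ∀ x, HasDerivAt bumpDeriv ((2 - 6 * x ^ 2) / (1 + x ^ 2) ^ 3) x := by
    intro x
    have h0 : (0 : ℝ) < 1 + x ^ 2 := by positivity
    have h := ((hasDerivAt_id' x).const_mul 2).fun_div
      (((hasDerivAt_pow 2 x).const_add 1).fun_pow 2) (by positivity)
    refine h.congr_deriv ?_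
    field_simp
    ring
  refine lipschitzWith_of_nnnorm_deriv_le (fun x => (hd x).differentiableAt) fun x => ?_
  rw [(hd x).deriv, ← NNReal.coe_le_coe, coe_nnnorm, Real.norm_eq_abs, abs_div,
    abs_of_pos (show (0 : ℝ) < (1 + x ^ 2) ^ 3 by positivity), div_le_iff₀ (by positivity), abs_le]
  push_cast
  constructor <;> nlinarith [sq_nonneg x, sq_nonneg (x ^ 2), sq_nonneg (x ^ 3),
    mul_nonneg (sq_nonneg x) (sq_nonneg (x ^ 2))]

section

variable {lam R : ℝ}

lemma hasDerivAt_bump_scaled (lam R a x : ℝ) :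
    HasDerivAt (fun x => lam * bump ((x - a) / R)) (lam * (bumpDeriv ((x - a) / R) / R)) x := by
  have h := (hasDerivAt_bump ((x - a) / R)).comp x (((hasDerivAt_id' x).sub_const a).div_const R)
  refine (h.const_mul lam).congr_deriv ?_
  ring

lemma abs_bump_scaled_le (hl : 0 ≤ lam) (R a x : ℝ) : |lam * bump ((x - a) / R)| ≤ lam := by
  rw [abs_mul, abs_of_nonneg hl]
  exact mul_le_of_le_one_right hl (abs_bump_le _)

lemma abs_bumpDeriv_scaled_le (hl : 0 ≤ lam) (hR : 0 < R) (a x : ℝ) :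
    |lam * (bumpDeriv ((x - a) / R) / R)| ≤ lam / R := by
  rw [abs_mul, abs_of_nonneg hl, abs_div, abs_of_pos hR, ← mul_div_assoc]
  gcongr
  exact mul_le_of_le_one_right hl (abs_bumpDeriv_le _)

lemma lipschitzWith_bumpDeriv_scaled (hl : 0 ≤ lam) (hR : 0 < R) (a : ℝ) :
    LipschitzWith (Real.toNNReal (6 * lam / R ^ 2))
      fun x => lam * (bumpDeriv ((x - a) / R) / R) := by
  refine LipschitzWith.of_dist_le_mul fun x y => ?_
  rw [Real.coe_toNNReal _ (by positivity), Real.dist_eq, ← mul_sub, ← sub_div, abs_mul, abs_div,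
    abs_of_nonneg hl, abs_of_pos hR]
  have h := lipschitzWith_bumpDeriv.dist_le_mul ((x - a) / R) ((y - a) / R)
  rw [Real.dist_eq, Real.dist_eq, ← sub_div, abs_div, abs_of_pos hR, sub_sub_sub_cancel_right] at h
  rw [Real.dist_eq]
  push_cast at h
  calc _ ≤ lam * (6 * (|x - y| / R) / R) := by gcongr
    _ = _ := by field_simp

lemma secondDiffBound_bump_scaled (hl : 0 ≤ lam) (hR : 0 < R) (a : ℝ) :
    SecondDiffBound (fun x => lam * bump ((x - a) / R)) (12 * lam / R ^ 2) lam := by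
  have h := SecondDiffBound.of_hasDerivAt (hasDerivAt_bump_scaled lam R a)
    (lipschitzWith_bumpDeriv_scaled hl hR a) (abs_bump_scaled_le hl R a)
  rw [Real.coe_toNNReal _ (by positivity)] at h
  convert h using 1
  ring

lemma abs_halfLaplacianNear_bump_scaled_le (hl : 0 ≤ lam) (hR : 0 < R) (a : ℝ) (δ : ℝ≥0∞)
    (x : ℝ) : |halfLaplacianNear δ (fun x => lam * bump ((x - a) / R)) x| ≤ 16 * lam / R := by
  refine ((secondDiffBound_bump_scaled hl hR a).abs_halfLaplacianNear_le hR δ x).trans_eq ?_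
  field_simp
  ring

end

lemma SecondDiffBound.halfLaplacianNear_add {f g : ℝ → ℝ} {K M K' M' : ℝ}
    (hf : SecondDiffBound f K M) (hg : SecondDiffBound g K' M') (c : ℝ) (δ : ℝ≥0∞) (x : ℝ) :
    halfLaplacianNear δ (fun y => f y + (c + g y)) x
      = halfLaplacianNear δ f x + halfLaplacianNear δ g x := by
  simp only [halfLaplacianNear]
  rw [← integral_add ((hf.integrableOn x).mono_set fun z hz => hz.1)
    ((hg.integrableOn x).mono_set fun z hz => hz.1)]
  refine integral_congr_ae (Eventually.of_forall fun z => ?_)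
  simp only
  ring

lemma halfLaplacianNear_const_mul (c : ℝ) (f : ℝ → ℝ) (δ : ℝ≥0∞) (x : ℝ) :
    halfLaplacianNear δ (fun y => c * f y) x = c * halfLaplacianNear δ f x := by
  simp only [halfLaplacianNear]
  rw [← integral_const_mul]
  refine integral_congr_ae (Eventually.of_forall fun z => ?_)
  simp only
  ring

lemma halfLaplacianNear_neg (f : ℝ → ℝ) (δ : ℝ≥0∞) (x : ℝ) :
    halfLaplacianNear δ (fun y => -f y) x = -halfLaplacianNear δ f x := by
  simpa using halfLaplacianNear_const_mul (-1) f δ x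

lemma halfLaplacianFar_const_mul (c : ℝ) (f : ℝ → ℝ) (δ : ℝ≥0∞) (x : ℝ) :
    halfLaplacianFar δ (fun y => c * f y) x = c * halfLaplacianFar δ f x := by
  simp only [halfLaplacianFar]
  rw [← integral_const_mul]
  refine integral_congr_ae (Eventually.of_forall fun z => ?_)
  simp only
  ring

lemma halfLaplacianFar_top (u : ℝ → ℝ) (x : ℝ) : halfLaplacianFar ∞ u x = 0 := by
  have : {y : ℝ | ∞ ≤ edist x y} = ∅ := by
    ext y
    simp [edist_ne_top]
  rw [halfLaplacianFar, this, setIntegral_empty]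

/-! ### Comparison with classical solutions -/

/-- The viscosity sub-solution inequality for `∂ₜu + σ ∂ₓu A₀[u] = 0` with all of the half-Laplacian
falling on the test function. For `σ = -1` it is the inequality satisfied by the opposite of a
super-solution of the equation with `σ = 1`. -/
def HasSubTest (σ : ℝ) (U : ℝ≥0 × ℝ → ℝ) : Prop :=
  ∀ (T : ℝ≥0) (φ : ℝ × ℝ → ℝ) (t₀ : ℝ≥0) (x₀ : ℝ), IsC11b φ → 0 < t₀ → t₀ ≤ T →
    IsMaxOn (fun z : ℝ≥0 × ℝ => U z - φ ((z.1 : ℝ), z.2)) {z | z.1 ≤ T} (t₀, x₀) →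
    deriv (fun s : ℝ => φ (s, x₀)) (t₀ : ℝ)
      + σ * (deriv (fun y : ℝ => φ ((t₀ : ℝ), y)) x₀
        * halfLaplacianNear ∞ (fun y => φ ((t₀ : ℝ), y)) x₀) ≤ 0

lemma IsViscositySubsolution.hasSubTest {U : ℝ≥0 × ℝ → ℝ} (h : IsViscositySubsolution U) :
    HasSubTest 1 U := by
  intro T φ t₀ x₀ hφ h0 hT hmax
  have := h.2 T φ ∞ t₀ x₀ hφ (by simp) h0 hT hmax
  rwa [viscosityOperator, halfLaplacianFar_top, add_zero, ← one_mul (deriv _ x₀ * _)] at this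

lemma IsViscositySupersolution.hasSubTest_neg {U : ℝ≥0 × ℝ → ℝ}
    (h : IsViscositySupersolution U) : HasSubTest (-1) fun z => -U z := by
  intro T φ t₀ x₀ hφ h0 hT hmax
  have hmin : IsMinOn (fun z : ℝ≥0 × ℝ => U z - -φ ((z.1 : ℝ), z.2)) {z | z.1 ≤ T} (t₀, x₀) := by
    intro z hz
    have := hmax hz
    simp only [Set.mem_ofPred_eq] at this ⊢
    linarith
  have := h.2 T (fun z => -φ z) ∞ t₀ x₀ hφ.neg (by simp) h0 hT hmin
  rw [viscosityOperator, halfLaplacianFar_top, add_zero, halfLaplacianNear_neg, deriv.fun_neg,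
    deriv.fun_neg] at this
  linarith

/-- The penalization of the comparison argument: an admissible error `e`, a term increasing in time
up to the time `T`, and a term confining to `|x| ≤ R`. -/
noncomputable def penalty (κ e T lam R : ℝ) (z : ℝ × ℝ) : ℝ :=
  (e + κ * Real.sin (z.1 / T)) + lam * bump ((z.2 - 0) / R)

section

variable {κ e T lam R : ℝ}

lemma hasDerivAt_penalty_time (κ e T lam R t x : ℝ) :
    HasDerivAt (fun s => penalty κ e T lam R (s, x)) (κ * (Real.cos (t / T) / T)) t := by
  have h := (((Real.hasDerivAt_sin (t / T)).comp t ((hasDerivAt_id' t).div_const T)).const_mul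
    κ).const_add e
  refine (h.add_const (lam * bump ((x - 0) / R))).congr_deriv ?_
  ring

lemma isC11b_penalty (hκ : 0 ≤ κ) (hT : 0 < T) (hl : 0 ≤ lam) (hR : 0 < R) :
    IsC11b (penalty κ e T lam R) := by
  refine isC11b_add_of_hasDerivAt (f := fun t => e + κ * Real.sin (t / T))
    (f' := fun t => κ * (Real.cos (t / T) / T)) (Cf := |e| + κ) (Cf' := κ / T)
    (Kf := Real.toNNReal (κ / T ^ 2)) (fun t => ?_) (hasDerivAt_bump_scaled lam R 0)
    (fun t => ?_) (abs_bump_scaled_le hl R 0) (fun t => ?_) (abs_bumpDeriv_scaled_le hl hR 0)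
    (LipschitzWith.of_dist_le_mul fun s t => ?_) (lipschitzWith_bumpDeriv_scaled hl hR 0)
  · have h := (((Real.hasDerivAt_sin (t / T)).comp t ((hasDerivAt_id' t).div_const T)).const_mul
      κ).const_add e
    refine h.congr_deriv ?_
    ring
  · refine (abs_add_le _ _).trans (add_le_add_right ?_ _)
    rw [abs_mul, abs_of_nonneg hκ]
    exact mul_le_of_le_one_right hκ (Real.abs_sin_le_one _)
  · rw [abs_mul, abs_of_nonneg hκ, abs_div, abs_of_pos hT, ← mul_div_assoc]
    gcongr
    exact mul_le_of_le_one_right hκ (Real.abs_cos_le_one _)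
  · rw [Real.coe_toNNReal _ (by positivity), Real.dist_eq, ← mul_sub, ← sub_div, abs_mul, abs_div,
      abs_of_nonneg hκ, abs_of_pos hT, Real.dist_eq]
    have h := Real.abs_cos_sub_cos_le (s / T) (t / T)
    rw [← sub_div, abs_div, abs_of_pos hT] at h
    calc _ ≤ κ * (|s - t| / T / T) := by gcongr
      _ = _ := by field_simp

end

/-- If the penalized difference is positive at one point of the final time, it has a maximum point
at a positive time. There the equation of `w` and the inequality of `U` bound the time slope of the
penalization by the contribution of its confining part, which is of order `1 / R`. The height `4 M`
of the confining part makes it exceed `U - w ≤ 2 M` for `|x| ≥ R`. -/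
lemma penalization_estimate {σ M P N κ e R : ℝ} {T : ℝ≥0} {x₁ : ℝ} {U : ℝ≥0 × ℝ → ℝ}
    {w : ℝ × ℝ → ℝ} (hσ : |σ| ≤ 1) (hUsc : UpperSemicontinuous U) (hUM : ∀ z, U z ≤ M)
    (hU : HasSubTest σ U) (hw : IsC11b w) (hwM : ∀ z, -M ≤ w z)
    (hwP : ∀ t x, |deriv (fun y => w (t, y)) x| ≤ P)
    (hwN : ∀ t x, |halfLaplacianNear ∞ (fun y => w (t, y)) x| ≤ N)
    (heq : ∀ t x, 0 < t → deriv (fun s => w (s, x)) t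
      + σ * (deriv (fun y => w (t, y)) x * halfLaplacianNear ∞ (fun y => w (t, y)) x) = 0)
    (he : 0 ≤ e) (h0 : ∀ x, U (0, x) ≤ w (0, x) + e) (hκ : 0 ≤ κ) (hM : 0 ≤ M) (hR : 1 ≤ R)
    (hx₁ : |x₁| ≤ R)
    (hpos : 0 < U (T, x₁) - (w (T, x₁) + penalty κ e (T + 1) (4 * M) R (T, x₁))) :
    κ * (Real.cos 1 / (T + 1)) ≤ (P * (64 * M) + 4 * M * (N + 64 * M)) / R := by
  have hR0 : 0 < R := one_pos.trans_le hR
  have hT1 : (0 : ℝ) < T + 1 := by positivity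
  set pen := penalty κ e (T + 1) (4 * M) R with hpen
  have hpenC := isC11b_penalty (e := e) hκ hT1 (show 0 ≤ 4 * M by positivity) hR0
  set φ : ℝ × ℝ → ℝ := fun z => w z + pen z with hφ
  have hφC : IsC11b φ := hw.add hpenC
  set f : ℝ≥0 × ℝ → ℝ := fun z => U z - φ ((z.1 : ℝ), z.2) with hf
  have hsin : ∀ t : ℝ≥0, t ≤ T → 0 ≤ Real.sin (t / (T + 1)) ∧ (t : ℝ) / (T + 1) ≤ 1 := by
    intro t ht
    have h1 : (t : ℝ) ≤ T := ht
    have h2 : (t : ℝ) / (T + 1) ≤ 1 := by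
      rw [div_le_one hT1]
      linarith
    refine ⟨Real.sin_nonneg_of_nonneg_of_le_pi (by positivity) ?_, h2⟩
    linarith [Real.pi_gt_three]
  -- Outside `|x| ≤ R`, and at time `0`, the penalized difference is not positive.
  have hout : ∀ z : ℝ≥0 × ℝ, z.1 ≤ T → R ≤ |z.2| → f z ≤ 0 := by
    intro z hz hz2
    have h1 := hUM z
    have h2 := hwM ((z.1 : ℝ), z.2)
    have h3 := mul_nonneg hκ (hsin z.1 hz).1
    have h4 : 1 / 2 ≤ bump ((z.2 - 0) / R) := by
      refine half_le_bump ?_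
      rw [sub_zero, abs_div, abs_of_pos hR0, le_div_iff₀ hR0, one_mul]
      exact hz2
    have h5 : 4 * M * (1 / 2) ≤ 4 * M * bump ((z.2 - 0) / R) := by gcongr
    simp only [hf, hφ, hpen, penalty]
    linarith
  have hzero : ∀ x : ℝ, f (0, x) ≤ 0 := by
    intro x
    have h1 := h0 x
    have h2 : 0 ≤ 4 * M * bump ((x - 0) / R) := mul_nonneg (by positivity) (bump_nonneg _)
    simp only [hf, hφ, hpen, penalty, NNReal.coe_zero, zero_div, Real.sin_zero, mul_zero]
    linarith
  have hφcont : Continuous fun z : ℝ≥0 × ℝ => φ ((z.1 : ℝ), z.2) :=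
    hφC.differentiable.continuous.comp (by fun_prop)
  have hfsc : UpperSemicontinuous f := by
    simp only [hf, sub_eq_add_neg]
    exact hUsc.add hφcont.neg.upperSemicontinuous
  have hK : IsCompact (Set.Icc (0 : ℝ≥0) T ×ˢ Set.Icc (-R) R) := isCompact_Icc.prod isCompact_Icc
  have hmem : (T, x₁) ∈ Set.Icc (0 : ℝ≥0) T ×ˢ Set.Icc (-R) R :=
    ⟨⟨zero_le, le_rfl⟩, abs_le.1 hx₁⟩
  obtain ⟨⟨t₀, x₀⟩, hz₀, hmax⟩ := (hfsc.upperSemicontinuousOn _).exists_isMaxOn ⟨_, hmem⟩ hK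
  have hfpos : 0 < f (t₀, x₀) := lt_of_lt_of_le hpos (hmax hmem)
  have ht₀ : 0 < t₀ := by
    rcases eq_or_ne t₀ 0 with h | h
    · rw [h] at hfpos
      exact absurd hfpos (not_lt.2 (hzero x₀))
    · exact pos_iff_ne_zero.2 h
  have hglob : IsMaxOn f {z | z.1 ≤ T} (t₀, x₀) := by
    intro z hz
    rcases le_or_gt |z.2| R with h | h
    · exact hmax ⟨⟨zero_le, hz⟩, abs_le.1 h⟩
    · exact (hout z hz h.le).trans hfpos.le
  have hvis := hU T φ t₀ x₀ hφC ht₀ hz₀.1.2 hglob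
  have d1 : deriv (fun s : ℝ => φ (s, x₀)) (t₀ : ℝ) = deriv (fun s : ℝ => w (s, x₀)) (t₀ : ℝ)
      + κ * (Real.cos (t₀ / (T + 1)) / (T + 1)) :=
    ((hw.hasDerivAt_time t₀ x₀).differentiableAt.hasDerivAt.add
      (hasDerivAt_penalty_time κ e (T + 1) (4 * M) R t₀ x₀)).deriv
  have d2 : deriv (fun y : ℝ => φ ((t₀ : ℝ), y)) x₀ = deriv (fun y : ℝ => w ((t₀ : ℝ), y)) x₀
      + 4 * M * (bumpDeriv ((x₀ - 0) / R) / R) :=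
    ((hw.hasDerivAt_space t₀ x₀).differentiableAt.hasDerivAt.add
      ((hasDerivAt_bump_scaled (4 * M) R 0 x₀).const_add
        (e + κ * Real.sin (t₀ / (T + 1))))).deriv
  obtain ⟨K₁, M₁, hw2⟩ := hw.exists_secondDiffBound
  have d3 := (hw2 t₀).halfLaplacianNear_add
    (secondDiffBound_bump_scaled (show 0 ≤ 4 * M by positivity) hR0 0)
    (e + κ * Real.sin (t₀ / (T + 1))) ∞ x₀
  have d3' : halfLaplacianNear ∞ (fun y => φ ((t₀ : ℝ), y)) x₀
      = halfLaplacianNear ∞ (fun y => w ((t₀ : ℝ), y)) x₀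
        + halfLaplacianNear ∞ (fun x => 4 * M * bump ((x - 0) / R)) x₀ := d3
  rw [d1, d2, d3'] at hvis
  have hb1 := abs_bumpDeriv_scaled_le (show 0 ≤ 4 * M by positivity) hR0 0 x₀
  have hb2 := abs_halfLaplacianNear_bump_scaled_le (show 0 ≤ 4 * M by positivity) hR0 0 ∞ x₀
  have hE := heq t₀ x₀ (by exact_mod_cast ht₀)
  have hP := hwP t₀ x₀
  have hN := hwN t₀ x₀
  set q := deriv (fun s : ℝ => w (s, x₀)) (t₀ : ℝ)
  set p := deriv (fun y : ℝ => w ((t₀ : ℝ), y)) x₀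
  set n := halfLaplacianNear ∞ (fun y => w ((t₀ : ℝ), y)) x₀
  set a := 4 * M * (bumpDeriv ((x₀ - 0) / R) / R)
  set b := halfLaplacianNear ∞ (fun x => 4 * M * bump ((x - 0) / R)) x₀
  have hcos : Real.cos 1 ≤ Real.cos (t₀ / (T + 1)) :=
    Real.cos_le_cos_of_nonneg_of_le_pi (by positivity) (by linarith [Real.pi_gt_three])
      (hsin t₀ hz₀.1.2).2
  have hb3 : |b| ≤ 64 * M := by
    refine hb2.trans ?_
    rw [div_le_iff₀ hR0]
    nlinarith
  have hrem : |σ * (p * b + a * (n + b))| ≤ P * (16 * (4 * M) / R)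
      + 4 * M / R * (N + 64 * M) := by
    rw [abs_mul]
    refine (mul_le_of_le_one_left (abs_nonneg _) hσ).trans ((abs_add_le _ _).trans ?_)
    rw [abs_mul, abs_mul]
    have hP0 := (abs_nonneg _).trans hP
    have hN0 := (abs_nonneg _).trans hN
    gcongr
    exact (abs_add_le _ _).trans (add_le_add hN hb3)
  have h1 := (abs_le.1 hrem).1
  calc κ * (Real.cos 1 / (T + 1)) ≤ κ * (Real.cos (t₀ / (T + 1)) / (T + 1)) := by gcongr
    _ ≤ P * (16 * (4 * M) / R) + 4 * M / R * (N + 64 * M) := by nlinarith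
    _ = _ := by ring

/-- Comparison principle between a viscosity sub-solution and a classical solution. -/
theorem HasSubTest.le_add {σ e : ℝ} {U : ℝ≥0 × ℝ → ℝ} {w : ℝ × ℝ → ℝ} (hU : HasSubTest σ U)
    (hσ : |σ| ≤ 1) (hUsc : UpperSemicontinuous U) {M : ℝ} (hUM : ∀ z, U z ≤ M) (hw : IsC11b w)
    (heq : ∀ t x, 0 < t → deriv (fun s => w (s, x)) t
      + σ * (deriv (fun y => w (t, y)) x * halfLaplacianNear ∞ (fun y => w (t, y)) x) = 0)
    (he : 0 ≤ e) (h0 : ∀ x, U (0, x) ≤ w (0, x) + e) (t : ℝ≥0) (x : ℝ) :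
    U (t, x) ≤ w (t, x) + e := by
  by_contra! hlt
  obtain ⟨P, hP⟩ := hw.abs_deriv_space_le
  obtain ⟨K, Mw, hS⟩ := hw.exists_secondDiffBound
  obtain ⟨Cw, hCw⟩ := hw.bounded
  set A := max |M| |Cw| with hA
  have hA0 : 0 ≤ A := (abs_nonneg M).trans (le_max_left _ _)
  have hUA : ∀ z, U z ≤ A := fun z => (hUM z).trans ((le_abs_self M).trans (le_max_left _ _))
  have hwA : ∀ z, -A ≤ w z := fun z => by
    have h1 := (abs_le.1 (hCw z)).1
    have h2 : Cw ≤ A := (le_abs_self Cw).trans (le_max_right _ _)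
    linarith
  -- With `κ = d / 4` and `R` large the penalization costs, besides `e`, at most `d / 2` at
  -- the point `(t, x)`.
  set d := U (t, x) - (w (t, x) + e) with hd
  have hd0 : 0 < d := sub_pos.2 hlt
  have hN : ∀ s y, |halfLaplacianNear ∞ (fun y => w (s, y)) y| ≤ K * 1 + 4 * Mw / 1 :=
    fun s y => (hS s).abs_halfLaplacianNear_le one_pos ∞ y
  set N := K * 1 + 4 * Mw / 1
  have hlim : Tendsto (fun R : ℝ => 4 * A * (x / R) ^ 2) atTop (𝓝 0) := by
    have h := ((tendsto_const_nhds (x := x)).div_atTop tendsto_id).pow 2 |>.const_mul (4 * A)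
    simpa using h
  have hlim2 : Tendsto (fun R : ℝ => (P * (64 * A) + 4 * A * (N + 64 * A)) / R) atTop (𝓝 0) :=
    tendsto_const_nhds.div_atTop tendsto_id
  have hkey : ∀ᶠ R : ℝ in atTop, d / 4 * (Real.cos 1 / (t + 1))
      ≤ (P * (64 * A) + 4 * A * (N + 64 * A)) / R := by
    filter_upwards [eventually_ge_atTop 1, eventually_ge_atTop |x|,
      hlim.eventually (gt_mem_nhds (show 0 < d / 4 by positivity))] with R hR hxR hsm
    refine penalization_estimate (e := e) (x₁ := x) hσ hUsc hUA hU hw hwA hP hN heq he h0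
      (by positivity) hA0 hR hxR ?_
    have h1 : 4 * A * bump ((x - 0) / R) ≤ 4 * A * (x / R) ^ 2 := by
      rw [sub_zero]
      exact mul_le_mul_of_nonneg_left (bump_le_sq _) (by positivity)
    have h2 : d / 4 * Real.sin ((t : ℝ) / (t + 1)) ≤ d / 4 :=
      mul_le_of_le_one_right (by positivity) (Real.sin_le_one _)
    simp only [penalty]
    have h3 : U (t, x) = d + (w (t, x) + e) := by rw [hd]; ring
    rw [h3]
    linarith
  have := ge_of_tendsto hlim2 hkey
  have hc := Real.cos_one_pos
  have : 0 < d / 4 * (Real.cos 1 / (t + 1)) := by positivity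
  linarith

/-! ### Uniqueness -/

section

variable {u : ℝ≥0 × ℝ → ℝ}

lemma isBoundedUnder_le_of_le_one (h1 : ∀ z, u z ≤ 1) (l : Filter (ℝ≥0 × ℝ)) :
    IsBoundedUnder (· ≤ ·) l u :=
  isBoundedUnder_of ⟨1, h1⟩

lemma isBoundedUnder_ge_of_nonneg (h0 : ∀ z, 0 ≤ u z) (l : Filter (ℝ≥0 × ℝ)) :
    IsBoundedUnder (· ≥ ·) l u :=
  isBoundedUnder_of ⟨0, h0⟩

lemma le_upperEnvelope (h1 : ∀ z, u z ≤ 1) (z : ℝ≥0 × ℝ) : u z ≤ upperEnvelope u z :=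
  le_limsup_of_frequently_le (fun h => h.self_of_nhds le_rfl) (isBoundedUnder_le_of_le_one h1 _)

lemma upperEnvelope_le_of_eventually (h0 : ∀ z, 0 ≤ u z) {z : ℝ≥0 × ℝ} {c : ℝ}
    (h : ∀ᶠ w in 𝓝 z, u w ≤ c) : upperEnvelope u z ≤ c :=
  limsup_le_of_le (isBoundedUnder_ge_of_nonneg h0 _).isCoboundedUnder_le h

lemma lowerEnvelope_le (h0 : ∀ z, 0 ≤ u z) (z : ℝ≥0 × ℝ) : lowerEnvelope u z ≤ u z :=
  liminf_le_of_frequently_le (fun h => h.self_of_nhds le_rfl) (isBoundedUnder_ge_of_nonneg h0 _)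

lemma le_lowerEnvelope_of_eventually (h1 : ∀ z, u z ≤ 1) {z : ℝ≥0 × ℝ} {c : ℝ}
    (h : ∀ᶠ w in 𝓝 z, c ≤ u w) : c ≤ lowerEnvelope u z :=
  le_liminf_of_le (isBoundedUnder_le_of_le_one h1 _).isCoboundedUnder_ge h

lemma upperEnvelope_le_one (h0 : ∀ z, 0 ≤ u z) (h1 : ∀ z, u z ≤ 1) (z : ℝ≥0 × ℝ) :
    upperEnvelope u z ≤ 1 :=
  upperEnvelope_le_of_eventually h0 (Eventually.of_forall h1)

lemma lowerEnvelope_nonneg (h0 : ∀ z, 0 ≤ u z) (h1 : ∀ z, u z ≤ 1) (z : ℝ≥0 × ℝ) :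
    0 ≤ lowerEnvelope u z :=
  le_lowerEnvelope_of_eventually h1 (Eventually.of_forall h0)

end

lemma primitive_nonneg (m : ℝ≥0 → ProbabilityMeasure ℝ) (z : ℝ≥0 × ℝ) : 0 ≤ primitive m z :=
  measureReal_nonneg

lemma primitive_le_one (m : ℝ≥0 → ProbabilityMeasure ℝ) (z : ℝ≥0 × ℝ) : primitive m z ≤ 1 :=
  measureReal_le_one

/-- Upper semicontinuity of the mass of a closed set under weak convergence. -/
lemma eventually_measureReal_le_of_isClosed {m : ℝ≥0 → ProbabilityMeasure ℝ}
    {m₀ : ProbabilityMeasure ℝ} (h : Tendsto m (𝓝 0) (𝓝 m₀)) {F : Set ℝ} (hF : IsClosed F) {e : ℝ}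
    (he : 0 < e) : ∀ᶠ t in 𝓝 0, (m t : Measure ℝ).real F ≤ (m₀ : Measure ℝ).real F + e := by
  have h1 := ProbabilityMeasure.limsup_measure_closed_le_of_tendsto h hF
  have h2 : limsup (fun t => (m t : Measure ℝ) F) (𝓝 0)
      < (m₀ : Measure ℝ) F + ENNReal.ofReal e :=
    h1.trans_lt (ENNReal.lt_add_right (measure_ne_top _ _) (by simpa using he))
  filter_upwards [eventually_lt_of_limsup_lt h2] with t ht
  have h3 := ENNReal.toReal_mono (by finiteness) ht.le
  rwa [ENNReal.toReal_add (measure_ne_top _ _) ENNReal.ofReal_ne_top,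
    ENNReal.toReal_ofReal he.le] at h3

lemma upperEnvelope_primitive_zero_le {m : ℝ≥0 → ProbabilityMeasure ℝ}
    {m₀ : ProbabilityMeasure ℝ} (h : Tendsto m (𝓝 0) (𝓝 m₀)) {ε e : ℝ} (hε : 0 < ε) (he : 0 < e)
    (x : ℝ) :
    upperEnvelope (primitive m) (0, x) ≤ (m₀ : Measure ℝ).real (Set.Iic (x + ε)) + e := by
  refine upperEnvelope_le_of_eventually (primitive_nonneg m) ?_
  have h1 : ∀ᶠ z : ℝ≥0 × ℝ in 𝓝 (0, x), z.2 < x + ε :=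
    continuousAt_snd.eventually (gt_mem_nhds (by simpa using hε))
  filter_upwards [h1, continuousAt_fst.eventually
    (eventually_measureReal_le_of_isClosed h (isClosed_Iic (a := x + ε)) he)] with z hz1 hz2
  exact (measureReal_mono (Set.Iic_subset_Iic.2 hz1.le)).trans hz2

lemma le_lowerEnvelope_primitive_zero {m : ℝ≥0 → ProbabilityMeasure ℝ}
    {m₀ : ProbabilityMeasure ℝ} (h : Tendsto m (𝓝 0) (𝓝 m₀)) {ε e : ℝ} (hε : 0 < ε) (he : 0 < e)
    (x : ℝ) :
    (m₀ : Measure ℝ).real (Set.Iic (x - ε)) - e ≤ lowerEnvelope (primitive m) (0, x) := by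
  refine le_lowerEnvelope_of_eventually (primitive_le_one m) ?_
  have h1 : ∀ᶠ z : ℝ≥0 × ℝ in 𝓝 (0, x), x - ε / 2 < z.2 :=
    continuousAt_snd.eventually (lt_mem_nhds (by simpa using hε))
  filter_upwards [h1, continuousAt_fst.eventually
    (eventually_measureReal_le_of_isClosed h (isClosed_Ici (a := x - ε / 2)) he)] with z hz1 hz2
  rw [← Set.compl_Iio, probReal_compl_eq_one_sub measurableSet_Iio,
    probReal_compl_eq_one_sub measurableSet_Iio] at hz2
  have h2 : (m₀ : Measure ℝ).real (Set.Iic (x - ε))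
      ≤ (m₀ : Measure ℝ).real (Set.Iio (x - ε / 2)) :=
    measureReal_mono (Set.Iic_subset_Iio.2 (by linarith))
  have h3 : (m z.1 : Measure ℝ).real (Set.Iio (x - ε / 2)) ≤ primitive m z :=
    measureReal_mono fun y hy => (Set.mem_Iio.1 hy).le.trans hz1.le
  linarith

section

variable {μ : Measure ℝ} [IsProbabilityMeasure μ] {η : ℝ}

lemma smoothSolution_translate_equation (hη : 0 < η) (a : ℝ) {t : ℝ} (ht : 0 ≤ t) (x : ℝ) :
    deriv (fun s => smoothSolution μ η ((s, x) + (0, a))) t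
      + deriv (fun y => smoothSolution μ η ((t, y) + (0, a))) x
        * halfLaplacianNear ∞ (fun y => smoothSolution μ η ((t, y) + (0, a))) x = 0 := by
  simp only [Prod.mk_add_mk, add_zero]
  have h1 := (hasDerivAt_smoothSolution_time (μ := μ) hη t (x + a)).deriv
  have h2 := (hasDerivAt_smoothSolution_space (μ := μ) hη t (x + a)).deriv
  have h3 := smoothSolution_equation (μ := μ) hη ht (x + a)
  rw [h1, deriv_comp_add_const (fun y => smoothSolution μ η (t, y)) a x, h2]
  convert h3 using 3
  simp only [halfLaplacianNear]
  refine integral_congr_ae (Eventually.of_forall fun z => ?_)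
  simp only
  rw [add_right_comm, sub_add_eq_add_sub]

end

/-- The primitive of any solution lies, up to arbitrarily small translations, below that of the
free convolution flow. -/
lemma IsSolution.primitive_le {m₀ : ProbabilityMeasure ℝ} {m : ℝ≥0 → ProbabilityMeasure ℝ}
    (h : IsSolution m₀ m) (t : ℝ≥0) (x : ℝ) {ε : ℝ} (hε : 0 < ε) :
    primitive m (t, x) ≤ (freeConv (m₀ : Measure ℝ) t).real (Set.Iic (x + 3 * ε)) := by
  have h0 := primitive_nonneg m
  have h1 := primitive_le_one m
  have hc : Tendsto m (𝓝 0) (𝓝 m₀) := by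
    have := h.continuousAt_zero.tendsto
    rwa [h.initial] at this
  have hlim : Tendsto (fun η => (freeConv (m₀ : Measure ℝ) t).real (Set.Iic (x + 3 * ε))
      + (2 * cauchyCDF η (-ε) + η)) (𝓝[>] 0)
      (𝓝 ((freeConv (m₀ : Measure ℝ) t).real (Set.Iic (x + 3 * ε)))) := by
    have := (((tendsto_cauchyCDF_neg hε).const_mul 2).add
      ((tendsto_id (α := ℝ)).mono_left nhdsWithin_le_nhds)).const_add
      ((freeConv (m₀ : Measure ℝ) t).real (Set.Iic (x + 3 * ε)))
    simpa using this
  refine ge_of_tendsto hlim ?_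
  filter_upwards [self_mem_nhdsWithin] with η hη
  have hη : 0 < η := hη
  have hcmp := (h.viscosity.sub.hasSubTest).le_add (e := cauchyCDF η (-ε) + η) (by simp)
    h.viscosity.sub.1 (upperEnvelope_le_one h0 h1)
    ((isC11b_smoothSolution (μ := (m₀ : Measure ℝ)) hη).translate (0, 2 * ε))
    (fun t x ht => by
      rw [one_mul]
      exact smoothSolution_translate_equation hη _ ht.le x)
    (by linarith [cauchyCDF_nonneg η (-ε)]) (fun y => by
      have a1 := upperEnvelope_primitive_zero_le hc hε hη y
      have a2 := cdf_le_smoothCDF (μ := (m₀ : Measure ℝ)) hη (y + ε) ε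
      rw [Prod.mk_add_mk, add_zero, smoothSolution_of_nonneg le_rfl, freeConv_zero]
      rw [show y + ε + ε = y + 2 * ε by ring] at a2
      linarith) t x
  have a1 := le_upperEnvelope h1 (t, x)
  have a2 := smoothCDF_le_cdf (μ := freeConv (m₀ : Measure ℝ) t) hη (x + 2 * ε) ε
  rw [Prod.mk_add_mk, add_zero, smoothSolution_of_nonneg (NNReal.coe_nonneg t)] at hcmp
  rw [show x + 2 * ε + ε = x + 3 * ε by ring] at a2
  linarith

/-- The primitive of any solution lies, up to arbitrarily small translations, above that of the
free convolution flow. -/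
lemma IsSolution.le_primitive {m₀ : ProbabilityMeasure ℝ} {m : ℝ≥0 → ProbabilityMeasure ℝ}
    (h : IsSolution m₀ m) (t : ℝ≥0) (x : ℝ) {ε : ℝ} (hε : 0 < ε) :
    (freeConv (m₀ : Measure ℝ) t).real (Set.Iic (x - 3 * ε)) ≤ primitive m (t, x) := by
  have h0 := primitive_nonneg m
  have h1 := primitive_le_one m
  have hc : Tendsto m (𝓝 0) (𝓝 m₀) := by
    have := h.continuousAt_zero.tendsto
    rwa [h.initial] at this
  have hlim : Tendsto (fun η => (freeConv (m₀ : Measure ℝ) t).real (Set.Iic (x - 3 * ε))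
      - (2 * cauchyCDF η (-ε) + η)) (𝓝[>] 0)
      (𝓝 ((freeConv (m₀ : Measure ℝ) t).real (Set.Iic (x - 3 * ε)))) := by
    have := (((tendsto_cauchyCDF_neg hε).const_mul 2).add
      ((tendsto_id (α := ℝ)).mono_left nhdsWithin_le_nhds)).const_sub
      ((freeConv (m₀ : Measure ℝ) t).real (Set.Iic (x - 3 * ε)))
    simpa using this
  refine le_of_tendsto hlim ?_
  filter_upwards [self_mem_nhdsWithin] with η hη
  have hη : 0 < η := hη
  have hcmp := (h.viscosity.super.hasSubTest_neg).le_add (e := cauchyCDF η (-ε) + η) (by simp)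
    h.viscosity.super.1.neg (M := 0) (fun z => by linarith [lowerEnvelope_nonneg h0 h1 z])
    ((isC11b_smoothSolution (μ := (m₀ : Measure ℝ)) hη).translate (0, -(2 * ε))).neg
    (fun t x ht => by
      rw [halfLaplacianNear_neg, deriv.fun_neg, deriv.fun_neg]
      linarith [smoothSolution_translate_equation (μ := (m₀ : Measure ℝ)) hη (-(2 * ε)) ht.le x])
    (by linarith [cauchyCDF_nonneg η (-ε)]) (fun y => by
      have a1 := le_lowerEnvelope_primitive_zero hc hε hη y
      have a2 := smoothCDF_le_cdf (μ := (m₀ : Measure ℝ)) hη (y - 2 * ε) ε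
      rw [Prod.mk_add_mk, add_zero, smoothSolution_of_nonneg le_rfl, freeConv_zero,
        ← sub_eq_add_neg]
      rw [show y - 2 * ε + ε = y - ε by ring] at a2
      linarith) t x
  have a1 := lowerEnvelope_le h0 (t, x)
  have a2 := cdf_le_smoothCDF (μ := freeConv (m₀ : Measure ℝ) t) hη (x - 3 * ε) ε
  rw [Prod.mk_add_mk, add_zero, smoothSolution_of_nonneg (NNReal.coe_nonneg t), ← sub_eq_add_neg] at hcmp
  rw [show x - 3 * ε + ε = x - 2 * ε by ring] at a2
  linarith

lemma tendsto_measureReal_Iic_add (μ : Measure ℝ) [IsProbabilityMeasure μ] (x : ℝ) {c : ℝ}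
    (hc : 0 < c) :
    Tendsto (fun ε => μ.real (Set.Iic (x + c * ε))) (𝓝[>] 0) (𝓝 (μ.real (Set.Iic x))) := by
  simp only [← ProbabilityTheory.cdf_eq_real]
  have h := ((ProbabilityTheory.cdf μ).right_continuous x).tendsto
  refine h.comp (tendsto_nhdsWithin_iff.2 ⟨?_, ?_⟩)
  · have : ContinuousAt (fun ε : ℝ => x + c * ε) 0 := by fun_prop
    have := this.tendsto.mono_left (nhdsWithin_le_nhds (s := Set.Ioi 0))
    simpa using this
  · filter_upwards [self_mem_nhdsWithin] with ε hε
    have : 0 < c * ε := mul_pos hc hε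
    simp only [Set.mem_Ici]
    linarith

/-- Any solution is the free convolution flow. -/
theorem IsSolution.eq_freeConv {m₀ : ProbabilityMeasure ℝ} {m : ℝ≥0 → ProbabilityMeasure ℝ}
    (h : IsSolution m₀ m) (t : ℝ≥0) : (m t : Measure ℝ) = freeConv (m₀ : Measure ℝ) t := by
  refine Measure.eq_of_cdf _ _ (StieltjesFunction.ext fun x => ?_)
  rw [ProbabilityTheory.cdf_eq_real, ProbabilityTheory.cdf_eq_real]
  refine le_antisymm ?_ ?_
  · refine ge_of_tendsto (tendsto_measureReal_Iic_add _ x three_pos) ?_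
    filter_upwards [self_mem_nhdsWithin] with ε hε
    exact h.primitive_le t x hε
  · refine ge_of_tendsto (tendsto_measureReal_Iic_add (m t : Measure ℝ) x three_pos) ?_
    filter_upwards [self_mem_nhdsWithin] with ε hε
    have := h.le_primitive t (x + 3 * ε) hε
    rwa [add_sub_cancel_right] at this

/-! ### Weak continuity at the initial time -/

section

variable {μ : Measure ℝ} [IsProbabilityMeasure μ]

lemma abs_smoothCDF_freeConv_sub_le {η : ℝ} (hη : 0 < η) {t : ℝ} (ht : 0 ≤ t) (x : ℝ) :
    |smoothCDF (freeConv μ t) η x - smoothCDF μ η x| ≤ Real.pi⁻¹ * (η⁻¹) ^ 2 * t := by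
  rw [smoothCDF_freeConv hη ht, add_sub_cancel_left]
  have := intervalIntegral.norm_integral_le_of_norm_le_const (a := 0) (b := t)
    (f := fun r => timeRate μ η (r, x)) (C := Real.pi⁻¹ * (η⁻¹) ^ 2)
    fun r _ => abs_timeRate_le hη _
  rwa [sub_zero, abs_of_nonneg ht] at this

/-- The error in comparing the distribution functions at time `t` and at time `0` through their
regularizations is small for small `t`, once the scale `η` is chosen. -/
lemma tendsto_cdf_error {ε : ℝ} (hε : 0 < ε) {d : ℝ} (hd : 0 < d) :
    ∃ η, 0 < η ∧ ∀ᶠ t : ℝ≥0 in 𝓝 0,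
      2 * cauchyCDF η (-ε) + Real.pi⁻¹ * (η⁻¹) ^ 2 * t < d := by
  have h1 := ((tendsto_cauchyCDF_neg hε).const_mul 2).eventually
    (gt_mem_nhds (show 2 * (0 : ℝ) < d by simpa using hd))
  obtain ⟨η, hη1, hη2⟩ := (h1.and self_mem_nhdsWithin).exists
  refine ⟨η, hη2, ?_⟩
  have hc : ContinuousAt
      (fun t : ℝ≥0 => 2 * cauchyCDF η (-ε) + Real.pi⁻¹ * (η⁻¹) ^ 2 * (t : ℝ)) 0 := by fun_prop
  refine hc.eventually (gt_mem_nhds ?_)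
  simpa using hη1

/-- The distribution functions of the flow converge at the continuity points of the initial one. -/
lemma tendsto_measureReal_freeConv_Iic {x : ℝ} (hx : μ {x} = 0) :
    Tendsto (fun t : ℝ≥0 => (freeConv μ t).real (Set.Iic x)) (𝓝 0) (𝓝 (μ.real (Set.Iic x))) := by
  have hF : ∀ y, μ.real (Set.Iic y) = ProbabilityTheory.cdf μ y := fun y =>
    (ProbabilityTheory.cdf_eq_real μ y).symm
  refine tendsto_order.2 ⟨fun a ha => ?_, fun a ha => ?_⟩
  · have hleft : ProbabilityTheory.cdf μ x ≤ Function.leftLim (ProbabilityTheory.cdf μ) x := by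
      rw [← ProbabilityTheory.measure_cdf μ, StieltjesFunction.measure_singleton,
        ENNReal.ofReal_eq_zero] at hx
      linarith
    rw [hF] at ha
    obtain ⟨y, hy1, hy2⟩ := (((ProbabilityTheory.cdf μ).mono.tendsto_leftLim x).eventually
      (lt_mem_nhds (ha.trans_le hleft)) |>.and self_mem_nhdsWithin).exists
    rw [← hF] at hy1
    have hy2 : y < x := hy2
    obtain ⟨η, hη, h⟩ := tendsto_cdf_error (show 0 < (x - y) / 2 by linarith) (sub_pos.2 hy1)
    filter_upwards [h] with t ht
    have b1 := cdf_le_smoothCDF (μ := μ) hη y ((x - y) / 2)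
    have b2 := (abs_le.1 (abs_smoothCDF_freeConv_sub_le (μ := μ) hη t.2 (y + (x - y) / 2))).1
    have b3 := smoothCDF_le_cdf (μ := freeConv μ t) hη (y + (x - y) / 2) ((x - y) / 2)
    rw [show y + (x - y) / 2 + (x - y) / 2 = x by ring] at b3
    simp only [NNReal.val_eq_coe] at b2
    linarith
  · rw [hF] at ha
    have hr := ((ProbabilityTheory.cdf μ).right_continuous x).mono Set.Ioi_subset_Ici_self
    obtain ⟨y, hy1, hy2⟩ := (hr.tendsto.eventually (gt_mem_nhds ha) |>.and
      self_mem_nhdsWithin).exists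
    rw [← hF] at hy1
    have hy2 : x < y := hy2
    obtain ⟨η, hη, h⟩ := tendsto_cdf_error (show 0 < (y - x) / 2 by linarith) (sub_pos.2 hy1)
    filter_upwards [h] with t ht
    have b1 := cdf_le_smoothCDF (μ := freeConv μ t) hη x ((y - x) / 2)
    have b2 := (abs_le.1 (abs_smoothCDF_freeConv_sub_le (μ := μ) hη t.2 (x + (y - x) / 2))).2
    have b3 := smoothCDF_le_cdf (μ := μ) hη (x + (y - x) / 2) ((y - x) / 2)
    rw [show x + (y - x) / 2 + (y - x) / 2 = y by ring] at b3
    simp only [NNReal.val_eq_coe] at b2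
    linarith

end

/-- The free convolution flow as a curve of probability measures. -/
noncomputable def freeFlow (m₀ : ProbabilityMeasure ℝ) (t : ℝ≥0) : ProbabilityMeasure ℝ :=
  ⟨freeConv (m₀ : Measure ℝ) t, inferInstance⟩

lemma freeFlow_zero (m₀ : ProbabilityMeasure ℝ) : freeFlow m₀ 0 = m₀ := by
  have h : freeConv (m₀ : Measure ℝ) ((0 : ℝ≥0) : ℝ) = m₀ := by
    rw [NNReal.coe_zero, freeConv_zero]
  exact Subtype.ext h

/-- Weak convergence is checked on the half-open intervals whose end points are not atoms of the
limit. -/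
lemma continuousAt_freeFlow_zero (m₀ : ProbabilityMeasure ℝ) : ContinuousAt (freeFlow m₀) 0 := by
  rw [ContinuousAt, freeFlow_zero]
  set A : Set ℝ := {x | (m₀ : Measure ℝ) {x} = 0} with hA
  have hdense : Dense A := by
    have hc : (Aᶜ).Countable := by
      have := Measure.countable_meas_pos_of_disjoint_iUnion (μ := (m₀ : Measure ℝ))
        (As := fun x : ℝ => {x}) (fun x => measurableSet_singleton x)
        (fun x y hxy => Set.disjoint_singleton.2 hxy)
      refine this.mono fun x hx => ?_
      exact pos_iff_ne_zero.2 hx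
    have := hc.dense_compl ℝ
    rwa [compl_compl] at this
  have hS := isPiSystem_Ioc_mem A A
  refine IsPiSystem.tendsto_probabilityMeasure_of_tendsto_of_mem hS ?_ ?_ ?_
  · rintro _ ⟨a, _, b, _, _, rfl⟩
    exact measurableSet_Ioc
  · intro U hU x hx
    obtain ⟨r, hr, hball⟩ := Metric.isOpen_iff.1 hU x hx
    obtain ⟨a, haA, ha⟩ := hdense.exists_between (show x - r < x by linarith)
    obtain ⟨b, hbA, hb⟩ := hdense.exists_between (show x < x + r by linarith)
    refine ⟨Set.Ioc a b, ⟨a, haA, b, hbA, ha.2.trans hb.1, rfl⟩, Ioc_mem_nhds ha.2 hb.1,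
      fun y hy => hball ?_⟩
    rw [Metric.mem_ball, Real.dist_eq, abs_lt]
    constructor <;> linarith [hy.1, hy.2, ha.1, hb.2]
  · rintro _ ⟨a, haA, b, hbA, hab, rfl⟩
    have h1 := (tendsto_measureReal_freeConv_Iic hbA).sub (tendsto_measureReal_freeConv_Iic haA)
    have e : ∀ ν : ProbabilityMeasure ℝ, ((ν (Set.Ioc a b) : ℝ≥0) : ℝ)
        = (ν : Measure ℝ).real (Set.Iic b) - (ν : Measure ℝ).real (Set.Iic a) := by
      intro ν
      rw [← measureReal_sdiff (Set.Iic_subset_Iic.2 hab.le) measurableSet_Iic, Set.Iic_sdiff_Iic]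
      rfl
    rw [← NNReal.tendsto_coe]
    simp only [e]
    exact h1

/-! ### Stability of viscosity solutions under uniform convergence -/

lemma tendsto_halfLaplacianNear {f : ℕ → ℝ → ℝ} {g : ℝ → ℝ} {K M : ℝ}
    (hf : ∀ n, SecondDiffBound (f n) K M) {x : ℕ → ℝ} {x₀ : ℝ}
    (h : ∀ z, Tendsto (fun n => f n (x n + z)) atTop (𝓝 (g (x₀ + z)))) (δ : ℝ≥0∞) :
    Tendsto (fun n => halfLaplacianNear δ (f n) (x n)) atTop (𝓝 (halfLaplacianNear δ g x₀)) := by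
  have hsub : {z : ℝ | 0 < z ∧ ENNReal.ofReal z < δ} ⊆ Set.Ioi 0 := fun z hz => hz.1
  refine tendsto_integral_of_dominated_convergence (majorant K M 1)
    (fun n => (((hf n).integrableOn (x n)).mono_set hsub).aestronglyMeasurable)
    ((integrableOn_majorant K M one_pos).1.mono_set hsub) (fun n => ?_)
    (Eventually.of_forall fun z => ?_)
  · refine (ae_restrict_iff' (measurableSet_near δ)).2 (Eventually.of_forall fun z hz => ?_)
    exact (hf n).abs_le_majorant 1 (x n) hz.1
  · have h0 := (h 0).const_mul 2
    simp only [add_zero] at h0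
    simpa only [sub_eq_add_neg] using ((h0.sub (h z)).sub (h (-z))).div_const (z ^ 2)

lemma tendsto_halfLaplacianFar {f : ℕ → ℝ → ℝ} {g : ℝ → ℝ} {M : ℝ}
    (hf : ∀ n, Measurable (f n)) (hg : Measurable g) (hfM : ∀ n x, |f n x| ≤ M)
    (hgM : ∀ x, |g x| ≤ M) {x : ℕ → ℝ} {x₀ : ℝ}
    (h : ∀ z, Tendsto (fun n => f n (x n + z)) atTop (𝓝 (g (x₀ + z)))) {δ : ℝ≥0∞} (hδ : 0 < δ) :
    Tendsto (fun n => halfLaplacianFar δ (f n) (x n)) atTop (𝓝 (halfLaplacianFar δ g x₀)) := by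
  simp only [halfLaplacianFar_eq (hf _) (hfM _) hδ, halfLaplacianFar_eq hg hgM hδ]
  obtain ⟨L, hL, hLδ⟩ : ∃ L : ℝ, 0 < L ∧ ENNReal.ofReal L < δ := by
    obtain ⟨L, h1, h2⟩ := ENNReal.lt_iff_exists_nnreal_btwn.1 hδ
    exact ⟨L, by exact_mod_cast h1, by simpa using h2⟩
  have hsub : {z : ℝ | 0 < z ∧ δ ≤ ENNReal.ofReal z} ⊆ Set.Ioi 0 := fun z hz => hz.1
  refine tendsto_integral_of_dominated_convergence (majorant 0 M L)
    (fun n => ?_) ((integrableOn_majorant 0 M hL).1.mono_set hsub) (fun n => ?_)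
    (Eventually.of_forall fun z => ?_)
  · have := hf n
    refine Measurable.aestronglyMeasurable ?_
    fun_prop
  · refine (ae_restrict_iff' (measurableSet_far δ)).2 (Eventually.of_forall fun z hz => ?_)
    have hzL : ¬ z ≤ L := fun hle =>
      absurd (hLδ.trans_le (hz.2.trans (ENNReal.ofReal_le_ofReal hle))) (lt_irrefl _)
    have e : z ^ (-2 : ℝ) = (z ^ 2)⁻¹ := by
      rw [Real.rpow_neg hz.1.le]
      norm_cast
    rw [majorant, if_neg hzL, e, Real.norm_eq_abs, abs_div, abs_of_pos (pow_pos hz.1 2),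
      div_eq_mul_inv]
    refine mul_le_mul_of_nonneg_right ?_ (inv_nonneg.2 (sq_nonneg z))
    have h1 := abs_le.1 (hfM n (x n))
    have h2 := abs_le.1 (hfM n (x n + z))
    have h3 := abs_le.1 (hfM n (x n - z))
    rw [abs_le]
    constructor <;> linarith [h1.1, h1.2, h2.1, h2.2, h3.1, h3.2]
  · have h0 := (h 0).const_mul 2
    simp only [add_zero] at h0
    simpa only [sub_eq_add_neg] using ((h0.sub (h z)).sub (h (-z))).div_const (z ^ 2)

/-- The derivative at the right end point of an interval is nonnegative at a maximum. -/
lemma deriv_nonneg_of_isMaxOn_Icc {f : ℝ → ℝ} {f' a b : ℝ} (hab : a < b) (hf : HasDerivAt f f' b)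
    (hmax : ∀ s ∈ Set.Icc a b, f s ≤ f b) : 0 ≤ f' := by
  have h1 : Tendsto (slope f b) (𝓝[<] b) (𝓝 f') :=
    (hasDerivAt_iff_tendsto_slope.1 hf).mono_left
      (nhdsWithin_mono b fun y hy => (Set.mem_Iio.1 hy).ne)
  refine ge_of_tendsto h1 ?_
  filter_upwards [self_mem_nhdsWithin, mem_nhdsWithin_of_mem_nhds (Ioi_mem_nhds hab)] with s hs hs'
  have hs : s < b := hs
  have hs' : a < s := hs'
  rw [slope_def_field]
  exact div_nonneg_of_nonpos (sub_nonpos.2 (hmax s ⟨hs'.le, hs.le⟩)) (sub_nonpos.2 hs.le)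

/-- The inequality satisfied by a classical solution at a point where it is touched from above,
globally in space and in the past, by a test function. The sign of `σ ∂ₓw` makes the equation
monotone in the nonlocal term. -/
lemma classical_inequality {σ a γ t₀ x₀ t₁ x₁ : ℝ} {w φ : ℝ × ℝ → ℝ} (hw : IsC11b w)
    (heq : deriv (fun s => w (s, x₁)) t₁
      + σ * (deriv (fun y => w (t₁, y)) x₁ * halfLaplacianNear ∞ (fun y => w (t₁, y)) x₁) = 0)
    (hsign : 0 ≤ σ * deriv (fun y => w (t₁, y)) x₁) (hφ : IsC11b φ) (hγ : 0 ≤ γ) (ha : a < t₁)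
    (htime : ∀ s ∈ Set.Icc a t₁, w (s, x₁) - (φ (s, x₁) + (s - t₀) ^ 2)
      ≤ w (t₁, x₁) - (φ (t₁, x₁) + (t₁ - t₀) ^ 2))
    (hspace : ∀ y, w (t₁, y) - (φ (t₁, y) + (0 + γ * bump ((y - x₀) / 1)))
      ≤ w (t₁, x₁) - (φ (t₁, x₁) + (0 + γ * bump ((x₁ - x₀) / 1))))
    {δ : ℝ≥0∞} (hδ : 0 < δ) :
    (fderiv ℝ φ (t₁, x₁) (1, 0) + 2 * (t₁ - t₀))
      + σ * ((fderiv ℝ φ (t₁, x₁) (0, 1) + γ * (bumpDeriv ((x₁ - x₀) / 1) / 1))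
        * (halfLaplacianNear δ (fun y => φ (t₁, y) + (0 + γ * bump ((y - x₀) / 1))) x₁
          + halfLaplacianFar δ (fun y => w (t₁, y)) x₁)) ≤ 0 := by
  obtain ⟨K, M, hwS⟩ := hw.exists_secondDiffBound
  obtain ⟨K', M', hφS⟩ := hφ.exists_secondDiffBound
  have hbS := secondDiffBound_bump_scaled hγ one_pos x₀
  have ht : fderiv ℝ φ (t₁, x₁) (1, 0) + 2 * (t₁ - t₀) ≤ deriv (fun s => w (s, x₁)) t₁ := by
    have d1 : HasDerivAt (fun s : ℝ => (s - t₀) ^ 2) (2 * (t₁ - t₀)) t₁ := by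
      refine (((hasDerivAt_id' t₁).sub_const t₀).fun_pow 2).congr_deriv ?_
      norm_num
    have d2 := (hw.hasDerivAt_time t₁ x₁).fun_sub ((hφ.hasDerivAt_time t₁ x₁).fun_add d1)
    have := deriv_nonneg_of_isMaxOn_Icc ha d2 htime
    rw [(hw.hasDerivAt_time t₁ x₁).deriv]
    linarith
  have hx : deriv (fun y => w (t₁, y)) x₁
      = fderiv ℝ φ (t₁, x₁) (0, 1) + γ * (bumpDeriv ((x₁ - x₀) / 1) / 1) := by
    have d2 := (hw.hasDerivAt_space t₁ x₁).fun_sub ((hφ.hasDerivAt_space t₁ x₁).fun_add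
      ((hasDerivAt_bump_scaled γ 1 x₀ x₁).const_add 0))
    have hloc : IsLocalMax (fun y => w (t₁, y) - (φ (t₁, y) + (0 + γ * bump ((y - x₀) / 1)))) x₁ :=
      Eventually.of_forall hspace
    have := hloc.hasDerivAt_eq_zero d2
    rw [(hw.hasDerivAt_space t₁ x₁).deriv]
    linarith
  have hnear : halfLaplacianNear δ (fun y => φ (t₁, y) + (0 + γ * bump ((y - x₀) / 1))) x₁
      ≤ halfLaplacianNear δ (fun y => w (t₁, y)) x₁ := by
    have hsub : {z : ℝ | 0 < z ∧ ENNReal.ofReal z < δ} ⊆ Set.Ioi 0 := fun z hz => hz.1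
    refine setIntegral_mono_on ?_ (((hwS t₁).integrableOn x₁).mono_set hsub)
      (measurableSet_near δ) fun z hz => ?_
    · have h1 := (((hφS t₁).integrableOn x₁).add (hbS.integrableOn x₁)).mono_set hsub
      refine h1.congr (Eventually.of_forall fun z => ?_)
      simp only [Pi.add_apply]
      ring
    · have h1 := hspace (x₁ + z)
      have h2 := hspace (x₁ - z)
      refine div_le_div_of_nonneg_right ?_ (sq_nonneg z)
      simp only
      linarith
  have hsplit := (hwS t₁).near_add_far hδ x₁
  rw [← hx]
  have h3 := mul_le_mul_of_nonneg_left (add_le_add_left hnear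
    (halfLaplacianFar δ (fun y => w (t₁, y)) x₁)) hsign
  rw [hsplit] at h3
  linarith

lemma half_sq_le_bump {x : ℝ} (hx : |x| ≤ 1) : x ^ 2 / 2 ≤ bump x := by
  have h : x ^ 2 ≤ 1 := (sq_le_one_iff_abs_le_one x).2 hx
  have e : bump x = x ^ 2 / (1 + x ^ 2) := by
    rw [bump]
    field_simp
    ring
  rw [e]
  gcongr
  linarith

lemma tendsto_of_sq_le {ι : Type*} {l : Filter ι} {f g : ι → ℝ} {a : ℝ} (hg : Tendsto g l (𝓝 0))
    (h : ∀ i, (f i - a) ^ 2 ≤ g i) : Tendsto f l (𝓝 a) := by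
  have h1 : Tendsto (fun i => (f i - a) ^ 2) l (𝓝 0) :=
    squeeze_zero (fun i => sq_nonneg _) h hg
  have h2 := (Real.continuous_sqrt.tendsto 0).comp h1
  rw [Real.sqrt_zero] at h2
  rw [tendsto_iff_dist_tendsto_zero]
  refine h2.congr fun i => ?_
  simp only [Function.comp_apply]
  rw [Real.sqrt_sq_eq_abs, Real.dist_eq]

/-- A uniform limit of classical solutions with `σ ∂ₓw ≥ 0` satisfies the sub-solution inequality at a
global maximum point. The test function is perturbed so as to make the maximum strict, which
localizes the maximum points of the approximations. -/
lemma viscosity_inequality_of_uniform_limit {σ : ℝ} {v : ℝ × ℝ → ℝ} {w : ℕ → ℝ × ℝ → ℝ} {M : ℝ}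
    (hvM : ∀ z, |v z| ≤ M) (hwM : ∀ n z, |w n z| ≤ M)
    (hv : ∀ t x, 0 < t → ContinuousAt v (t, x)) (hvm : ∀ t, Measurable fun y => v (t, y))
    (hw : ∀ n, IsC11b (w n))
    (heq : ∀ n t x, 0 < t → deriv (fun s => w n (s, x)) t + σ * (deriv (fun y => w n (t, y)) x
      * halfLaplacianNear ∞ (fun y => w n (t, y)) x) = 0)
    (hsign : ∀ n t x, 0 < t → 0 ≤ σ * deriv (fun y => w n (t, y)) x)
    (hlim : ∀ c, 0 < c → ∃ e : ℕ → ℝ, Tendsto e atTop (𝓝 0) ∧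
      ∀ n t x, c ≤ t → |w n (t, x) - v (t, x)| ≤ e n)
    {φ : ℝ × ℝ → ℝ} (hφ : IsC11b φ) {t₀ x₀ : ℝ} (ht₀ : 0 < t₀)
    (hmax : ∀ t x, 0 < t → t ≤ t₀ → v (t, x) - φ (t, x) ≤ v (t₀, x₀) - φ (t₀, x₀))
    {δ : ℝ≥0∞} (hδ : 0 < δ) :
    deriv (fun s => φ (s, x₀)) t₀ + σ * (deriv (fun y => φ (t₀, y)) x₀
      * (halfLaplacianNear δ (fun y => φ (t₀, y)) x₀
        + halfLaplacianFar δ (fun y => v (t₀, y)) x₀)) ≤ 0 := by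
  obtain ⟨e, he, hwe⟩ := hlim (t₀ / 2) (by positivity)
  obtain ⟨K, M', hφS⟩ := hφ.exists_secondDiffBound
  have hφ' : Continuous (fderiv ℝ φ) := hφ.fderiv_lipschitz.choose_spec.continuous
  rw [(hφ.hasDerivAt_time t₀ x₀).deriv, (hφ.hasDerivAt_space t₀ x₀).deriv]
  -- The inequality holds up to the contribution of the perturbation `γ * bump`.
  have hkey : ∀ γ : ℝ, 0 < γ → fderiv ℝ φ (t₀, x₀) (1, 0) + σ * (fderiv ℝ φ (t₀, x₀) (0, 1)
      * (halfLaplacianNear δ (fun y => φ (t₀, y) + (0 + γ * bump ((y - x₀) / 1))) x₀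
        + halfLaplacianFar δ (fun y => v (t₀, y)) x₀)) ≤ 0 := by
    intro γ hγ
    set g : ℕ → ℝ × ℝ → ℝ := fun n z =>
      w n z - (φ z + ((z.1 - t₀) ^ 2 + γ * bump ((z.2 - x₀) / 1))) with hg
    have hb0 : bump ((x₀ - x₀) / 1) = 0 := by simp [bump]
    have hcmp : ∀ n t x, t₀ / 2 ≤ t → t ≤ t₀ → g n (t, x) + ((t - t₀) ^ 2
        + γ * bump ((x - x₀) / 1)) ≤ g n (t₀, x₀) + 2 * e n := by
      intro n t x h1 h2
      have a1 := hmax t x (by linarith) h2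
      have a2 := (abs_le.1 (hwe n t x h1)).2
      have a3 := (abs_le.1 (hwe n t₀ x₀ (by linarith))).1
      simp only [hg, hb0]
      linarith
    have hgc : ∀ n, Continuous (g n) := by
      intro n
      have c1 := (hw n).differentiable.continuous
      have c2 := hφ.differentiable.continuous
      have c3 : Continuous bump :=
        continuous_iff_continuousAt.2 fun x => (hasDerivAt_bump x).continuousAt
      simp only [hg]
      fun_prop
    have hKc : IsCompact (Set.Icc (t₀ / 2) t₀ ×ˢ Set.Icc (x₀ - 1) (x₀ + 1)) :=
      isCompact_Icc.prod isCompact_Icc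
    have hz₀ : (t₀, x₀) ∈ Set.Icc (t₀ / 2) t₀ ×ˢ Set.Icc (x₀ - 1) (x₀ + 1) :=
      ⟨⟨by linarith, le_rfl⟩, by linarith, by linarith⟩
    -- The maximum points `z n` of the approximations converge to `(t₀, x₀)` by `hcmp`.
    have hex : ∀ n, ∃ z ∈ Set.Icc (t₀ / 2) t₀ ×ˢ Set.Icc (x₀ - 1) (x₀ + 1),
        IsMaxOn (g n) (Set.Icc (t₀ / 2) t₀ ×ˢ Set.Icc (x₀ - 1) (x₀ + 1)) z :=
      fun n => hKc.exists_isMaxOn ⟨_, hz₀⟩ (hgc n).continuousOn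
    choose z hzK hzmax using hex
    have hloc : ∀ n, ((z n).1 - t₀) ^ 2 + γ * bump (((z n).2 - x₀) / 1) ≤ 2 * e n := by
      intro n
      have h1 := hcmp n (z n).1 (z n).2 (hzK n).1.1 (hzK n).1.2
      have h2 : g n (t₀, x₀) ≤ g n (z n) := hzmax n hz₀
      have h3 : g n ((z n).1, (z n).2) = g n (z n) := rfl
      linarith
    have ht : Tendsto (fun n => (z n).1) atTop (𝓝 t₀) := by
      refine tendsto_of_sq_le (g := fun n => 2 * e n) (by simpa using he.const_mul 2) fun n => ?_
      have := mul_nonneg hγ.le (bump_nonneg (((z n).2 - x₀) / 1))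
      linarith [hloc n]
    have hx : Tendsto (fun n => (z n).2) atTop (𝓝 x₀) := by
      refine tendsto_of_sq_le (g := fun n => 4 / γ * e n)
        (by simpa using he.const_mul (4 / γ)) fun n => ?_
      have h1 : |(z n).2 - x₀| ≤ 1 := by
        rw [abs_le]
        constructor <;> linarith [(hzK n).2.1, (hzK n).2.2]
      have h2 := mul_le_mul_of_nonneg_left (half_sq_le_bump h1) hγ.le
      have h3 := hloc n
      rw [div_one] at h3
      have h4 := sq_nonneg ((z n).1 - t₀)
      rw [div_mul_eq_mul_div, le_div_iff₀ hγ]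
      linarith
    have hz : Tendsto z atTop (𝓝 (t₀, x₀)) := ht.prodMk_nhds hx
    have hcl : ∀ᶠ n in atTop, (fderiv ℝ φ (z n) (1, 0) + 2 * ((z n).1 - t₀))
        + σ * ((fderiv ℝ φ (z n) (0, 1) + γ * (bumpDeriv (((z n).2 - x₀) / 1) / 1))
          * (halfLaplacianNear δ (fun y => φ ((z n).1, y) + (0 + γ * bump ((y - x₀) / 1))) (z n).2
            + halfLaplacianFar δ (fun y => w n ((z n).1, y)) (z n).2)) ≤ 0 := by
      filter_upwards [ht.eventually (lt_mem_nhds (show t₀ / 2 < t₀ by linarith)),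
        he.eventually (gt_mem_nhds (show 0 < γ / 4 by positivity))] with n hn1 hn2
      have htn : 0 < (z n).1 := by linarith
      refine classical_inequality (a := t₀ / 2) (hw n) (heq n _ _ htn) (hsign n _ _ htn) hφ hγ.le
        hn1 (fun s hs => ?_) (fun y => ?_) hδ
      · have h1 : g n (s, (z n).2) ≤ g n (z n) :=
          hzmax n ⟨⟨hs.1, hs.2.trans (hzK n).1.2⟩, (hzK n).2⟩
        simp only [hg] at h1
        change w n (s, (z n).2) - (φ (s, (z n).2) + (s - t₀) ^ 2)
          ≤ w n (z n) - (φ (z n) + ((z n).1 - t₀) ^ 2)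
        linarith
      · have h1 : g n ((z n).1, y) ≤ g n (z n) := by
          rcases le_or_gt |y - x₀| 1 with hy | hy
          · have hy' := abs_le.1 hy
            exact hzmax n ⟨(hzK n).1, by linarith [hy'.1], by linarith [hy'.2]⟩
          · have h2 := hcmp n (z n).1 y (hzK n).1.1 (hzK n).1.2
            have h3 : g n (t₀, x₀) ≤ g n (z n) := hzmax n hz₀
            have h4 := mul_le_mul_of_nonneg_left (half_le_bump hy.le) hγ.le
            have h5 := sq_nonneg ((z n).1 - t₀)
            rw [div_one] at h2
            linarith
        simp only [hg] at h1
        change w n ((z n).1, y) - (φ ((z n).1, y) + (0 + γ * bump ((y - x₀) / 1)))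
          ≤ w n (z n) - (φ (z n) + (0 + γ * bump (((z n).2 - x₀) / 1)))
        linarith
    have hd : Tendsto (fun n => fderiv ℝ φ (z n)) atTop (𝓝 (fderiv ℝ φ (t₀, x₀))) :=
      (hφ'.tendsto _).comp hz
    have hd1 : Tendsto (fun n => fderiv ℝ φ (z n) (1, 0)) atTop
        (𝓝 (fderiv ℝ φ (t₀, x₀) (1, 0))) :=
      ((ContinuousLinearMap.apply ℝ ℝ ((1 : ℝ), (0 : ℝ))).continuous.tendsto _).comp hd
    have hd2 : Tendsto (fun n => fderiv ℝ φ (z n) (0, 1)) atTop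
        (𝓝 (fderiv ℝ φ (t₀, x₀) (0, 1))) :=
      ((ContinuousLinearMap.apply ℝ ℝ ((0 : ℝ), (1 : ℝ))).continuous.tendsto _).comp hd
    have hd3 : Tendsto (fun n => 2 * ((z n).1 - t₀)) atTop (𝓝 0) := by
      simpa using (ht.sub_const t₀).const_mul 2
    have hd4 : Tendsto (fun n => γ * (bumpDeriv (((z n).2 - x₀) / 1) / 1)) atTop (𝓝 0) := by
      have c : ContinuousAt (fun x => γ * (bumpDeriv ((x - x₀) / 1) / 1)) x₀ := by
        have := lipschitzWith_bumpDeriv.continuous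
        fun_prop
      have := c.tendsto.comp hx
      simpa [bumpDeriv, Function.comp_def] using this
    have hzy : ∀ y, Tendsto (fun n => ((z n).1, (z n).2 + y)) atTop (𝓝 (t₀, x₀ + y)) :=
      fun y => ht.prodMk_nhds (hx.add_const y)
    have hbS := secondDiffBound_bump_scaled hγ.le one_pos x₀
    have hd5 : Tendsto (fun n => halfLaplacianNear δ
        (fun y => φ ((z n).1, y) + (0 + γ * bump ((y - x₀) / 1))) (z n).2) atTop
        (𝓝 (halfLaplacianNear δ (fun y => φ (t₀, y) + (0 + γ * bump ((y - x₀) / 1))) x₀)) := by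
      have h1 : ∀ n, halfLaplacianNear δ (fun y => φ ((z n).1, y)
          + (0 + γ * bump ((y - x₀) / 1))) (z n).2 = _ :=
        fun n => (hφS (z n).1).halfLaplacianNear_add hbS 0 δ (z n).2
      rw [(hφS t₀).halfLaplacianNear_add hbS 0 δ x₀]
      simp only [h1]
      refine (tendsto_halfLaplacianNear (fun n => hφS (z n).1) (g := fun y => φ (t₀, y))
        (fun y => (hφ.differentiable.continuous.tendsto _).comp (hzy y)) δ).add
        (tendsto_halfLaplacianNear (fun _ => hbS) (fun y => ?_) δ)
      exact (hbS.continuous.tendsto _).comp (hx.add_const y)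
    have hd6 : Tendsto (fun n => halfLaplacianFar δ (fun y => w n ((z n).1, y)) (z n).2) atTop
        (𝓝 (halfLaplacianFar δ (fun y => v (t₀, y)) x₀)) := by
      refine tendsto_halfLaplacianFar (fun n => ?_) (hvm t₀) (fun n x => hwM n _) (fun x => hvM _)
        (fun y => ?_) hδ
      · have := (hw n).differentiable.continuous
        exact Continuous.measurable (by fun_prop)
      · have h1 : Tendsto (fun n => v ((z n).1, (z n).2 + y)) atTop (𝓝 (v (t₀, x₀ + y))) :=
          (hv t₀ (x₀ + y) ht₀).tendsto.comp (hzy y)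
        have h2 : Tendsto (fun n => w n ((z n).1, (z n).2 + y) - v ((z n).1, (z n).2 + y)) atTop
            (𝓝 0) :=
          squeeze_zero_norm (fun n => hwe n _ _ (hzK n).1.1) he
        simpa using h2.add h1
    have hfin := (hd1.add hd3).add (((hd2.add hd4).mul (hd5.add hd6)).const_mul σ)
    have := le_of_tendsto hfin hcl
    simpa only [add_zero] using this
  have hsplit : ∀ γ : ℝ, 0 < γ →
      halfLaplacianNear δ (fun y => φ (t₀, y) + (0 + γ * bump ((y - x₀) / 1))) x₀
        = halfLaplacianNear δ (fun y => φ (t₀, y)) x₀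
          + halfLaplacianNear δ (fun y => γ * bump ((y - x₀) / 1)) x₀ := fun γ hγ =>
    (hφS t₀).halfLaplacianNear_add (secondDiffBound_bump_scaled hγ.le one_pos x₀) 0 δ x₀
  have hbump : Tendsto (fun γ : ℝ => halfLaplacianNear δ (fun y => γ * bump ((y - x₀) / 1)) x₀)
      (𝓝[>] 0) (𝓝 0) := by
    have h1 : Tendsto (fun γ : ℝ => 16 * γ / 1) (𝓝[>] 0) (𝓝 0) := by
      have : ContinuousAt (fun γ : ℝ => 16 * γ / 1) 0 := by fun_prop
      simpa using this.tendsto.mono_left (nhdsWithin_le_nhds (s := Set.Ioi (0 : ℝ)))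
    refine squeeze_zero_norm' ?_ h1
    filter_upwards [self_mem_nhdsWithin] with γ hγ
    exact abs_halfLaplacianNear_bump_scaled_le (le_of_lt hγ) one_pos x₀ δ x₀
  have hfin := ((((hbump.const_add (halfLaplacianNear δ (fun y => φ (t₀, y)) x₀)).add_const
    (halfLaplacianFar δ (fun y => v (t₀, y)) x₀)).const_mul
    (fderiv ℝ φ (t₀, x₀) (0, 1))).const_mul σ).const_add (fderiv ℝ φ (t₀, x₀) (1, 0))
  rw [add_zero] at hfin
  refine le_of_tendsto hfin ?_
  filter_upwards [self_mem_nhdsWithin] with γ hγ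
  have := hkey γ hγ
  rwa [hsplit γ hγ] at this

/-! ### Existence -/

section

variable {μ : Measure ℝ} [IsProbabilityMeasure μ] {t : ℝ}

lemma measureReal_freeConv_Ioc_le (ht : 0 < t) {a b : ℝ} (hab : a ≤ b) :
    (freeConv μ t).real (Set.Ioc a b) ≤ Real.pi⁻¹ * (√t)⁻¹ * (b - a) := by
  have hD : 0 ≤ Real.pi⁻¹ * (√t)⁻¹ := by
    have := Real.pi_pos
    positivity
  rw [Measure.real, freeConv_of_pos ht, withDensity_apply _ measurableSet_Ioc]
  refine ENNReal.toReal_le_of_le_ofReal (mul_nonneg hD (sub_nonneg.2 hab)) ?_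
  calc ∫⁻ x in Set.Ioc a b, ENNReal.ofReal (freeDensity μ t x)
      ≤ ∫⁻ _ in Set.Ioc a b, ENNReal.ofReal (Real.pi⁻¹ * (√t)⁻¹) :=
        lintegral_mono fun x => ENNReal.ofReal_le_ofReal (freeDensity_le ht x)
    _ = _ := by rw [setLIntegral_const, Real.volume_Ioc, ENNReal.ofReal_mul hD]

/-- The density bound makes the Poisson regularization uniformly close to the distribution
function. -/
lemma abs_smoothCDF_freeConv_sub_cdf_le (ht : 0 < t) {η ε : ℝ} (hη : 0 < η) (hε : 0 ≤ ε) (x : ℝ) :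
    |smoothCDF (freeConv μ t) η x - (freeConv μ t).real (Set.Iic x)|
      ≤ Real.pi⁻¹ * (√t)⁻¹ * ε + cauchyCDF η (-ε) := by
  have key : ∀ y, (freeConv μ t).real (Set.Iic (y + ε))
      ≤ (freeConv μ t).real (Set.Iic y) + Real.pi⁻¹ * (√t)⁻¹ * ε := by
    intro y
    have h := measureReal_freeConv_Ioc_le (μ := μ) ht (show y ≤ y + ε by linarith)
    rw [add_sub_cancel_left] at h
    rw [← Set.Iic_union_Ioc_eq_Iic (show y ≤ y + ε by linarith)]
    exact (measureReal_union_le _ _).trans (by gcongr)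
  have h1 := key x
  have h2 := key (x - ε)
  have h3 := smoothCDF_le_cdf (μ := freeConv μ t) hη x ε
  have h4 := cdf_le_smoothCDF (μ := freeConv μ t) hη (x - ε) ε
  rw [sub_add_cancel] at h2 h4
  rw [abs_le]
  constructor <;> linarith

/-- The mass that the Cauchy law of scale `ε²` gives to `(-∞, -ε]` vanishes with `ε`. -/
lemma tendsto_cauchyCDF_sq :
    Tendsto (fun n : ℕ => cauchyCDF (((n : ℝ) + 1)⁻¹ ^ 2) (-((n : ℝ) + 1)⁻¹)) atTop (𝓝 0) := by
  have h1 : Tendsto (fun n : ℕ => -((n : ℝ) + 1)) atTop atBot :=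
    tendsto_neg_atTop_atBot.comp (tendsto_atTop_add_const_right _ _ tendsto_natCast_atTop_atTop)
  refine ((tendsto_cauchyCDF_atBot one_pos).comp h1).congr fun n => ?_
  have : (n : ℝ) + 1 ≠ 0 := by positivity
  simp only [Function.comp_apply, cauchyCDF]
  congr 3
  field_simp

variable (μ) in
/-- The distribution functions of the free convolution flow, as a function of time and space. At
negative times it is the initial distribution function. -/
noncomputable def flowCDF (z : ℝ × ℝ) : ℝ := (freeConv μ z.1).real (Set.Iic z.2)

/-- Uniform convergence of the regularized flow away from time `0`, at scales `η = ε²` with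
`ε = 1 / (n + 1)`. -/
lemma exists_uniform_approx {c : ℝ} (hc : 0 < c) : ∃ e : ℕ → ℝ, Tendsto e atTop (𝓝 0) ∧
    ∀ (n : ℕ) (t x : ℝ), c ≤ t →
      |smoothSolution μ (((n : ℝ) + 1)⁻¹ ^ 2) (t, x) - flowCDF μ (t, x)| ≤ e n := by
  refine ⟨fun n => Real.pi⁻¹ * (√c)⁻¹ * ((n : ℝ) + 1)⁻¹
    + cauchyCDF (((n : ℝ) + 1)⁻¹ ^ 2) (-((n : ℝ) + 1)⁻¹), ?_, fun n t x ht => ?_⟩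
  · have h1 : Tendsto (fun n : ℕ => ((n : ℝ) + 1)⁻¹) atTop (𝓝 0) := by
      simpa using tendsto_one_div_add_atTop_nhds_zero_nat (𝕜 := ℝ)
    simpa using (h1.const_mul (Real.pi⁻¹ * (√c)⁻¹)).add tendsto_cauchyCDF_sq
  · have ht0 := hc.trans_le ht
    rw [smoothSolution_of_nonneg ht0.le]
    refine (abs_smoothCDF_freeConv_sub_cdf_le ht0 (by positivity)
      (show 0 ≤ ((n : ℝ) + 1)⁻¹ by positivity) x).trans ?_
    have hpi := Real.pi_pos
    beta_reduce
    gcongr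

lemma continuousAt_flowCDF (ht : 0 < t) (x : ℝ) : ContinuousAt (flowCDF μ) (t, x) := by
  refine continuousAt_of_locally_uniform_approx_of_continuousAt fun u hu => ?_
  obtain ⟨ε, hε, hεu⟩ := Metric.mem_uniformity_dist.1 hu
  obtain ⟨e, he, happ⟩ := exists_uniform_approx (μ := μ) (show 0 < t / 2 by positivity)
  obtain ⟨n, hn⟩ := (he.eventually (gt_mem_nhds hε)).exists
  refine ⟨{z | t / 2 < z.1}, continuousAt_fst.eventually (lt_mem_nhds (by simpa using ht)),
    smoothSolution μ (((n : ℝ) + 1)⁻¹ ^ 2),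
    (isC11b_smoothSolution (by positivity)).differentiable.continuous.continuousAt,
    fun z hz => hεu ?_⟩
  rw [dist_comm, Real.dist_eq]
  exact (happ n z.1 z.2 (le_of_lt hz)).trans_lt hn

lemma spaceRate_nonneg {η : ℝ} (hη : 0 < η) (ht : 0 ≤ t) (x : ℝ) : 0 ≤ spaceRate μ η (t, x) := by
  rw [spaceRate_of_nonneg ht]
  exact inversionDensity_nonneg (fun z hz => stieltjes_im_nonpos hz) hη x

/-- The distribution functions of the flow satisfy the viscosity inequalities at positive times;
`σ = 1` is the sub-solution case, `σ = -1` the super-solution case. -/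
lemma flowCDF_inequality {σ : ℝ} (hσ : |σ| = 1) {φ : ℝ × ℝ → ℝ} (hφ : IsC11b φ) {t₀ x₀ : ℝ}
    (ht₀ : 0 < t₀) (hmax : ∀ t x, 0 < t → t ≤ t₀ →
      σ * flowCDF μ (t, x) - φ (t, x) ≤ σ * flowCDF μ (t₀, x₀) - φ (t₀, x₀))
    {δ : ℝ≥0∞} (hδ : 0 < δ) :
    deriv (fun s => φ (s, x₀)) t₀ + σ * (deriv (fun y => φ (t₀, y)) x₀
      * (halfLaplacianNear δ (fun y => φ (t₀, y)) x₀
        + halfLaplacianFar δ (fun y => σ * flowCDF μ (t₀, y)) x₀)) ≤ 0 := by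
  have hη : ∀ n : ℕ, 0 < ((n : ℝ) + 1)⁻¹ ^ 2 := fun n => by positivity
  have hσ2 : σ * σ = 1 := by rw [← abs_mul_abs_self, hσ, one_mul]
  have habs : ∀ r : ℝ, |σ * r| = |r| := fun r => by rw [abs_mul, hσ, one_mul]
  have hd : ∀ (n : ℕ) (t x : ℝ),
      deriv (fun s => σ * smoothSolution μ (((n : ℝ) + 1)⁻¹ ^ 2) (s, x)) t
        = σ * timeRate μ (((n : ℝ) + 1)⁻¹ ^ 2) (t, x) := fun n t x =>
    ((hasDerivAt_smoothSolution_time (hη n) t x).const_mul σ).deriv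
  have hd' : ∀ (n : ℕ) (t x : ℝ),
      deriv (fun y => σ * smoothSolution μ (((n : ℝ) + 1)⁻¹ ^ 2) (t, y)) x
        = σ * spaceRate μ (((n : ℝ) + 1)⁻¹ ^ 2) (t, x) := fun n t x =>
    ((hasDerivAt_smoothSolution_space (hη n) t x).const_mul σ).deriv
  refine viscosity_inequality_of_uniform_limit (M := 3) (v := fun z => σ * flowCDF μ z)
    (w := fun n z => σ * smoothSolution μ (((n : ℝ) + 1)⁻¹ ^ 2) z)
    (fun z => ?_) (fun n z => ?_) (fun t x ht => (continuousAt_flowCDF ht x).const_mul σ)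
    (fun t => ?_) (fun n => (isC11b_smoothSolution (hη n)).const_mul σ) (fun n t x ht => ?_)
    (fun n t x ht => ?_) (fun c hc => ?_) hφ ht₀ hmax hδ
  · rw [habs, flowCDF, abs_of_nonneg measureReal_nonneg]
    exact measureReal_le_one.trans (by norm_num)
  · rw [habs]
    exact abs_smoothSolution_le (hη n) z
  · refine Measurable.const_mul ?_ σ
    exact Monotone.measurable fun a b hab => measureReal_mono (Set.Iic_subset_Iic.2 hab)
  · rw [hd, hd', halfLaplacianNear_const_mul]
    have := smoothSolution_equation (μ := μ) (hη n) ht.le x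
    linear_combination σ * this + σ * spaceRate μ (((n : ℝ) + 1)⁻¹ ^ 2) (t, x)
      * halfLaplacianNear ∞ (fun y => smoothSolution μ (((n : ℝ) + 1)⁻¹ ^ 2) (t, y)) x * hσ2
  · rw [hd', ← mul_assoc, hσ2, one_mul]
    exact spaceRate_nonneg (hη n) ht.le x
  · obtain ⟨e, he, happ⟩ := exists_uniform_approx (μ := μ) hc
    refine ⟨e, he, fun n t x ht => ?_⟩
    rw [← mul_sub, habs]
    exact happ n t x ht

end

section

variable {u : ℝ≥0 × ℝ → ℝ}

lemma upperSemicontinuous_upperEnvelope (h0 : ∀ z, 0 ≤ u z) (h1 : ∀ z, u z ≤ 1) :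
    UpperSemicontinuous (upperEnvelope u) := by
  intro z c hc
  obtain ⟨c', hc1, hc2⟩ := exists_between hc
  have h := eventually_lt_of_limsup_lt hc1 (isBoundedUnder_le_of_le_one h1 _)
  filter_upwards [eventually_eventually_nhds.2 h] with w hw
  exact (upperEnvelope_le_of_eventually h0 (hw.mono fun _ h => h.le)).trans_lt hc2

lemma lowerSemicontinuous_lowerEnvelope (h0 : ∀ z, 0 ≤ u z) (h1 : ∀ z, u z ≤ 1) :
    LowerSemicontinuous (lowerEnvelope u) := by
  intro z c hc
  obtain ⟨c', hc1, hc2⟩ := exists_between hc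
  have h := eventually_lt_of_lt_liminf hc2 (isBoundedUnder_ge_of_nonneg h0 _)
  filter_upwards [eventually_eventually_nhds.2 h] with w hw
  exact hc1.trans_le (le_lowerEnvelope_of_eventually h1 (hw.mono fun _ h => h.le))

end

section

variable (m₀ : ProbabilityMeasure ℝ)

lemma continuousAt_primitive_freeFlow {t : ℝ≥0} (ht : 0 < t) (x : ℝ) :
    ContinuousAt (primitive (freeFlow m₀)) (t, x) := by
  have h1 : ContinuousAt (fun z : ℝ≥0 × ℝ => ((z.1 : ℝ), z.2)) (t, x) :=
    Continuous.continuousAt (by fun_prop)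
  exact ContinuousAt.comp (g := flowCDF (m₀ : Measure ℝ)) (x := (t, x))
    (f := fun z : ℝ≥0 × ℝ => ((z.1 : ℝ), z.2))
    (continuousAt_flowCDF (NNReal.coe_pos.2 ht) x) h1

lemma upperEnvelope_freeFlow {t : ℝ≥0} (ht : 0 < t) (x : ℝ) :
    upperEnvelope (primitive (freeFlow m₀)) (t, x) = flowCDF (m₀ : Measure ℝ) ((t : ℝ), x) :=
  (continuousAt_primitive_freeFlow m₀ ht x).tendsto.limsup_eq

lemma lowerEnvelope_freeFlow {t : ℝ≥0} (ht : 0 < t) (x : ℝ) :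
    lowerEnvelope (primitive (freeFlow m₀)) (t, x) = flowCDF (m₀ : Measure ℝ) ((t : ℝ), x) :=
  (continuousAt_primitive_freeFlow m₀ ht x).tendsto.liminf_eq

lemma isViscositySubsolution_freeFlow :
    IsViscositySubsolution (upperEnvelope (primitive (freeFlow m₀))) := by
  refine ⟨upperSemicontinuous_upperEnvelope (primitive_nonneg _) (primitive_le_one _),
    fun T φ δ t₀ x₀ hφ hδ ht₀ hT hmax => ?_⟩
  have h := flowCDF_inequality (μ := (m₀ : Measure ℝ)) (σ := 1) (by simp) hφ (x₀ := x₀)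
    (NNReal.coe_pos.2 ht₀) (fun t x ht hle => ?_) hδ
  · simp only [one_mul] at h
    simp only [viscosityOperator, upperEnvelope_freeFlow m₀ ht₀]
    exact h
  · lift t to ℝ≥0 using ht.le
    have := hmax (show (t, x) ∈ {z : ℝ≥0 × ℝ | z.1 ≤ T} from (NNReal.coe_le_coe.1 hle).trans hT)
    simp only [Set.mem_ofPred_eq, upperEnvelope_freeFlow m₀ ht₀,
      upperEnvelope_freeFlow m₀ (NNReal.coe_pos.1 ht)] at this
    rwa [one_mul, one_mul]

lemma isViscositySupersolution_freeFlow :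
    IsViscositySupersolution (lowerEnvelope (primitive (freeFlow m₀))) := by
  refine ⟨lowerSemicontinuous_lowerEnvelope (primitive_nonneg _) (primitive_le_one _),
    fun T φ δ t₀ x₀ hφ hδ ht₀ hT hmin => ?_⟩
  have h := flowCDF_inequality (μ := (m₀ : Measure ℝ)) (σ := -1) (by simp) hφ.neg (x₀ := x₀)
    (NNReal.coe_pos.2 ht₀) (fun t x ht hle => ?_) hδ
  · rw [halfLaplacianNear_neg, halfLaplacianFar_const_mul, deriv.fun_neg, deriv.fun_neg] at h
    simp only [viscosityOperator, lowerEnvelope_freeFlow m₀ ht₀]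
    linarith
  · lift t to ℝ≥0 using ht.le
    have := hmin (show (t, x) ∈ {z : ℝ≥0 × ℝ | z.1 ≤ T} from (NNReal.coe_le_coe.1 hle).trans hT)
    simp only [Set.mem_ofPred_eq, lowerEnvelope_freeFlow m₀ ht₀,
      lowerEnvelope_freeFlow m₀ (NNReal.coe_pos.1 ht)] at this
    linarith

/-- The free convolution flow solves the Dyson equation. -/
theorem isSolution_freeFlow : IsSolution m₀ (freeFlow m₀) where
  viscosity :=
    { locally_bounded := fun _ => ⟨1, Eventually.of_forall fun w => by
        rw [abs_of_nonneg (primitive_nonneg _ w)]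
        exact primitive_le_one _ w⟩
      sub := isViscositySubsolution_freeFlow m₀
      super := isViscositySupersolution_freeFlow m₀ }
  initial := freeFlow_zero m₀
  continuousAt_zero := continuousAt_freeFlow_zero m₀

end

end Dyson

theorem mainTheorem8 (m₀ : ProbabilityMeasure ℝ)
    (hm₀ : Integrable (fun x : ℝ => x ^ 2) (m₀ : Measure ℝ)) :
    ∃ m : ℝ≥0 → ProbabilityMeasure ℝ,
      Dyson.IsSolution m₀ m ∧
      (∀ m' : ℝ≥0 → ProbabilityMeasure ℝ, Dyson.IsSolution m₀ m' → m' = m) ∧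
      ∀ p : ℝ≥0∞, 1 ≤ p → ∀ t s : ℝ≥0, t ≤ s →
        Dyson.lpNorm p (m s : Measure ℝ) ≤ Dyson.lpNorm p (m t : Measure ℝ) := by
  refine ⟨Dyson.freeFlow m₀, Dyson.isSolution_freeFlow m₀, fun m' h => ?_, fun p hp t s hts => ?_⟩
  · exact funext fun t => Subtype.ext (h.eq_freeConv t)
  · exact Dyson.lpNorm_freeConv_le hp t.2 (NNReal.coe_le_coe.2 hts)
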